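/- Let $d\ge 1$ and let $A$ be a $d\times d$ integer matrix whose (complex) eigenvalues all have absolute value greater than $1$ (a dilation matrix). Suppose $A$ is isotropic, i.e. diagonalizable over $\mathbb C$ with all eigenvalues equal in absolute value. Put $q=|\det A|$ and $A^{-T}=(A^{T})^{-1}$, and let $$A^{-T}=q^{-1/d}\,Q^{-1}UQ,$$ where $Q$ is a real symmetric positive definite matrix and $U$ is a real orthogonal matrix. Let $Q^2=[q_{ij}]$, $W(\xi)=\xi^TQ^2\xi$, and $$G(\xi)=4\sum_{i} q_{ii}\sin^2\frac{\xi_i}{2}+2\sum_{i<j}q_{ij}\sin\xi_i\sin\xi_j ,$$ a trigonometric polynomial whose Taylor series at $0$ begins with $W$. Let $\mathcal S(A^T)=\{s\in[0,1)^d: A^Ts\in\mathbb Z^d\}$ and define the mask $$m_0(\xi)=\frac{\prod_{s\in\mathcal S(A^T)\setminus\{0\}}G(\xi+2\pi s)}{\prod_{s\in\mathcal S(A^T)\setminus\{0\}}G(2\pi s)},\qquad \hat\phi(\xi)=\prod_{j=1}^{\infty}m_0\big((A^{-T})^{j}\xi\big).$$ For an integer $m\ge1$ let $\phi^m$, the elliptic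 scaling function of order $m$, be the tempered distribution on $\mathbb R^d$ whose Fourier transform (normalized as $\hat f(\xi)=(2\pi)^{-d/2}\int f(x)e^{-i\xi\cdot x}\,dx$) is the function $\hat\phi(\xi)^m$. Let $\mathcal V$ be the space of all real polynomials $P$ on $\mathbb R^d$ contained in the span of the integer shifts of $\phi^m$, that is, those for which there are real coefficients $(c_k)_{k\in\mathbb Z^d}$ with $P=\sum_{k\in\mathbb Z^d}c_k\,\phi^m(\cdot-k)$ in the sense of distributions. Then every $P\in\mathcal V$ satisfies $W(-iD)^mP=0$, where $W(-iD)=-\sum_{j,k}q_{jk}\,\partial_j\partial_k$. Moreover, $\mathcal V$ is affinely invariant: if $P\in\mathcal V$, then $P(\cdot+h)\in\mathcal V$ for all $h\in\mathbb R^d$ and $P(t\,\cdot)\in\mathcal V$ for all $t\in\mathbb R$. -/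

import Mathlib

open scoped Matrix SchwartzMap FourierTransform

namespace EllipticScaling

noncomputable section

/-- An integer matrix all of whose complex eigenvalues are greater than `1` in absolute value. -/
def IsDilationMatrix {d : ℕ} (A : Matrix (Fin d) (Fin d) ℤ) : Prop :=
  ∀ μ ∈ spectrum ℂ (A.map (Int.cast : ℤ → ℂ)), 1 < ‖μ‖

/-- A matrix that is diagonalizable over `ℂ` and whose eigenvalues are all equal in absolute
value. -/
def IsIsotropic {d : ℕ} (A : Matrix (Fin d) (Fin d) ℤ) : Prop :=
  ∃ (T : Matrix (Fin d) (Fin d) ℂ) (μ : Fin d → ℂ), IsUnit T ∧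
    A.map (Int.cast : ℤ → ℂ) = T * Matrix.diagonal μ * T⁻¹ ∧ ∀ i j, ‖μ i‖ = ‖μ j‖

/-- The real matrix `A⁻ᵀ`, the inverse of the transpose of `A`. -/
def invTranspose {d : ℕ} (A : Matrix (Fin d) (Fin d) ℤ) : Matrix (Fin d) (Fin d) ℝ :=
  ((A.map (Int.cast : ℤ → ℝ))ᵀ)⁻¹

/-- The factorization `A⁻ᵀ = q ^ (-1/d) Q⁻¹ U Q`, `q = |det A|`, with `Q` symmetric positive
definite and `U` orthogonal. -/
structure IsFactorization {d : ℕ} (A : Matrix (Fin d) (Fin d) ℤ)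
    (Q U : Matrix (Fin d) (Fin d) ℝ) : Prop where
  posDef : Q.PosDef
  orthogonal : U ∈ Matrix.orthogonalGroup (Fin d) ℝ
  factor : invTranspose A = (|(A.det : ℝ)| ^ (-(1 / (d : ℝ)))) • (Q⁻¹ * U * Q)

/-- The trigonometric polynomial
`G(ξ) = 4 ∑ᵢ qᵢᵢ sin²(ξᵢ/2) + 2 ∑_{i<j} qᵢⱼ sin ξᵢ sin ξⱼ`, where `Q² = [qᵢⱼ]`. -/
def trigG {d : ℕ} (Q : Matrix (Fin d) (Fin d) ℝ) (ξ : Fin d → ℝ) : ℝ :=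
  4 * ∑ i, (Q ^ 2) i i * Real.sin (ξ i / 2) ^ 2 +
    2 * ∑ i, ∑ j ∈ Finset.Ioi i, (Q ^ 2) i j * Real.sin (ξ i) * Real.sin (ξ j)

/-- The set `𝒮(M)` of all `s ∈ [0,1)^d` with `M s ∈ ℤ^d`. -/
def digitSet {d : ℕ} (M : Matrix (Fin d) (Fin d) ℤ) : Set (Fin d → ℝ) :=
  {s | (∀ i, s i ∈ Set.Ico (0 : ℝ) 1) ∧
    ∃ k : Fin d → ℤ, (M.map (Int.cast : ℤ → ℝ)) *ᵥ s = fun i => (k i : ℝ)}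

/-- The mask `m₀(ξ) = ∏ G(ξ + 2πs) / ∏ G(2πs)`, both products over `s ∈ 𝒮(Aᵀ) \ {0}`
(a finite set, see `digitSet_finite`). -/
def mask {d : ℕ} (A : Matrix (Fin d) (Fin d) ℤ) (Q : Matrix (Fin d) (Fin d) ℝ)
    (ξ : Fin d → ℝ) : ℝ :=
  (∏ᶠ s ∈ digitSet Aᵀ \ {0}, trigG Q (ξ + (2 * Real.pi) • s)) /
    ∏ᶠ s ∈ digitSet Aᵀ \ {0}, trigG Q ((2 * Real.pi) • s)

/-- `φ̂(ξ) = ∏_{j ≥ 1} m₀((A⁻ᵀ)^j ξ)`. -/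
def phiHat {d : ℕ} (A : Matrix (Fin d) (Fin d) ℤ) (Q : Matrix (Fin d) (Fin d) ℝ)
    (ξ : Fin d → ℝ) : ℝ :=
  ∏' j : ℕ, mask A Q ((invTranspose A ^ (j + 1)) *ᵥ ξ)

/-- A measurable function bounded by `C (1 + |x|)^N`. -/
def IsSlowlyIncreasing {d : ℕ} (F : EuclideanSpace ℝ (Fin d) → ℂ) : Prop :=
  Measurable F ∧ ∃ (C : ℝ) (N : ℕ), ∀ x, ‖F x‖ ≤ C * (1 + ‖x‖) ^ N

lemma integrable_mul_schwartz {d : ℕ} {F : EuclideanSpace ℝ (Fin d) → ℂ}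
    (hF : IsSlowlyIncreasing F) (ψ : 𝓢(EuclideanSpace ℝ (Fin d), ℂ)) :
    MeasureTheory.Integrable (fun x => F x * ψ x) := by
  obtain ⟨hm, C, N, hC⟩ := hF
  have h1 : MeasureTheory.Integrable
      (fun x => |C| * 2 ^ N * (‖x‖ ^ 0 * ‖ψ x‖ + ‖x‖ ^ N * ‖ψ x‖)) :=
    ((ψ.integrable_pow_mul MeasureTheory.volume 0).add
      (ψ.integrable_pow_mul MeasureTheory.volume N)).const_mul _
  refine h1.mono' (hm.aestronglyMeasurable.mul ψ.continuous.aestronglyMeasurable)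
    (Filter.Eventually.of_forall fun x => ?_)
  rw [norm_mul]
  have h2 : (1 + ‖x‖) ^ N ≤ 2 ^ N * (1 + ‖x‖ ^ N) := by
    rcases le_total ‖x‖ 1 with h | h
    · have : (1 + ‖x‖) ^ N ≤ 2 ^ N := by gcongr; linarith
      nlinarith [pow_nonneg (norm_nonneg x) N, pow_pos (two_pos : (0 : ℝ) < 2) N]
    · have : (1 + ‖x‖) ^ N ≤ (2 * ‖x‖) ^ N := by gcongr; linarith
      rw [mul_pow] at this
      nlinarith [pow_pos (two_pos : (0 : ℝ) < 2) N]
  calc ‖F x‖ * ‖ψ x‖ ≤ (|C| * (2 ^ N * (1 + ‖x‖ ^ N))) * ‖ψ x‖ := by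
        gcongr
        exact (hC x).trans (mul_le_mul (le_abs_self C) h2 (by positivity) (abs_nonneg C))
    _ = _ := by ring

/-- A slowly increasing function `F` as a tempered distribution, `ψ ↦ ∫ F ψ`. -/
def IsSlowlyIncreasing.toTempered {d : ℕ} {F : EuclideanSpace ℝ (Fin d) → ℂ}
    (hF : IsSlowlyIncreasing F) : 𝓢'(EuclideanSpace ℝ (Fin d), ℂ) :=
  ContinuousLinearMap.toPointwiseConvergenceCLM _ _ _ _ <|
    SchwartzMap.mkCLMtoNormedSpace (𝕜 := ℂ) (σ := RingHom.id ℂ) (fun ψ => ∫ x, F x * ψ x)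
      (fun ψ χ => by
        simp only [add_apply, mul_add]
        exact MeasureTheory.integral_add (integrable_mul_schwartz hF ψ)
          (integrable_mul_schwartz hF χ))
      (fun a ψ => by
        simp only [smul_apply, smul_eq_mul, RingHom.id_apply, mul_left_comm _ a]
        exact MeasureTheory.integral_const_mul _ _)
      (by
        obtain ⟨hm, C, N, hC⟩ := hF
        obtain ⟨n, h⟩ := (inferInstance :
          (MeasureTheory.volume : MeasureTheory.Measure
            (EuclideanSpace ℝ (Fin d))).HasTemperateGrowth).exists_integrable
        refine ⟨Finset.Iic (N + n, 0), |C| * 2 ^ (N + n) *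
          ∫ x : EuclideanSpace ℝ (Fin d), (1 + ‖x‖) ^ (-(n : ℝ)), by positivity, fun ψ => ?_⟩
        refine (MeasureTheory.norm_integral_le_integral_norm _).trans ?_
        have h' : ∀ x, ‖F x * ψ x‖ ≤ (1 + ‖x‖) ^ (-(n : ℝ)) *
            (|C| * 2 ^ (N + n) *
              ((Finset.Iic (N + n, 0)).sup (schwartzSeminormFamily ℂ _ _) ψ)) := by
          intro x
          have h0 := SchwartzMap.one_add_le_sup_seminorm_apply (𝕜 := ℂ) (m := (N + n, 0))
            (k := N + n) (n := 0) le_rfl le_rfl ψ x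
          rw [norm_iteratedFDeriv_zero] at h0
          rw [Real.rpow_neg (by positivity), ← div_eq_inv_mul, le_div_iff₀' (by positivity),
            Real.rpow_natCast, norm_mul]
          calc (1 + ‖x‖) ^ n * (‖F x‖ * ‖ψ x‖)
              ≤ (1 + ‖x‖) ^ n * ((|C| * (1 + ‖x‖) ^ N) * ‖ψ x‖) := by
                gcongr
                exact (hC x).trans (by gcongr; exact le_abs_self C)
            _ = |C| * ((1 + ‖x‖) ^ (N + n) * ‖ψ x‖) := by ring
            _ ≤ |C| * (2 ^ (N + n) *
              ((Finset.Iic (N + n, 0)).sup (schwartzSeminormFamily ℂ _ _) ψ)) := by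
                exact mul_le_mul_of_nonneg_left h0 (abs_nonneg C)
            _ = _ := by ring
        refine (MeasureTheory.integral_mono
          (integrable_mul_schwartz ⟨hm, C, N, hC⟩ ψ).norm (h.mul_const _) h').trans ?_
        rw [MeasureTheory.integral_mul_const]
        exact le_of_eq (by ring))

lemma IsSlowlyIncreasing.toTempered_apply {d : ℕ} {F : EuclideanSpace ℝ (Fin d) → ℂ}
    (hF : IsSlowlyIncreasing F) (ψ : 𝓢(EuclideanSpace ℝ (Fin d), ℂ)) :
    hF.toTempered ψ = ∫ x, F x * ψ x := rfl

lemma digitSet_finite {d : ℕ} {M : Matrix (Fin d) (Fin d) ℤ} (hM : M.det ≠ 0) :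
    (digitSet M).Finite := by
  set R : Matrix (Fin d) (Fin d) ℝ := M.map (Int.cast : ℤ → ℝ) with hR
  have hdet : IsUnit R.det := by
    have : R.det = (M.det : ℝ) := (Int.cast_det M).symm
    rw [this]
    exact isUnit_iff_ne_zero.2 (by exact_mod_cast hM)
  refine ((Set.finite_Icc (fun i => -∑ j, |M i j|) (fun i => ∑ j, |M i j|)).image
    (fun k : Fin d → ℤ => R⁻¹ *ᵥ (fun i => (k i : ℝ)))).subset ?_
  rintro s ⟨hs, k, hk⟩
  refine ⟨k, ?_, ?_⟩
  · have hb : ∀ i, |(k i : ℝ)| ≤ ∑ j, |(M i j : ℝ)| := by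
      intro i
      have : (k i : ℝ) = ∑ j, (M i j : ℝ) * s j := by
        rw [← congrFun hk i]; rfl
      rw [this]
      refine (Finset.abs_sum_le_sum_abs _ _).trans (Finset.sum_le_sum fun j _ => ?_)
      rw [abs_mul]
      exact mul_le_of_le_one_right (abs_nonneg _)
        (abs_le.2 ⟨by linarith [(hs j).1], (hs j).2.le⟩)
    have hb' : ∀ i, |k i| ≤ ∑ j, |M i j| := fun i => by exact_mod_cast hb i
    exact ⟨fun i => (abs_le.1 (hb' i)).1, fun i => (abs_le.1 (hb' i)).2⟩
  · change R⁻¹ *ᵥ (fun i => (k i : ℝ)) = s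
    rw [← hk, Matrix.mulVec_mulVec, Matrix.nonsing_inv_mul _ hdet, Matrix.one_mulVec]

lemma sum_symm_eq {d : ℕ} (M : Matrix (Fin d) (Fin d) ℝ) (hM : M.IsSymm) (x : Fin d → ℝ) :
    ∑ i, ∑ j, M i j * x i * x j =
      ∑ i, M i i * x i ^ 2 + 2 * ∑ i, ∑ j ∈ Finset.Ioi i, M i j * x i * x j := by
  have h1 : ∀ i, ∑ j, M i j * x i * x j = ∑ j ∈ Finset.Iio i, M i j * x i * x j +
      M i i * x i ^ 2 + ∑ j ∈ Finset.Ioi i, M i j * x i * x j := by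
    intro i
    rw [← Finset.sum_erase_add _ _ (Finset.mem_univ i)]
    have : Finset.univ.erase i = Finset.Iio i ∪ Finset.Ioi i := by
      ext j; simp [lt_or_lt_iff_ne]
    rw [this, Finset.sum_union (Finset.disjoint_left.2 fun a ha hb =>
      absurd (Finset.mem_Iio.1 ha) (not_lt.2 (Finset.mem_Ioi.1 hb).le))]
    ring
  have h2 : ∑ i, ∑ j ∈ Finset.Iio i, M i j * x i * x j =
      ∑ i, ∑ j ∈ Finset.Ioi i, M i j * x i * x j := by
    rw [Finset.sum_comm' (t' := Finset.univ) (s' := fun j => Finset.Ioi j) (by simp)]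
    refine Finset.sum_congr rfl fun i _ => Finset.sum_congr rfl fun j _ => ?_
    rw [hM.apply]; ring
  simp only [h1, Finset.sum_add_distrib, h2]
  ring

lemma trigG_eq {d : ℕ} {Q : Matrix (Fin d) (Fin d) ℝ} (hQ : Q.PosDef) (ξ : Fin d → ℝ) :
    trigG Q ξ = (∑ i, ((Q *ᵥ fun j => Real.sin (ξ j)) i) ^ 2) +
      4 * ∑ i, (Q ^ 2) i i * Real.sin (ξ i / 2) ^ 4 := by
  have hs : Qᵀ = Q := by simpa using hQ.1.eq
  have hs2 : (Q ^ 2).IsSymm := by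
    rw [Matrix.IsSymm, Matrix.transpose_pow, hs]
  have h1 : ∑ i, ((Q *ᵥ fun j => Real.sin (ξ j)) i) ^ 2 =
      ∑ i, ∑ j, (Q ^ 2) i j * Real.sin (ξ i) * Real.sin (ξ j) := by
    set v : Fin d → ℝ := fun j => Real.sin (ξ j) with hv
    calc ∑ i, ((Q *ᵥ v) i) ^ 2 = (Q *ᵥ v) ⬝ᵥ (Q *ᵥ v) := by
          simp only [dotProduct, sq]
      _ = v ⬝ᵥ ((Q ^ 2) *ᵥ v) := by
          rw [Matrix.dotProduct_mulVec, ← Matrix.mulVec_transpose, hs, Matrix.mulVec_mulVec,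
            ← sq, dotProduct_comm]
      _ = _ := by
          simp only [dotProduct, Matrix.mulVec, Finset.mul_sum, hv]
          exact Finset.sum_congr rfl fun i _ => Finset.sum_congr rfl fun j _ => by ring
  rw [h1, sum_symm_eq _ hs2 (fun i => Real.sin (ξ i)), trigG, add_right_comm]
  congr 1
  rw [Finset.mul_sum, Finset.mul_sum, ← Finset.sum_add_distrib]
  refine Finset.sum_congr rfl fun i _ => ?_
  have h2 : Real.sin (ξ i) = 2 * Real.sin (ξ i / 2) * Real.cos (ξ i / 2) := by
    rw [← Real.sin_two_mul]; ring_nf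
  rw [h2]
  have h3 := Real.sin_sq_add_cos_sq (ξ i / 2)
  have : Real.cos (ξ i / 2) ^ 2 = 1 - Real.sin (ξ i / 2) ^ 2 := by linarith
  rw [mul_pow, this]; ring

lemma trigG_ne_zero {d : ℕ} {Q : Matrix (Fin d) (Fin d) ℝ} (hQ : Q.PosDef) {s : Fin d → ℝ}
    (hs : ∀ i, s i ∈ Set.Ico (0 : ℝ) 1) (h0 : s ≠ 0) :
    trigG Q ((2 * Real.pi) • s) ≠ 0 := by
  have hQ2 : ∀ i, 0 < (Q ^ 2) i i := by
    intro i
    have h : (Q ^ 2).PosDef := by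
      have := Matrix.PosDef.conjTranspose_mul_self Q
        (Matrix.mulVec_injective_iff_isUnit.2 hQ.isUnit)
      rwa [hQ.1.eq, ← sq] at this
    exact h.diag_pos
  obtain ⟨i, hi⟩ := Function.ne_iff.1 h0
  have hi0 : 0 < s i := lt_of_le_of_ne (hs i).1 (Ne.symm hi)
  have hsin : 0 < Real.sin (((2 * Real.pi) • s) i / 2) := by
    apply Real.sin_pos_of_pos_of_lt_pi
    · simp only [Pi.smul_apply, smul_eq_mul]; have := Real.pi_pos; positivity
    · simp only [Pi.smul_apply, smul_eq_mul]; nlinarith [Real.pi_pos, (hs i).2]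
  rw [trigG_eq hQ]
  apply ne_of_gt
  have h1 : 0 < ∑ i, (Q ^ 2) i i * Real.sin (((2 * Real.pi) • s) i / 2) ^ 4 :=
    Finset.sum_pos' (fun j _ => mul_nonneg (hQ2 j).le (by positivity))
      ⟨i, Finset.mem_univ i, mul_pos (hQ2 i) (by positivity)⟩
  have h2 : 0 ≤ ∑ i, ((Q *ᵥ fun j => Real.sin (((2 * Real.pi) • s) j)) i) ^ 2 :=
    Finset.sum_nonneg fun _ _ => sq_nonneg _
  linarith

lemma trigG_differentiable {d : ℕ} (Q : Matrix (Fin d) (Fin d) ℝ) :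
    Differentiable ℝ (trigG Q) := by
  unfold trigG
  fun_prop

lemma trigG_bounded {d : ℕ} (Q : Matrix (Fin d) (Fin d) ℝ) :
    ∃ C, ∀ ξ, |trigG Q ξ| ≤ C := by
  refine ⟨4 * ∑ i, |(Q ^ 2) i i| + 2 * ∑ i, ∑ j ∈ Finset.Ioi i, |(Q ^ 2) i j|, fun ξ => ?_⟩
  unfold trigG
  refine (abs_add_le _ _).trans ?_
  rw [abs_mul, abs_mul, abs_of_pos (four_pos : (0 : ℝ) < 4), abs_of_pos (two_pos : (0 : ℝ) < 2)]
  gcongr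
  · refine (Finset.abs_sum_le_sum_abs _ _).trans (Finset.sum_le_sum fun i _ => ?_)
    rw [abs_mul]
    exact mul_le_of_le_one_right (abs_nonneg _) (by
      rw [abs_of_nonneg (sq_nonneg _)]; exact Real.sin_sq_le_one _)
  · refine (Finset.abs_sum_le_sum_abs _ _).trans (Finset.sum_le_sum fun i _ => ?_)
    refine (Finset.abs_sum_le_sum_abs _ _).trans (Finset.sum_le_sum fun j _ => ?_)
    rw [abs_mul, abs_mul]
    exact (mul_le_of_le_one_right (by positivity) (Real.abs_sin_le_one _)).trans
      (mul_le_of_le_one_right (by positivity) (Real.abs_sin_le_one _))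

section maskProps

variable {d : ℕ} {A : Matrix (Fin d) (Fin d) ℤ} {Q : Matrix (Fin d) (Fin d) ℝ}

lemma mask_eq (hA : A.det ≠ 0) (Q : Matrix (Fin d) (Fin d) ℝ) :
    ∃ S : Finset (Fin d → ℝ), (∀ s ∈ S, s ∈ digitSet Aᵀ \ {0}) ∧
      mask A Q = fun ξ => (∏ s ∈ S, trigG Q (ξ + (2 * Real.pi) • s)) /
        ∏ s ∈ S, trigG Q ((2 * Real.pi) • s) := by
  have hf : (digitSet Aᵀ \ {0}).Finite :=
    (digitSet_finite (by rwa [Matrix.det_transpose])).subset Set.sdiff_subset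
  refine ⟨hf.toFinset, fun s hs => hf.mem_toFinset.1 hs, ?_⟩
  funext ξ
  rw [mask, finprod_mem_eq_finite_toFinset_prod _ hf, finprod_mem_eq_finite_toFinset_prod _ hf]

lemma mask_differentiable (hA : A.det ≠ 0) : Differentiable ℝ (mask A Q) := by
  obtain ⟨S, -, hS⟩ := mask_eq hA Q
  have := trigG_differentiable Q
  simp only [hS, div_eq_mul_inv]
  refine Differentiable.mul_const (𝕜 := ℝ) ?_ _
  classical
  exact fun ξ => (HasFDerivAt.finsetProd fun s _ =>
    ((this.comp (differentiable_id.add_const _)) ξ).hasFDerivAt).differentiableAt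

lemma mask_zero (hA : A.det ≠ 0) (hQ : Q.PosDef) : mask A Q 0 = 1 := by
  obtain ⟨S, hS', hS⟩ := mask_eq hA Q
  rw [hS]
  simp only [zero_add]
  exact div_self (Finset.prod_ne_zero_iff.2 fun s hs =>
    trigG_ne_zero hQ (hS' s hs).1.1 (hS' s hs).2)

lemma mask_bounded (hA : A.det ≠ 0) : ∃ M, ∀ ξ, |mask A Q ξ| ≤ M := by
  obtain ⟨S, -, hS⟩ := mask_eq hA Q
  obtain ⟨C, hC⟩ := trigG_bounded Q
  refine ⟨(∏ _s ∈ S, C) / |∏ s ∈ S, trigG Q ((2 * Real.pi) • s)|, fun ξ => ?_⟩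
  rw [hS, abs_div, Finset.abs_prod]
  gcongr
  exact hC _

lemma mask_sub_one (hA : A.det ≠ 0) (hQ : Q.PosDef) :
    ∃ C, 0 ≤ C ∧ ∀ ξ, |mask A Q ξ - 1| ≤ C * ‖ξ‖ := by
  obtain ⟨M, hM⟩ := mask_bounded (Q := Q) hA
  have h1 := ((mask_differentiable (Q := Q) hA) 0).isBigO_sub
  rw [mask_zero hA hQ] at h1
  obtain ⟨C, hC⟩ := h1.bound
  obtain ⟨δ, hδ, hb⟩ := Metric.eventually_nhds_iff.1 hC
  have hM0 : 0 ≤ M := (abs_nonneg _).trans (hM 0)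
  refine ⟨|C| + (M + 1) / δ, by positivity, fun ξ => ?_⟩
  rcases lt_or_ge ‖ξ‖ δ with h | h
  · have := hb (y := ξ) (by simpa using h)
    simp only [Real.norm_eq_abs, sub_zero] at this
    refine this.trans ?_
    gcongr
    exact (le_abs_self C).trans (le_add_of_nonneg_right (by positivity))
  · calc |mask A Q ξ - 1| ≤ |mask A Q ξ| + |(1 : ℝ)| := abs_sub _ _
      _ ≤ M + 1 := by rw [abs_one]; gcongr; exact hM ξ
      _ = (M + 1) / δ * δ := by field_simp
      _ ≤ (|C| + (M + 1) / δ) * ‖ξ‖ := by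
        gcongr
        exact le_add_of_nonneg_left (abs_nonneg C)

end maskProps
section infiniteProduct

variable {d : ℕ} {A : Matrix (Fin d) (Fin d) ℤ} {Q U : Matrix (Fin d) (Fin d) ℝ}

lemma one_lt_abs_det (hd : 0 < d) (hA : IsDilationMatrix A) : 1 < |(A.det : ℝ)| := by
  set R : Matrix (Fin d) (Fin d) ℂ := A.map (Int.cast : ℤ → ℂ) with hR
  have h1 : R.det = (A.det : ℂ) := (Int.cast_det A).symm
  have h2 : ‖R.det‖ = |(A.det : ℝ)| := by rw [h1, Complex.norm_intCast]
  rw [← h2, Matrix.det_eq_prod_roots_charpoly]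
  have h3 : ∀ μ ∈ R.charpoly.roots, 1 < ‖μ‖ := fun μ hμ =>
    hA μ (Matrix.mem_spectrum_iff_isRoot_charpoly.2 (Polynomial.isRoot_of_mem_roots hμ))
  have h4 : R.charpoly.roots.card = d := by
    rw [IsAlgClosed.card_roots_eq_natDegree, Matrix.charpoly_natDegree_eq_dim, Fintype.card_fin]
  have key : ∀ s : Multiset ℂ, (∀ μ ∈ s, 1 < ‖μ‖) → 1 ≤ ‖s.prod‖ ∧ (s ≠ 0 → 1 < ‖s.prod‖) := by
    intro s
    induction s using Multiset.induction with
    | empty => simp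
    | cons a s ih =>
      intro h
      have ha := h a (Multiset.mem_cons_self a s)
      have hs := (ih fun μ hμ => h μ (Multiset.mem_cons_of_mem hμ)).1
      rw [Multiset.prod_cons, norm_mul]
      have : 1 < ‖a‖ * ‖s.prod‖ := by nlinarith
      exact ⟨this.le, fun _ => this⟩
  refine (key _ h3).2 ?_
  rintro h
  rw [h] at h4
  simp at h4
  omega

/-- The Euclidean length of `Q ξ`. -/
def qNorm (Q : Matrix (Fin d) (Fin d) ℝ) (ξ : Fin d → ℝ) : ℝ :=
  Real.sqrt ((Q *ᵥ ξ) ⬝ᵥ (Q *ᵥ ξ))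

lemma qNorm_contract (h : IsFactorization A Q U) (ξ : Fin d → ℝ) :
    qNorm Q (invTranspose A *ᵥ ξ) = |(A.det : ℝ)| ^ (-(1 / (d : ℝ))) * qNorm Q ξ := by
  have hQ : IsUnit Q.det := (Matrix.isUnit_iff_isUnit_det Q).1 h.posDef.isUnit
  have hU : Uᵀ * U = 1 := by
    have := (Matrix.mem_orthogonalGroup_iff' (Fin d) ℝ).1 h.orthogonal
    simpa using this
  have h1 : Q *ᵥ (invTranspose A *ᵥ ξ) =
      (|(A.det : ℝ)| ^ (-(1 / (d : ℝ)))) • (U *ᵥ (Q *ᵥ ξ)) := by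
    rw [h.factor, Matrix.smul_mulVec, Matrix.mulVec_smul, Matrix.mulVec_mulVec,
      Matrix.mulVec_mulVec, Matrix.mul_assoc, Matrix.mul_nonsing_inv_cancel_left _ _ hQ]
  have h2 : (U *ᵥ (Q *ᵥ ξ)) ⬝ᵥ (U *ᵥ (Q *ᵥ ξ)) = (Q *ᵥ ξ) ⬝ᵥ (Q *ᵥ ξ) := by
    rw [Matrix.dotProduct_mulVec, ← Matrix.mulVec_transpose, Matrix.mulVec_mulVec, hU,
      Matrix.one_mulVec]
  have h3 : (0 : ℝ) ≤ |(A.det : ℝ)| ^ (-(1 / (d : ℝ))) := Real.rpow_nonneg (abs_nonneg _) _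
  rw [qNorm, h1, smul_dotProduct, dotProduct_smul, h2, smul_eq_mul, smul_eq_mul, ← mul_assoc,
    Real.sqrt_mul (mul_nonneg h3 h3), Real.sqrt_mul_self h3, qNorm]

lemma norm_le_sqrt_dot (v : Fin d → ℝ) : ‖v‖ ≤ Real.sqrt (v ⬝ᵥ v) := by
  refine (pi_norm_le_iff_of_nonneg (Real.sqrt_nonneg _)).2 fun i => ?_
  rw [Real.norm_eq_abs, ← Real.sqrt_sq_eq_abs]
  apply Real.sqrt_le_sqrt
  rw [dotProduct, sq]
  exact Finset.single_le_sum (f := fun i => v i * v i) (fun j _ => mul_self_nonneg _)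
    (Finset.mem_univ i)

lemma norm_le_qNorm (hQ : Q.PosDef) : ∃ K, 0 ≤ K ∧ ∀ ξ, ‖ξ‖ ≤ K * qNorm Q ξ := by
  have hQ' : IsUnit Q.det := (Matrix.isUnit_iff_isUnit_det Q).1 hQ.isUnit
  let L := LinearMap.toContinuousLinearMap (Matrix.toLin' Q⁻¹)
  refine ⟨‖L‖, norm_nonneg _, fun ξ => ?_⟩
  have h1 : L (Q *ᵥ ξ) = ξ := by
    change Q⁻¹ *ᵥ (Q *ᵥ ξ) = ξ
    rw [Matrix.mulVec_mulVec, Matrix.nonsing_inv_mul _ hQ', Matrix.one_mulVec]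
  calc ‖ξ‖ = ‖L (Q *ᵥ ξ)‖ := by rw [h1]
    _ ≤ ‖L‖ * ‖Q *ᵥ ξ‖ := L.le_opNorm _
    _ ≤ ‖L‖ * qNorm Q ξ := by gcongr; exact norm_le_sqrt_dot _

lemma qNorm_le (Q : Matrix (Fin d) (Fin d) ℝ) :
    ∃ K, 0 ≤ K ∧ ∀ ξ : EuclideanSpace ℝ (Fin d), qNorm Q ξ ≤ K * ‖ξ‖ := by
  let L := Matrix.toEuclideanCLM (n := Fin d) (𝕜 := ℝ) Q
  refine ⟨‖L‖, norm_nonneg _, fun ξ => ?_⟩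
  have h1 : qNorm Q ξ = ‖L ξ‖ := by
    rw [EuclideanSpace.norm_eq, qNorm]
    congr 1
    simp only [dotProduct, Real.norm_eq_abs, sq_abs, ← sq]
    rfl
  rw [h1]
  exact L.le_opNorm _

lemma multipliable_and_bound {a : ℕ → ℝ} {C ρ : ℝ} (hC : 0 ≤ C) (hρ0 : 0 ≤ ρ) (hρ : ρ < 1)
    (ha : ∀ j, |a j - 1| ≤ C * ρ ^ j) :
    Multipliable a ∧ |∏' j, a j| ≤ Real.exp (C * (1 - ρ)⁻¹) := by
  have hsum : Summable fun j => C * ρ ^ j := (summable_geometric_of_lt_one hρ0 hρ).mul_left C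
  have hm : Multipliable a := by
    have := Real.multipliable_one_add_of_summable (f := fun j => a j - 1)
      (hsum.of_norm_bounded ha)
    simpa using this
  refine ⟨hm, ?_⟩
  have ht := (hm.hasProd.tendsto_prod_nat).abs
  refine le_of_tendsto ht (Filter.Eventually.of_forall fun n => ?_)
  rw [Finset.abs_prod]
  calc ∏ j ∈ Finset.range n, |a j| ≤ ∏ j ∈ Finset.range n, Real.exp (C * ρ ^ j) := by
        refine Finset.prod_le_prod (fun _ _ => abs_nonneg _) fun j _ => ?_
        have h1 : |a j| ≤ |a j - 1| + 1 := by
          have := abs_add_le (a j - 1) 1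
          simpa using this
        linarith [ha j, Real.add_one_le_exp (C * ρ ^ j)]
    _ = Real.exp (∑ j ∈ Finset.range n, C * ρ ^ j) := (Real.exp_sum _ _).symm
    _ ≤ Real.exp (C * (1 - ρ)⁻¹) := by
        apply Real.exp_le_exp.2
        rw [← tsum_geometric_of_lt_one hρ0 hρ, ← tsum_mul_left]
        exact hsum.sum_le_tsum _ fun j _ => by positivity

lemma rho_mem (hd : 0 < d) (hA : IsDilationMatrix A) :
    0 < |(A.det : ℝ)| ^ (-(1 / (d : ℝ))) ∧ |(A.det : ℝ)| ^ (-(1 / (d : ℝ))) < 1 := by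
  have h := one_lt_abs_det hd hA
  refine ⟨Real.rpow_pos_of_pos (by linarith) _, Real.rpow_lt_one_of_one_lt_of_neg h ?_⟩
  have : (0 : ℝ) < d := by exact_mod_cast hd
  simp [hd]

lemma det_ne_zero (hd : 0 < d) (hA : IsDilationMatrix A) : A.det ≠ 0 := by
  intro h
  have := one_lt_abs_det hd hA
  simp [h] at this
  linarith

lemma qNorm_pow (h : IsFactorization A Q U) (ξ : Fin d → ℝ) (j : ℕ) :
    qNorm Q ((invTranspose A ^ j) *ᵥ ξ) =
      (|(A.det : ℝ)| ^ (-(1 / (d : ℝ)))) ^ j * qNorm Q ξ := by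
  induction j with
  | zero => simp
  | succ j ih =>
    rw [pow_succ', ← Matrix.mulVec_mulVec, qNorm_contract h, ih]; ring

lemma mask_factor_bound (hd : 0 < d) (hA : IsDilationMatrix A) (h : IsFactorization A Q U) :
    ∃ C, 0 ≤ C ∧ ∀ (ξ : Fin d → ℝ) (j : ℕ), |mask A Q ((invTranspose A ^ (j + 1)) *ᵥ ξ) - 1| ≤
      C * qNorm Q ξ * (|(A.det : ℝ)| ^ (-(1 / (d : ℝ)))) ^ j := by
  obtain ⟨C, hC, hb⟩ := mask_sub_one (det_ne_zero hd hA) h.posDef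
  obtain ⟨K, hK, hk⟩ := norm_le_qNorm h.posDef
  obtain ⟨hρ0, hρ1⟩ := rho_mem hd hA
  refine ⟨C * K, by positivity, fun ξ j => ?_⟩
  have h0 : 0 ≤ qNorm Q ξ := Real.sqrt_nonneg _
  refine (hb _).trans ?_
  refine (mul_le_mul_of_nonneg_left (hk _) hC).trans ?_
  rw [qNorm_pow h, pow_succ, ← mul_assoc, ← mul_assoc]
  set ρ := |(A.det : ℝ)| ^ (-(1 / (d : ℝ)))
  calc C * K * (ρ ^ j * ρ) * qNorm Q ξ = (C * K * qNorm Q ξ * ρ ^ j) * ρ := by ring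
    _ ≤ (C * K * qNorm Q ξ * ρ ^ j) * 1 := by gcongr
    _ = _ := by ring

/-- The infinite product defining `φ̂` converges at every point. -/
lemma multipliable_phiHat (hd : 0 < d) (hA : IsDilationMatrix A) (h : IsFactorization A Q U)
    (ξ : Fin d → ℝ) : Multipliable fun j : ℕ => mask A Q ((invTranspose A ^ (j + 1)) *ᵥ ξ) := by
  obtain ⟨C, hC, hb⟩ := mask_factor_bound hd hA h
  obtain ⟨hρ0, hρ1⟩ := rho_mem hd hA
  exact (multipliable_and_bound (mul_nonneg hC (Real.sqrt_nonneg _)) hρ0.le hρ1 (hb ξ)).1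

lemma phiHat_refine (hd : 0 < d) (hA : IsDilationMatrix A) (h : IsFactorization A Q U)
    (ξ : Fin d → ℝ) :
    phiHat A Q ξ = mask A Q (invTranspose A *ᵥ ξ) * phiHat A Q (invTranspose A *ᵥ ξ) := by
  have key : ∀ f : ℕ → ℝ, (Multipliable fun j => f (j + 1)) →
      ∏' j, f j = f 0 * ∏' j, f (j + 1) := fun f hf => tprod_eq_zero_mul' hf
  have hstep : ∀ j : ℕ, (invTranspose A ^ (j + 1)) *ᵥ (invTranspose A *ᵥ ξ) =
      (invTranspose A ^ (j + 1 + 1)) *ᵥ ξ := fun j => by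
    rw [Matrix.mulVec_mulVec, ← pow_succ]
  have h1 := multipliable_phiHat hd hA h (invTranspose A *ᵥ ξ)
  simp only [hstep] at h1
  have h2 := key (fun j => mask A Q ((invTranspose A ^ (j + 1)) *ᵥ ξ)) h1
  simp only [phiHat, hstep]
  rw [h2, zero_add, pow_one]

lemma phiHat_growth (hd : 0 < d) (hA : IsDilationMatrix A) (h : IsFactorization A Q U) :
    ∃ (C : ℝ) (p : ℕ), 0 ≤ C ∧ ∀ ξ, |phiHat A Q ξ| ≤
      C * (max 1 (qNorm Q ξ / |(A.det : ℝ)| ^ (-(1 / (d : ℝ))))) ^ p := by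
  obtain ⟨C, hC, hb⟩ := mask_factor_bound hd hA h
  obtain ⟨hρ0, hρ1⟩ := rho_mem hd hA
  obtain ⟨M, hM⟩ := mask_bounded (Q := Q) (det_ne_zero hd hA)
  have hcon := qNorm_contract h
  set ρ := |(A.det : ℝ)| ^ (-(1 / (d : ℝ))) with hρ
  have hM0 : 0 ≤ M := (abs_nonneg _).trans (hM 0)
  obtain ⟨p, hp⟩ := pow_unbounded_of_one_lt M (one_lt_inv_iff₀.2 ⟨hρ0, hρ1⟩)
  set C0 := Real.exp (C * (1 - ρ)⁻¹) with hC0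
  have hinv : 0 ≤ (1 - ρ)⁻¹ := inv_nonneg.2 (by linarith)
  have base : ∀ ξ, qNorm Q ξ ≤ 1 → |phiHat A Q ξ| ≤ C0 := by
    intro ξ hξ
    refine (multipliable_and_bound (mul_nonneg hC (Real.sqrt_nonneg _)) hρ0.le hρ1 (hb ξ)).2.trans
      (Real.exp_le_exp.2 ?_)
    exact mul_le_mul_of_nonneg_right (mul_le_of_le_one_right hC hξ) hinv
  have base' : ∀ ξ, qNorm Q ξ ≤ 1 → |phiHat A Q ξ| ≤ C0 * (max 1 (qNorm Q ξ / ρ)) ^ p :=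
    fun ξ hξ => (base ξ hξ).trans
      (le_mul_of_one_le_right (Real.exp_pos _).le (one_le_pow₀ (le_max_left _ _)))
  refine ⟨C0, p, (Real.exp_pos _).le, ?_⟩
  have key : ∀ (n : ℕ) (ξ : Fin d → ℝ), ρ ^ n * qNorm Q ξ ≤ 1 →
      |phiHat A Q ξ| ≤ C0 * (max 1 (qNorm Q ξ / ρ)) ^ p := by
    intro n
    induction n with
    | zero => intro ξ hξ; exact base' ξ (by simpa using hξ)
    | succ n ih =>
      intro ξ hξ
      rcases le_or_gt (qNorm Q ξ) 1 with h1 | h1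
      · exact base' ξ h1
      have h2 := ih (invTranspose A *ᵥ ξ) (by rw [hcon, ← mul_assoc, ← pow_succ]; exact hξ)
      rw [hcon, mul_div_cancel_left₀ _ hρ0.ne', max_eq_right h1.le] at h2
      rw [phiHat_refine hd hA h, abs_mul]
      calc _ ≤ M * (C0 * qNorm Q ξ ^ p) := by
            gcongr
            exact hM _
        _ ≤ ρ⁻¹ ^ p * (C0 * qNorm Q ξ ^ p) := by
            gcongr
        _ = C0 * (qNorm Q ξ / ρ) ^ p := by rw [div_eq_mul_inv, mul_pow]; ring
        _ ≤ _ := by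
            have : 0 ≤ qNorm Q ξ / ρ := by positivity
            gcongr
            exact le_max_right _ _
  intro ξ
  have ht : Filter.Tendsto (fun n : ℕ => ρ ^ n * qNorm Q ξ) Filter.atTop (nhds (0 * qNorm Q ξ)) :=
    (tendsto_pow_atTop_nhds_zero_of_lt_one hρ0.le hρ1).mul_const _
  rw [zero_mul] at ht
  obtain ⟨n, hn⟩ := (ht.eventually (eventually_le_nhds (by norm_num : (0 : ℝ) < 1))).exists
  exact key n ξ hn

lemma phiHat_measurable (hd : 0 < d) (hA : IsDilationMatrix A) (h : IsFactorization A Q U) :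
    Measurable (phiHat A Q) := by
  have hc := (mask_differentiable (Q := Q) (det_ne_zero hd hA)).continuous
  refine measurable_of_tendsto_metrizable
    (f := fun (n : ℕ) (ξ : Fin d → ℝ) =>
      ∏ j ∈ Finset.range n, mask A Q ((invTranspose A ^ (j + 1)) *ᵥ ξ)) (fun n => ?_) ?_
  · refine (continuous_finsetProd _ fun j _ => hc.comp ?_).measurable
    exact (Matrix.mulVecLin (invTranspose A ^ (j + 1))).continuous_of_finiteDimensional
  · exact tendsto_pi_nhds.2 fun ξ => (multipliable_phiHat hd hA h ξ).hasProd.tendsto_prod_nat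

end infiniteProduct

/-- The function `η ↦ (2π)^(d/2) φ̂(2πη)^m`. If `F(f)(ξ) = (2π)^(-d/2) ∫ f(x) e^(-iξ·x) dx` is
`φ̂^m`, then this is the Fourier transform of `f` in the normalization
`𝓕 f (η) = ∫ f(x) e^(-2πiη·x) dx`. -/
def fourierSide {d : ℕ} (A : Matrix (Fin d) (Fin d) ℤ) (Q : Matrix (Fin d) (Fin d) ℝ) (m : ℕ)
    (η : EuclideanSpace ℝ (Fin d)) : ℂ :=
  (((2 * Real.pi) ^ ((d : ℝ) / 2) * phiHat A Q (fun i => 2 * Real.pi * η i) ^ m : ℝ) : ℂ)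

lemma fourierSide_slowlyIncreasing {d : ℕ} (hd : 0 < d) {A : Matrix (Fin d) (Fin d) ℤ}
    (hA : IsDilationMatrix A) {Q U : Matrix (Fin d) (Fin d) ℝ} (h : IsFactorization A Q U)
    (m : ℕ) : IsSlowlyIncreasing (fourierSide A Q m) := by
  constructor
  · refine Complex.measurable_ofReal.comp (Measurable.const_mul (Measurable.pow_const
      ((phiHat_measurable hd hA h).comp ?_) m) _)
    fun_prop
  · obtain ⟨C, p, hC, hb⟩ := phiHat_growth hd hA h
    obtain ⟨K, hK, hk⟩ := qNorm_le Q
    obtain ⟨hρ0, hρ1⟩ := rho_mem hd hA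
    set ρ := |(A.det : ℝ)| ^ (-(1 / (d : ℝ))) with hρ
    set L := max 1 (K * (2 * Real.pi) / ρ) with hL
    have hL0 : 0 ≤ L := zero_le_one.trans (le_max_left _ _)
    refine ⟨(2 * Real.pi) ^ ((d : ℝ) / 2) * (C * L ^ p) ^ m, p * m, fun η => ?_⟩
    have h1 : |phiHat A Q (fun i => 2 * Real.pi * η i)| ≤ C * (L * (1 + ‖η‖)) ^ p := by
      refine (hb _).trans ?_
      have h2 := hk ((2 * Real.pi) • η)
      rw [norm_smul, Real.norm_of_nonneg (by positivity)] at h2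
      have h3 : qNorm Q (fun i => 2 * Real.pi * η i) / ρ ≤ L * ‖η‖ := by
        calc _ ≤ K * (2 * Real.pi * ‖η‖) / ρ := by gcongr; exact h2
          _ = K * (2 * Real.pi) / ρ * ‖η‖ := by ring
          _ ≤ _ := by gcongr; exact le_max_right _ _
      have h4 : max 1 (qNorm Q (fun i => 2 * Real.pi * η i) / ρ) ≤ L * (1 + ‖η‖) := by
        have : 1 ≤ L := le_max_left _ _
        apply max_le
        · nlinarith [norm_nonneg η]
        · nlinarith [norm_nonneg η]
      gcongr
    rw [fourierSide, Complex.norm_real, Real.norm_eq_abs, abs_mul, abs_pow,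
      abs_of_nonneg (by positivity)]
    calc _ ≤ (2 * Real.pi) ^ ((d : ℝ) / 2) * (C * (L * (1 + ‖η‖)) ^ p) ^ m := by gcongr
      _ = _ := by rw [mul_pow L, pow_mul]; ring

/-- The elliptic scaling function `φ^m` of order `m`: the tempered distribution whose Fourier
transform, in the normalization `(2π)^(-d/2) ∫ f(x) e^(-iξ·x) dx`, is the function `φ̂(ξ)^m`. -/
def ellipticScalingFunction {d : ℕ} (hd : 0 < d) {A : Matrix (Fin d) (Fin d) ℤ}
    (hA : IsDilationMatrix A) {Q U : Matrix (Fin d) (Fin d) ℝ} (h : IsFactorization A Q U)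
    (m : ℕ) : 𝓢'(EuclideanSpace ℝ (Fin d), ℂ) :=
  𝓕⁻ (fourierSide_slowlyIncreasing hd hA h m).toTempered

lemma fourier_ellipticScalingFunction {d : ℕ} (hd : 0 < d) {A : Matrix (Fin d) (Fin d) ℤ}
    (hA : IsDilationMatrix A) {Q U : Matrix (Fin d) (Fin d) ℝ} (h : IsFactorization A Q U)
    (m : ℕ) (ψ : 𝓢(EuclideanSpace ℝ (Fin d), ℂ)) :
    (𝓕 (ellipticScalingFunction hd hA h m)) ψ = ∫ η, fourierSide A Q m η * ψ η := by
  rw [ellipticScalingFunction, FourierTransform.fourier_fourierInv_eq]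
  rfl

/-- `⟨f(· - k), ψ⟩ = ⟨f, ψ(· + k)⟩`, where `k ∈ ℤ^d`. -/
def integerShift {d : ℕ} (f : 𝓢'(EuclideanSpace ℝ (Fin d), ℂ)) (k : Fin d → ℤ)
    (ψ : 𝓢(EuclideanSpace ℝ (Fin d), ℂ)) : ℂ :=
  f (SchwartzMap.compSubConstCLM ℂ (-(WithLp.toLp 2 fun i => (k i : ℝ))) ψ)

lemma integrable_poly_mul {d : ℕ} (P : MvPolynomial (Fin d) ℝ)
    (ψ : 𝓢(EuclideanSpace ℝ (Fin d), ℂ)) (hψ : HasCompactSupport ψ) :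
    MeasureTheory.Integrable
      (fun x : EuclideanSpace ℝ (Fin d) => ((MvPolynomial.eval x P : ℝ) : ℂ) * ψ x) := by
  apply Continuous.integrable_of_hasCompactSupport
  · have : Continuous fun x : EuclideanSpace ℝ (Fin d) => MvPolynomial.eval (⇑x) P :=
      (MvPolynomial.continuous_eval P).comp (by fun_prop)
    exact (Complex.continuous_ofReal.comp this).mul ψ.continuous
  · exact hψ.mul_left

/-- The space of all real polynomials contained in the span of the integer shifts of `f`:
those `P` for which there are real coefficients `c k`, `k ∈ ℤ^d`, with `P = ∑ c k f(· - k)` as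
distributions, that is, after pairing with any smooth compactly supported `ψ`. As usual for a
compactly supported `f` (the sum is then locally finite), the coefficients are arbitrary. -/
def polynomialsInSpan {d : ℕ} (f : 𝓢'(EuclideanSpace ℝ (Fin d), ℂ)) :
    Submodule ℝ (MvPolynomial (Fin d) ℝ) where
  carrier := {P | ∃ c : (Fin d → ℤ) → ℝ, ∀ ψ : 𝓢(EuclideanSpace ℝ (Fin d), ℂ),
    HasCompactSupport ψ → HasSum (fun k => (c k : ℂ) * integerShift f k ψ)
      (∫ x : EuclideanSpace ℝ (Fin d), ((MvPolynomial.eval x P : ℝ) : ℂ) * ψ x)}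
  zero_mem' := ⟨0, fun ψ _ => by simp⟩
  add_mem' := by
    rintro P P' ⟨c, hc⟩ ⟨c', hc'⟩
    refine ⟨c + c', fun ψ hψ => ?_⟩
    have := (hc ψ hψ).add (hc' ψ hψ)
    rw [← MeasureTheory.integral_add (integrable_poly_mul P ψ hψ)
      (integrable_poly_mul P' ψ hψ)] at this
    simpa [add_mul] using this
  smul_mem' := by
    rintro a P ⟨c, hc⟩
    refine ⟨a • c, fun ψ hψ => ?_⟩
    have := (hc ψ hψ).mul_left (a : ℂ)
    rw [← MeasureTheory.integral_const_mul] at this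
    simpa [mul_assoc] using this

/-- The polynomial `x ↦ P (x + h)`. -/
def polyShift {d : ℕ} (h : Fin d → ℝ) (P : MvPolynomial (Fin d) ℝ) : MvPolynomial (Fin d) ℝ :=
  MvPolynomial.bind₁ (fun i => MvPolynomial.X i + MvPolynomial.C (h i)) P

/-- The polynomial `x ↦ P (t x)`. -/
def polyScale {d : ℕ} (t : ℝ) (P : MvPolynomial (Fin d) ℝ) : MvPolynomial (Fin d) ℝ :=
  MvPolynomial.bind₁ (fun i => MvPolynomial.C t * MvPolynomial.X i) P

/-- Affine invariance of a space of polynomials: shift-invariance and scale-invariance. -/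
def IsAffinelyInvariant {d : ℕ} (V : Submodule ℝ (MvPolynomial (Fin d) ℝ)) : Prop :=
  (∀ P ∈ V, ∀ h : Fin d → ℝ, polyShift h P ∈ V) ∧ ∀ P ∈ V, ∀ t : ℝ, polyScale t P ∈ V

/-- The differential operator `W(-iD)` on polynomials, for the quadratic form `W(ξ) = ξᵀ Q² ξ`.
Since `(-i)² = -1`, it is `-∑ⱼₖ (Q²)ⱼₖ ∂ⱼ ∂ₖ`. -/
def ellipticOperator {d : ℕ} (Q : Matrix (Fin d) (Fin d) ℝ) :
    Module.End ℝ (MvPolynomial (Fin d) ℝ) :=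
  -∑ j, ∑ k, (Q ^ 2) j k •
    ((MvPolynomial.pderiv j).toLinearMap ∘ₗ (MvPolynomial.pderiv k).toLinearMap)

end

end EllipticScaling

/-! Write `ρ = |det A| ^ (-1/d)`, which is less than `1`, and let `V` be the space of polynomials in
question.

Affine invariance comes from two symmetries of `V`. It is closed under integer translations, and the
refinement equation `φ̂(Aᵀ·) = m₀ φ̂` makes it closed under `P ↦ P(A⁻¹·)` (`polySubst_inv_mem`).
Since `P(· + x)` depends polynomially on `x` and a polynomial vanishing on `ℤ^d` is zero, integer
translations can be replaced by real ones (`polyShift_mem`). The factorization gives `A⁻¹ = ρ R`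
with `R` conjugate to an orthogonal matrix, so the powers of `R` return arbitrarily close to the
identity; the different decay rates `ρ^(jn)` of the degrees `n` then separate the homogeneous
components (`homogeneousComponent_mem`). Thus `V` is graded, hence invariant under scaling.

For the differential equation, choose `k ∈ ℤ^d` outside `Aᵀ ℤ^d`, possible because `|det A| > 1`.
Near `2πk` the function `φ̂^m` looks like a nonzero multiple of `W^m`: exactly one factor `G` of the
mask vanishes at `2πA⁻ᵀk`, with leading form `W`; the remaining part of the infinite product does
not vanish there; and `A⁻ᵀ` multiplies `W` by `ρ²` (`tendsto_fourierSide`). Hence, on polynomials of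
degree at most `2m`, integration against `e^{-2πi k·y} φ^m(y)` is a nonzero multiple of the
functional `P ↦ (W(-iD)^m P)(0)` (`exists_momentFunctional_eq`).

On the other side, if `P` is a combination of shifts of `φ^m`, then the periodization of `P(-·) φ^m`
is constant (`exists_hasSum_periodization`), so its Fourier coefficient at `k ≠ 0` vanishes.
Comparing the two gives `(W(-iD)^m P)(0) = 0` for `P ∈ V` homogeneous of degree `2m`; gradedness and
translation invariance extend this to all of `V` and to every point.

Because `φ^m` is only a distribution, the second argument is run on its smoothing by a bump
function. The lattice sums are finite because `φ^m` has compact support: the partial products of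
`φ̂^m` are exponential sums with frequencies in one fixed ball (`exists_support_radius`). -/

open scoped Matrix SchwartzMap FourierTransform

namespace EllipticScaling

/-! ### Invariant spaces of polynomials: from integer to real translations, and gradedness. -/

section PolynomialSpaces

variable {d : ℕ}

/-- A linear functional applied to a polynomial whose coefficients depend polynomially on a
parameter `x` is a polynomial in `x`. -/
lemma exists_eval_eq_functional {σ τ : Type*} (l : MvPolynomial τ ℝ →ₗ[ℝ] ℝ)
    (P : MvPolynomial τ (MvPolynomial σ ℝ)) :
    ∃ q : MvPolynomial σ ℝ, ∀ x : σ → ℝ,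
      MvPolynomial.eval x q = l (MvPolynomial.map (MvPolynomial.eval x) P) := by
  induction P using MvPolynomial.induction_on' with
  | monomial u a =>
    refine ⟨a * MvPolynomial.C (l (MvPolynomial.monomial u 1)), fun x => ?_⟩
    rw [MvPolynomial.map_monomial, map_mul, MvPolynomial.eval_C, ← smul_eq_mul, ← map_smul,
      MvPolynomial.smul_monomial, smul_eq_mul, mul_one]
  | add p q hp hq =>
    obtain ⟨a, ha⟩ := hp
    obtain ⟨b, hb⟩ := hq
    exact ⟨a + b, fun x => by rw [map_add, ha, hb, map_add, map_add]⟩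

/-- Substitutions whose coefficients are polynomials in a parameter, such as translation by `x` or a
linear map with entries `x`, yield values of `l` that are polynomial in that parameter. Vanishing on
a lattice of parameters, or in a limit, can then be exploited. -/
lemma exists_eval_eq_functional_bind {σ τ : Type*} (l : MvPolynomial τ ℝ →ₗ[ℝ] ℝ)
    (g : τ → MvPolynomial τ (MvPolynomial σ ℝ)) (P : MvPolynomial τ ℝ) :
    ∃ q : MvPolynomial σ ℝ, ∀ x : σ → ℝ, MvPolynomial.eval x q =
      l (MvPolynomial.bind₁ (fun i => MvPolynomial.map (MvPolynomial.eval x) (g i)) P) := by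
  obtain ⟨q, hq⟩ := exists_eval_eq_functional l
    (MvPolynomial.bind₁ g (MvPolynomial.map MvPolynomial.C P))
  refine ⟨q, fun x => ?_⟩
  rw [hq, MvPolynomial.map_bind₁, MvPolynomial.map_map]
  congr 2
  have : (MvPolynomial.eval x).comp MvPolynomial.C = RingHom.id ℝ := by ext; simp
  rw [this, MvPolynomial.map_id]

/-- The polynomial `x ↦ P (M x)`. -/
noncomputable def polySubst (M : Matrix (Fin d) (Fin d) ℝ) (P : MvPolynomial (Fin d) ℝ) :
    MvPolynomial (Fin d) ℝ :=
  MvPolynomial.bind₁ (fun i => ∑ j, MvPolynomial.C (M i j) * MvPolynomial.X j) P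

lemma eval_bind₁ {σ τ : Type*} (g : σ → MvPolynomial τ ℝ) (P : MvPolynomial σ ℝ) (x : τ → ℝ) :
    MvPolynomial.eval x (MvPolynomial.bind₁ g P) =
      MvPolynomial.eval (fun i => MvPolynomial.eval x (g i)) P := by
  induction P using MvPolynomial.induction_on with
  | C a => simp
  | add p q hp hq => rw [map_add, map_add, map_add, hp, hq]
  | mul_X p i hp => rw [map_mul, map_mul, map_mul, hp, MvPolynomial.bind₁_X_right,
      MvPolynomial.eval_X]

lemma eval_polySubst (M : Matrix (Fin d) (Fin d) ℝ) (P : MvPolynomial (Fin d) ℝ)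
    (x : Fin d → ℝ) : MvPolynomial.eval x (polySubst M P) = MvPolynomial.eval (M *ᵥ x) P := by
  rw [polySubst, eval_bind₁]
  simp only [map_sum, map_mul, MvPolynomial.eval_C, MvPolynomial.eval_X]
  rfl

lemma eval_polyShift (h : Fin d → ℝ) (P : MvPolynomial (Fin d) ℝ)
    (x : Fin d → ℝ) : MvPolynomial.eval x (polyShift h P) = MvPolynomial.eval (x + h) P := by
  rw [polyShift, eval_bind₁]
  simp [Pi.add_def]

lemma eval_polyScale (t : ℝ) (P : MvPolynomial (Fin d) ℝ)
    (x : Fin d → ℝ) : MvPolynomial.eval x (polyScale t P) = MvPolynomial.eval (t • x) P := by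
  rw [polyScale, eval_bind₁]
  simp [Pi.smul_def]

lemma polySubst_one (P : MvPolynomial (Fin d) ℝ) : polySubst 1 P = P :=
  MvPolynomial.funext fun x => by rw [eval_polySubst, Matrix.one_mulVec]

lemma polySubst_polySubst (M N : Matrix (Fin d) (Fin d) ℝ) (P : MvPolynomial (Fin d) ℝ) :
    polySubst N (polySubst M P) = polySubst (M * N) P :=
  MvPolynomial.funext fun x => by
    rw [eval_polySubst, eval_polySubst, eval_polySubst, Matrix.mulVec_mulVec]

lemma eval_smul_of_isHomogeneous {P : MvPolynomial (Fin d) ℝ} {n : ℕ}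
    (hP : P.IsHomogeneous n) (c : ℝ) (x : Fin d → ℝ) :
    MvPolynomial.eval (c • x) P = c ^ n * MvPolynomial.eval x P := by
  simp only [MvPolynomial.eval_eq', Finset.mul_sum, Pi.smul_apply, smul_eq_mul, mul_pow,
    Finset.prod_mul_distrib, Finset.prod_pow_eq_pow_sum]
  refine Finset.sum_congr rfl fun u hu => ?_
  have h1 : ∑ i, u i = n := by
    have := hP (MvPolynomial.mem_support_iff.1 hu)
    have h2 := congrArg (fun f => f u) (Finsupp.degree_eq_weight_one (σ := Fin d) (R := ℕ))
    rw [← this, ← Finsupp.degree_eq_sum]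
    exact h2
  rw [h1]
  ring

lemma polySubst_smul_of_isHomogeneous {P : MvPolynomial (Fin d) ℝ} {n : ℕ}
    (hP : P.IsHomogeneous n) (c : ℝ) (M : Matrix (Fin d) (Fin d) ℝ) :
    polySubst (c • M) P = c ^ n • polySubst M P := by
  refine MvPolynomial.funext fun x => ?_
  rw [eval_polySubst, MvPolynomial.smul_eval, eval_polySubst, Matrix.smul_mulVec]
  exact eval_smul_of_isHomogeneous hP _ _

lemma polyScale_eq_polySubst (t : ℝ) (P : MvPolynomial (Fin d) ℝ) :
    polyScale t P = polySubst (t • 1) P :=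
  MvPolynomial.funext fun x => by
    rw [eval_polySubst, eval_polyScale, Matrix.smul_mulVec, Matrix.one_mulVec]

/-- The matrix entries serve as the parameters, so the dependence on `M` is polynomial. Continuity
is what permits passing to the limit along powers of a matrix. -/
lemma exists_continuous_eq_functional_polySubst (l : MvPolynomial (Fin d) ℝ →ₗ[ℝ] ℝ)
    (P : MvPolynomial (Fin d) ℝ) :
    ∃ F : Matrix (Fin d) (Fin d) ℝ → ℝ, Continuous F ∧ ∀ M, F M = l (polySubst M P) := by
  obtain ⟨q, hq⟩ := exists_eval_eq_functional_bind (σ := Fin d × Fin d) l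
    (fun i => ∑ j, MvPolynomial.C (MvPolynomial.X (i, j)) * MvPolynomial.X j) P
  simp only [map_sum, map_mul, MvPolynomial.map_X, MvPolynomial.map_C,
    MvPolynomial.eval_X] at hq
  have h1 : Continuous fun (M : Matrix (Fin d) (Fin d) ℝ) (p : Fin d × Fin d) => M p.1 p.2 :=
    continuous_pi fun p => continuous_id.matrix_elem p.1 p.2
  have h2 := (MvPolynomial.continuous_eval q).comp h1
  refine ⟨_, h2, fun M => ?_⟩
  rw [polySubst]
  exact hq _

/-- A space of polynomials that contains the integer translates of its elements contains all of
their translates. -/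
lemma polyShift_mem {V : Submodule ℝ (MvPolynomial (Fin d) ℝ)}
    (hV : ∀ P ∈ V, ∀ k : Fin d → ℤ, polyShift (fun i => (k i : ℝ)) P ∈ V)
    {P : MvPolynomial (Fin d) ℝ} (hP : P ∈ V) (h : Fin d → ℝ) : polyShift h P ∈ V := by
  by_contra hn
  -- A functional vanishing on `V` but not on the missing translate turns membership into a scalar
  -- identity, without finite-dimensionality of `V`.
  obtain ⟨l, hl, hle⟩ := Submodule.exists_le_ker_of_notMem hn
  obtain ⟨q, hq⟩ := exists_eval_eq_functional_bind (σ := Fin d) l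
    (fun i => MvPolynomial.X i + MvPolynomial.C (MvPolynomial.X i)) P
  simp only [map_add, MvPolynomial.map_X, MvPolynomial.map_C, MvPolynomial.eval_X] at hq
  -- The value of `l` at the translate by `x` is polynomial in `x` and vanishes at all integer
  -- points, hence identically.
  have h0 : q = 0 := by
    refine MvPolynomial.funext_set (fun _ => Set.range (Int.cast : ℤ → ℝ))
      (fun _ => Set.infinite_range_of_injective Int.cast_injective) fun x hx => ?_
    choose k hk using fun i => hx i (Set.mem_univ i)
    rw [hq, map_zero]
    have : x = fun i => (k i : ℝ) := funext fun i => (hk i).symm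
    rw [this]
    exact hle (hV P hP k)
  refine hl ?_
  rw [polyShift, ← hq, h0, map_zero]

/-- A space of polynomials that contains `P (M x)` with each `P`, where `M` is a contraction
`ρ R` such that `1` is a cluster point of the powers of `R`, is graded. -/
lemma homogeneousComponent_mem {V : Submodule ℝ (MvPolynomial (Fin d) ℝ)} {ρ : ℝ} (h0 : 0 < ρ)
    (h1 : ρ < 1) {R : Matrix (Fin d) (Fin d) ℝ}
    (hR : MapClusterPt (1 : Matrix (Fin d) (Fin d) ℝ) Filter.atTop (fun j : ℕ => R ^ j))
    (hV : ∀ P ∈ V, polySubst (ρ • R) P ∈ V) {P : MvPolynomial (Fin d) ℝ} (hP : P ∈ V) (n : ℕ) :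
    MvPolynomial.homogeneousComponent n P ∈ V := by
  by_contra hn
  obtain ⟨l, hl, hle⟩ := Submodule.exists_le_ker_of_notMem hn
  have hpow : ∀ j : ℕ, polySubst ((ρ • R) ^ j) P ∈ V := by
    intro j
    induction j with
    | zero => rwa [pow_zero, polySubst_one]
    | succ j ih => rw [pow_succ, ← polySubst_polySubst]; exact hV _ ih
  set c := fun n => MvPolynomial.homogeneousComponent n P with hc
  have hhom : ∀ n, (c n).IsHomogeneous n := fun n =>
    MvPolynomial.homogeneousComponent_isHomogeneous n P
  have hcont := fun n => exists_continuous_eq_functional_polySubst l (c n)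
  choose F hF hFl using hcont
  set N := P.totalDegree + 1 with hN
  have hsum : ∀ j : ℕ, ∑ n ∈ Finset.range N, (ρ ^ j) ^ n * F n (R ^ j) = 0 := by
    intro j
    have h2 : l (polySubst ((ρ • R) ^ j) P) = 0 := hle (hpow j)
    have h3 : P = ∑ n ∈ Finset.range N, c n := (MvPolynomial.sum_homogeneousComponent P).symm
    rw [h3, polySubst, map_sum, map_sum] at h2
    rw [← h2]
    refine Finset.sum_congr rfl fun n _ => ?_
    rw [hFl, ← smul_eq_mul, ← map_smul, ← polySubst_smul_of_isHomogeneous (hhom n), smul_pow]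
    rfl
  -- Lowest degree first: after division by `(ρ^j)^n` the higher degrees carry positive powers of
  -- `ρ^j`. The claim is made for every power `R ^ i`, not just for `1`, because the induction must
  -- delete the lower degrees from `hsum j` for every `j`.
  have key : ∀ n, n < N → ∀ i, F n (R ^ i) = 0 := by
    intro n
    induction n using Nat.strong_induction_on with
    | _ n ih =>
      intro hnN i
      have hj : ∀ j, F n (R ^ j) = -∑ k ∈ Finset.Ico (n + 1) N, (ρ ^ j) ^ (k - n) * F k (R ^ j) := by
        intro j
        have h4 := hsum j
        rw [← Finset.sum_range_add_sum_Ico _ (Nat.succ_le_of_lt hnN), Finset.sum_range_succ,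
          Finset.sum_eq_zero (fun k hk => by
            rw [ih k (Finset.mem_range.1 hk) ((Finset.mem_range.1 hk).trans hnN), mul_zero]),
          zero_add] at h4
        have h5 : ∑ k ∈ Finset.Ico (n + 1) N, (ρ ^ j) ^ k * F k (R ^ j) =
            (ρ ^ j) ^ n * ∑ k ∈ Finset.Ico (n + 1) N, (ρ ^ j) ^ (k - n) * F k (R ^ j) := by
          rw [Finset.mul_sum]
          refine Finset.sum_congr rfl fun k hk => ?_
          rw [← mul_assoc, ← pow_add, Nat.add_sub_cancel' (by
            have := (Finset.mem_Ico.1 hk).1; omega)]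
        rw [Nat.succ_eq_add_one, h5, ← mul_add] at h4
        have h6 := (mul_eq_zero.1 h4).resolve_left (by positivity)
        linarith
      -- Along an ultrafilter `u` with `R ^ j → 1` one has `R ^ (j + i) → R ^ i`, so all `F k (R ^
      -- (j + i))` converge while `ρ ^ (j + i) → 0`.
      obtain ⟨u, hu, hlim⟩ := mapClusterPt_iff_ultrafilter.1 hR
      have hRi : Filter.Tendsto (fun j : ℕ => R ^ (j + i)) u (nhds (R ^ i)) := by
        simpa [pow_add] using hlim.mul_const (R ^ i)
      have hFi : ∀ k, Filter.Tendsto (fun j : ℕ => F k (R ^ (j + i))) u (nhds (F k (R ^ i))) :=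
        fun k => ((hF k).tendsto _).comp hRi
      have hρ : Filter.Tendsto (fun j : ℕ => ρ ^ (j + i)) u (nhds 0) :=
        (((tendsto_pow_atTop_nhds_zero_of_lt_one h0.le h1).comp
          (Filter.tendsto_add_atTop_nat i))).mono_left hu
      have hz : Filter.Tendsto (fun j : ℕ => -∑ k ∈ Finset.Ico (n + 1) N,
          (ρ ^ (j + i)) ^ (k - n) * F k (R ^ (j + i))) u (nhds 0) := by
        have : Filter.Tendsto (fun j : ℕ => -∑ k ∈ Finset.Ico (n + 1) N,
          (ρ ^ (j + i)) ^ (k - n) * F k (R ^ (j + i))) u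
          (nhds (-∑ k ∈ Finset.Ico (n + 1) N, 0 ^ (k - n) * F k (R ^ i))) :=
          (tendsto_finsetSum _ fun k _ => (hρ.pow _).mul (hFi k)).neg
        rwa [Finset.sum_eq_zero fun k hk => by
          rw [zero_pow (by have := (Finset.mem_Ico.1 hk).1; omega), zero_mul], neg_zero] at this
      simp only [← hj] at hz
      exact tendsto_nhds_unique (hFi n) hz
  refine hl ?_
  by_cases hnN : n < N
  · have := key n hnN 0
    rwa [pow_zero, hFl, polySubst_one] at this
  · have : c n = 0 := MvPolynomial.homogeneousComponent_eq_zero _ _ (by omega)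
    rw [show MvPolynomial.homogeneousComponent n P = c n from rfl, this, map_zero]

lemma polyScale_mem {V : Submodule ℝ (MvPolynomial (Fin d) ℝ)}
    {P : MvPolynomial (Fin d) ℝ} (hP : ∀ n, MvPolynomial.homogeneousComponent n P ∈ V) (t : ℝ) :
    polyScale t P ∈ V := by
  have h3 := MvPolynomial.sum_homogeneousComponent P
  rw [polyScale_eq_polySubst, ← h3, polySubst, map_sum]
  refine Submodule.sum_mem _ fun n _ => ?_
  have := polySubst_smul_of_isHomogeneous
    (MvPolynomial.homogeneousComponent_isHomogeneous n P) t 1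
  rw [polySubst_one, polySubst] at this
  rw [this]
  exact V.smul_mem _ (hP n)

end PolynomialSpaces

/-! ### The operator `W(-iD)` on powers of linear forms and under affine substitutions. -/

section EllipticOperator

variable {d : ℕ}

/-- The linear form `η · X`. -/
noncomputable def linearForm (η : Fin d → ℝ) : MvPolynomial (Fin d) ℝ :=
  ∑ i, MvPolynomial.C (η i) * MvPolynomial.X i

lemma eval_linearForm (η x : Fin d → ℝ) : MvPolynomial.eval x (linearForm η) = η ⬝ᵥ x := by
  simp [linearForm, dotProduct]

lemma pderiv_linearForm (η : Fin d → ℝ) (j : Fin d) :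
    MvPolynomial.pderiv j (linearForm η) = MvPolynomial.C (η j) := by
  classical
  simp [linearForm, MvPolynomial.pderiv_X, Pi.single_apply]

/-- The quadratic form `W(η) = ηᵀ Q² η`. -/
noncomputable def quadForm (Q : Matrix (Fin d) (Fin d) ℝ) (η : Fin d → ℝ) : ℝ :=
  ∑ j, ∑ k, (Q ^ 2) j k * (η j * η k)

lemma ellipticOperator_apply (Q : Matrix (Fin d) (Fin d) ℝ) (P : MvPolynomial (Fin d) ℝ) :
    ellipticOperator Q P =
      -∑ j, ∑ k, (Q ^ 2) j k • MvPolynomial.pderiv j (MvPolynomial.pderiv k P) := by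
  simp [ellipticOperator, LinearMap.sum_apply]

lemma pderiv_linearForm_pow (η : Fin d → ℝ) (j : Fin d) (n : ℕ) :
    MvPolynomial.pderiv j (linearForm η ^ n) = (n * η j) • linearForm η ^ (n - 1) := by
  rw [Derivation.leibniz_pow, pderiv_linearForm, MvPolynomial.smul_eq_C_mul, map_mul]
  simp
  ring

/-- Every derivative brings down one coordinate of `η`. The truncated subtractions are harmless,
since the factor `n * (n - 1)` is zero for `n < 2`. -/
lemma ellipticOperator_linearForm_pow (Q : Matrix (Fin d) (Fin d) ℝ) (η : Fin d → ℝ) (n : ℕ) :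
    ellipticOperator Q (linearForm η ^ n) =
      (-(quadForm Q η) * (n * (n - 1 : ℕ) : ℝ)) • linearForm η ^ (n - 2) := by
  rw [ellipticOperator_apply]
  simp only [pderiv_linearForm_pow, Derivation.map_smul, smul_smul]
  simp only [← Finset.sum_smul, ← neg_smul, Nat.sub_sub]
  congr 1
  simp only [quadForm, Finset.sum_mul, neg_mul, neg_inj]
  refine Finset.sum_congr rfl fun j _ => Finset.sum_congr rfl fun k _ => ?_
  ring

lemma ellipticOperator_pow_linearForm_pow (Q : Matrix (Fin d) (Fin d) ℝ) (η : Fin d → ℝ)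
    (n k : ℕ) : (ellipticOperator Q ^ k) (linearForm η ^ n) =
      ((-(quadForm Q η)) ^ k * (n.descFactorial (2 * k) : ℝ)) • linearForm η ^ (n - 2 * k) := by
  induction k with
  | zero => simp
  | succ k ih =>
    rw [pow_succ', Module.End.mul_apply, ih, map_smul, ellipticOperator_linearForm_pow, smul_smul,
      show 2 * (k + 1) = 2 * k + 1 + 1 by ring, Nat.descFactorial_succ, Nat.descFactorial_succ,
      Nat.sub_sub, Nat.sub_sub]
    congr 1
    push_cast
    ring

/-- The linear functional `P ↦ (W(-iD)^m P)(0)`. -/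
noncomputable def ellipticFunctional (Q : Matrix (Fin d) (Fin d) ℝ) (m : ℕ) :
    MvPolynomial (Fin d) ℝ →ₗ[ℝ] ℝ :=
  (MvPolynomial.aeval (0 : Fin d → ℝ)).toLinearMap ∘ₗ (ellipticOperator Q ^ m)

lemma ellipticFunctional_apply (Q : Matrix (Fin d) (Fin d) ℝ) (m : ℕ)
    (P : MvPolynomial (Fin d) ℝ) :
    ellipticFunctional Q m P = MvPolynomial.eval 0 ((ellipticOperator Q ^ m) P) := rfl

/-- This and the next lemma give the values to be matched with the moments read off from the Taylor
expansion of the Fourier transform at a lattice point. -/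
lemma ellipticFunctional_linearForm_pow_of_lt (Q : Matrix (Fin d) (Fin d) ℝ) {m n : ℕ}
    (hn : n < 2 * m) (η : Fin d → ℝ) : ellipticFunctional Q m (linearForm η ^ n) = 0 := by
  rw [ellipticFunctional_apply, ellipticOperator_pow_linearForm_pow,
    Nat.descFactorial_eq_zero_iff_lt.2 hn]
  simp

lemma ellipticFunctional_linearForm_pow (Q : Matrix (Fin d) (Fin d) ℝ) (m : ℕ)
    (η : Fin d → ℝ) : ellipticFunctional Q m (linearForm η ^ (2 * m)) =
      (-(quadForm Q η)) ^ m * ((2 * m).factorial : ℝ) := by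
  rw [ellipticFunctional_apply, ellipticOperator_pow_linearForm_pow, Nat.descFactorial_self]
  simp

/-- The chain rule for `x ↦ s x + u`. It is needed for translations (`s = 1`) and point reflections
(`s = -1`). -/
lemma pderiv_bind₁_affine (s : ℝ) (u : Fin d → ℝ) (j : Fin d) (P : MvPolynomial (Fin d) ℝ) :
    MvPolynomial.pderiv j (MvPolynomial.bind₁
        (fun i => MvPolynomial.C s * MvPolynomial.X i + MvPolynomial.C (u i)) P) =
      s • MvPolynomial.bind₁ (fun i => MvPolynomial.C s * MvPolynomial.X i + MvPolynomial.C (u i))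
        (MvPolynomial.pderiv j P) := by
  classical
  induction P using MvPolynomial.induction_on with
  | C a => simp
  | add p q hp hq => simp only [map_add, hp, hq, smul_add]
  | mul_X p i hp =>
    simp only [map_mul, Derivation.leibniz, hp, MvPolynomial.bind₁_X_right, map_add, smul_add,
      MvPolynomial.pderiv_C, MvPolynomial.pderiv_X, smul_eq_mul, mul_zero, add_zero,
      MvPolynomial.smul_eq_C_mul]
    by_cases h : i = j
    · subst h; simp; ring
    · simp [Pi.single_eq_of_ne h]; ring

lemma ellipticOperator_bind₁_affine (Q : Matrix (Fin d) (Fin d) ℝ) (s : ℝ) (u : Fin d → ℝ)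
    (P : MvPolynomial (Fin d) ℝ) :
    ellipticOperator Q (MvPolynomial.bind₁
        (fun i => MvPolynomial.C s * MvPolynomial.X i + MvPolynomial.C (u i)) P) =
      s ^ 2 • MvPolynomial.bind₁
        (fun i => MvPolynomial.C s * MvPolynomial.X i + MvPolynomial.C (u i))
        (ellipticOperator Q P) := by
  simp only [ellipticOperator_apply, pderiv_bind₁_affine, map_smul, map_neg, map_sum, smul_neg,
    Finset.smul_sum]
  congr 1
  refine Finset.sum_congr rfl fun j _ => Finset.sum_congr rfl fun k _ => ?_
  rw [Derivation.map_smul, pderiv_bind₁_affine, smul_smul, smul_smul, smul_smul]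
  congr 1
  ring

lemma ellipticOperator_pow_bind₁_affine (Q : Matrix (Fin d) (Fin d) ℝ) (s : ℝ) (u : Fin d → ℝ)
    (m : ℕ) (P : MvPolynomial (Fin d) ℝ) :
    (ellipticOperator Q ^ m) (MvPolynomial.bind₁
        (fun i => MvPolynomial.C s * MvPolynomial.X i + MvPolynomial.C (u i)) P) =
      (s ^ 2) ^ m • MvPolynomial.bind₁
        (fun i => MvPolynomial.C s * MvPolynomial.X i + MvPolynomial.C (u i))
        ((ellipticOperator Q ^ m) P) := by
  induction m with
  | zero => simp
  | succ m ih =>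
    rw [pow_succ', Module.End.mul_apply, ih, map_smul, ellipticOperator_bind₁_affine, smul_smul,
      pow_succ (s ^ 2), Module.End.mul_apply]

lemma isHomogeneous_ellipticOperator (Q : Matrix (Fin d) (Fin d) ℝ) {P : MvPolynomial (Fin d) ℝ}
    {n : ℕ} (hP : P.IsHomogeneous n) : (ellipticOperator Q P).IsHomogeneous (n - 2) := by
  rw [ellipticOperator_apply]
  refine (MvPolynomial.homogeneousSubmodule (Fin d) ℝ (n - 2)).neg_mem
    (Submodule.sum_mem _ fun j _ => Submodule.sum_mem _ fun k _ => Submodule.smul_mem _ _ ?_)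
  exact hP.pderiv.pderiv

lemma isHomogeneous_ellipticOperator_pow (Q : Matrix (Fin d) (Fin d) ℝ)
    {P : MvPolynomial (Fin d) ℝ} {n : ℕ} (hP : P.IsHomogeneous n) (m : ℕ) :
    ((ellipticOperator Q ^ m) P).IsHomogeneous (n - 2 * m) := by
  induction m with
  | zero => simpa
  | succ m ih =>
    rw [pow_succ', Module.End.mul_apply, mul_add, ← Nat.sub_sub]
    exact isHomogeneous_ellipticOperator Q ih

lemma eval_eq_of_isHomogeneous_zero {P : MvPolynomial (Fin d) ℝ} (hP : P.IsHomogeneous 0)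
    (x : Fin d → ℝ) : MvPolynomial.eval x P = MvPolynomial.eval 0 P := by
  rw [(MvPolynomial.totalDegree_eq_zero_iff_eq_C (p := P)).1 (Nat.le_zero.1 hP.totalDegree_le)]
  simp

lemma eval_zero_of_isHomogeneous_pos {P : MvPolynomial (Fin d) ℝ} {n : ℕ}
    (hP : P.IsHomogeneous n) (hn : n ≠ 0) : MvPolynomial.eval 0 P = 0 := by
  simpa [hn] using eval_smul_of_isHomogeneous hP 0 0

/-- Powers of linear forms span. -/
lemma functional_eq_zero_of_linearForm_pow {l : MvPolynomial (Fin d) ℝ →ₗ[ℝ] ℝ} {N : ℕ}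
    (hl : ∀ n ≤ N, ∀ η, l (linearForm η ^ n) = 0) {P : MvPolynomial (Fin d) ℝ}
    (hP : P.totalDegree ≤ N) : l P = 0 := by
  have key : ∀ u : Fin d →₀ ℕ, u.degree ≤ N → l (MvPolynomial.monomial u 1) = 0 := by
    intro u hu
    set n := u.degree with hn
    -- By the multinomial theorem `l ((η · X)^n)` is this polynomial in `η`. It vanishes
    -- identically, so its coefficients do, and these are positive multiples of the values of `l` on
    -- monomials.
    let q : MvPolynomial (Fin d) ℝ := ∑ k ∈ Finset.piAntidiag Finset.univ n,
      MvPolynomial.monomial (Finsupp.equivFunOnFinite.symm k)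
        ((Nat.multinomial Finset.univ k : ℝ) *
          l (MvPolynomial.monomial (Finsupp.equivFunOnFinite.symm k) 1))
    have hq : q = 0 := by
      refine MvPolynomial.funext fun η => ?_
      rw [map_zero, ← hl n hu η, linearForm, Finset.sum_pow_eq_sum_piAntidiag, map_sum, map_sum]
      refine Finset.sum_congr rfl fun k _ => ?_
      have h1 : (Nat.multinomial Finset.univ k : MvPolynomial (Fin d) ℝ) *
          ∏ i, (MvPolynomial.C (η i) * MvPolynomial.X i) ^ k i =
          ((Nat.multinomial Finset.univ k : ℝ) * ∏ i, η i ^ k i) •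
            MvPolynomial.monomial (Finsupp.equivFunOnFinite.symm k) 1 := by
        simp only [mul_pow, Finset.prod_mul_distrib, MvPolynomial.smul_eq_C_mul, map_mul, map_prod,
          map_pow, map_natCast, MvPolynomial.monomial_eq, Finsupp.prod_pow]
        simp [mul_assoc]
      rw [h1, map_smul, MvPolynomial.eval_monomial, Finsupp.prod_pow]
      simp
      ring
    have h2 := congrArg (MvPolynomial.coeff u) hq
    simp only [q, MvPolynomial.coeff_sum, MvPolynomial.coeff_monomial, MvPolynomial.coeff_zero]
      at h2
    rw [Finset.sum_eq_single (u : Fin d → ℕ)] at h2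
    · have h3 : Finsupp.equivFunOnFinite.symm (u : Fin d → ℕ) = u :=
        Finsupp.equivFunOnFinite.symm_apply_apply u
      rw [h3, if_pos rfl] at h2
      exact (mul_eq_zero.1 h2).resolve_left (by
        exact_mod_cast (Nat.multinomial_pos _ _).ne')
    · intro k _ hk
      rw [if_neg]
      rintro rfl
      exact hk rfl
    · intro h
      refine absurd ?_ h
      rw [Finset.mem_piAntidiag]
      exact ⟨by rw [hn, Finsupp.degree_eq_sum], fun _ _ => Finset.mem_univ _⟩
  rw [P.as_sum, map_sum]
  refine Finset.sum_eq_zero fun u hu => ?_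
  rw [← mul_one (MvPolynomial.coeff u P), ← smul_eq_mul, ← MvPolynomial.smul_monomial, map_smul,
    key u, smul_zero]
  refine le_trans ?_ hP
  have := MvPolynomial.le_totalDegree hu
  rwa [Finsupp.degree_eq_sum, ← Finsupp.sum_fintype u (fun _ e => e) fun _ => rfl]

end EllipticOperator

/-! ### The mask as an even trigonometric polynomial. -/

section TrigonometricPolynomials

variable {d : ℕ}

/-- An integer vector as a point of the Euclidean space. -/
noncomputable def intVec (k : Fin d → ℤ) : EuclideanSpace ℝ (Fin d) :=
  WithLp.toLp 2 fun i => (k i : ℝ)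

@[simp] lemma intVec_apply (k : Fin d → ℤ) (i : Fin d) : intVec k i = k i := rfl

lemma intVec_add (k l : Fin d → ℤ) : intVec (k + l) = intVec k + intVec l := by
  ext i; simp

lemma intVec_neg (k : Fin d → ℤ) : intVec (-k) = -intVec k := by
  ext i; simp

/-- The character `e^{2πi v·ζ}`. -/
noncomputable def expChar (v ζ : EuclideanSpace ℝ (Fin d)) : ℂ :=
  Complex.exp (((2 * Real.pi * inner ℝ v ζ : ℝ) : ℂ) * Complex.I)

lemma expChar_add_left (v w ζ : EuclideanSpace ℝ (Fin d)) :
    expChar (v + w) ζ = expChar v ζ * expChar w ζ := by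
  rw [expChar, expChar, expChar, ← Complex.exp_add, inner_add_left]
  congr 1
  push_cast
  ring

lemma expChar_comm (v ζ : EuclideanSpace ℝ (Fin d)) : expChar v ζ = expChar ζ v := by
  rw [expChar, expChar, real_inner_comm]

lemma expChar_add_right (v ζ ζ' : EuclideanSpace ℝ (Fin d)) :
    expChar v (ζ + ζ') = expChar v ζ * expChar v ζ' := by
  rw [expChar_comm, expChar_add_left, expChar_comm ζ, expChar_comm ζ']

@[simp] lemma expChar_zero_left (ζ : EuclideanSpace ℝ (Fin d)) : expChar 0 ζ = 1 := by
  simp [expChar]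

@[simp] lemma norm_expChar (v ζ : EuclideanSpace ℝ (Fin d)) : ‖expChar v ζ‖ = 1 :=
  Complex.norm_exp_ofReal_mul_I _

lemma continuous_expChar (v : EuclideanSpace ℝ (Fin d)) : Continuous (expChar v) := by
  unfold expChar
  fun_prop

lemma conj_expChar (v ζ : EuclideanSpace ℝ (Fin d)) :
    (starRingEnd ℂ) (expChar v ζ) = expChar (-v) ζ := by
  rw [expChar, expChar, ← Complex.exp_conj, inner_neg_left, map_mul, Complex.conj_ofReal,
    Complex.conj_I]
  congr 1
  push_cast
  ring

lemma expChar_intVec (k l : Fin d → ℤ) : expChar (intVec k) (intVec l) = 1 := by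
  rw [expChar, Complex.exp_eq_one_iff]
  refine ⟨∑ i, k i * l i, ?_⟩
  simp only [PiLp.inner_apply, intVec_apply, RCLike.inner_apply, conj_trivial]
  push_cast
  rw [Finset.mul_sum, Finset.sum_mul, Finset.sum_mul]
  exact Finset.sum_congr rfl fun i _ => by ring

/-- The algebra of trigonometric polynomials with integer frequencies. -/
noncomputable def trigPolyHom (d : ℕ) :
    AddMonoidAlgebra ℂ (Fin d → ℤ) →ₐ[ℂ] (EuclideanSpace ℝ (Fin d) → ℂ) :=
  AddMonoidAlgebra.lift ℂ _ _
    { toFun := fun l => expChar (-intVec l.toAdd)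
      map_one' := by
        funext ζ
        have : intVec (0 : Fin d → ℤ) = 0 := by ext i; simp
        simp [this]
      map_mul' := fun k l => by
        funext ζ
        rw [toAdd_mul, intVec_add, neg_add, expChar_add_left]
        rfl }

lemma trigPolyHom_apply (a : AddMonoidAlgebra ℂ (Fin d → ℤ)) (ζ : EuclideanSpace ℝ (Fin d)) :
    trigPolyHom d a ζ = ∑ l ∈ a.coeff.support, a.coeff l * expChar (-intVec l) ζ := by
  rw [trigPolyHom, AddMonoidAlgebra.lift_apply, Finsupp.sum, Finset.sum_apply]
  rfl

/-- Euler's formula, the phase `c` being absorbed into the coefficients. Hence the factors `G(ξ +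
2πs)` have integer frequencies although `s` need not be integral. -/
lemma sin_mem_trigPoly (i : Fin d) (c : ℝ) :
    (fun ζ : EuclideanSpace ℝ (Fin d) => (Real.sin (2 * Real.pi * ζ i + c) : ℂ)) ∈
      (trigPolyHom d).range := by
  have h : ∀ k : ℤ, (fun ζ : EuclideanSpace ℝ (Fin d) =>
      Complex.exp ((2 * Real.pi * ζ i : ℂ) * (-k) * Complex.I)) ∈ (trigPolyHom d).range := by
    intro k
    refine ⟨AddMonoidAlgebra.single (Pi.single i k) 1, ?_⟩
    funext ζ
    change trigPolyHom d _ ζ = _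
    rw [trigPolyHom, AddMonoidAlgebra.lift_single, one_smul]
    change expChar _ _ = _
    rw [expChar]
    congr 1
    simp only [PiLp.inner_apply, RCLike.inner_apply, conj_trivial, PiLp.neg_apply, intVec_apply,
      toAdd_ofAdd]
    rw [Finset.sum_eq_single i (by
      intro j _ hj; simp [Pi.single_eq_of_ne hj]) (by simp)]
    simp
    ring
  have h1 : (fun ζ : EuclideanSpace ℝ (Fin d) => (Real.sin (2 * Real.pi * ζ i + c) : ℂ)) =
      (Complex.exp (-c * Complex.I) * Complex.I / 2) • (fun ζ : EuclideanSpace ℝ (Fin d) =>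
        Complex.exp ((2 * Real.pi * ζ i : ℂ) * (-(1 : ℤ)) * Complex.I)) -
      (Complex.exp (c * Complex.I) * Complex.I / 2) • (fun ζ : EuclideanSpace ℝ (Fin d) =>
        Complex.exp ((2 * Real.pi * ζ i : ℂ) * (-(-1 : ℤ)) * Complex.I)) := by
    funext ζ
    simp only [Pi.sub_apply, Pi.smul_apply, smul_eq_mul]
    have e1 : Complex.exp (-(c : ℂ) * Complex.I) * Complex.I / 2 *
        Complex.exp ((2 * Real.pi * ζ i : ℂ) * (-(1 : ℤ)) * Complex.I) =
        Complex.exp (-(2 * Real.pi * ζ i + c : ℂ) * Complex.I) * Complex.I / 2 := by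
      rw [mul_div_assoc, mul_right_comm, ← Complex.exp_add, mul_div_assoc]
      congr 2
      push_cast
      ring
    have e2 : Complex.exp ((c : ℂ) * Complex.I) * Complex.I / 2 *
        Complex.exp ((2 * Real.pi * ζ i : ℂ) * (-(-1 : ℤ)) * Complex.I) =
        Complex.exp ((2 * Real.pi * ζ i + c : ℂ) * Complex.I) * Complex.I / 2 := by
      rw [mul_div_assoc, mul_right_comm, ← Complex.exp_add, mul_div_assoc]
      congr 2
      push_cast
      ring
    rw [e1, e2]
    push_cast
    rw [Complex.sin]
    ring
  rw [h1]
  exact Subalgebra.sub_mem _ (Subalgebra.smul_mem _ (h 1) _) (Subalgebra.smul_mem _ (h (-1)) _)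

/-- Removing the half angles makes the `2π`-periodicity, the evenness and the integrality of the
frequencies visible. -/
lemma trigG_eq_cos (Q : Matrix (Fin d) (Fin d) ℝ) (ξ : Fin d → ℝ) :
    trigG Q ξ = 2 * ∑ i, (Q ^ 2) i i * (1 - Real.cos (ξ i)) +
      2 * ∑ i, ∑ j ∈ Finset.Ioi i, (Q ^ 2) i j * Real.sin (ξ i) * Real.sin (ξ j) := by
  rw [trigG]
  congr 1
  rw [Finset.mul_sum, Finset.mul_sum]
  refine Finset.sum_congr rfl fun i _ => ?_
  have h1 : Real.cos (ξ i) = 1 - 2 * Real.sin (ξ i / 2) ^ 2 := by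
    rw [← mul_div_cancel₀ (ξ i) (two_ne_zero' ℝ), mul_div_assoc, Real.cos_two_mul,
      Real.cos_sq']
    ring_nf
  rw [h1]
  ring

lemma trigG_neg (Q : Matrix (Fin d) (Fin d) ℝ) (ξ : Fin d → ℝ) :
    trigG Q (-ξ) = trigG Q ξ := by
  simp [trigG_eq_cos]

lemma trigG_add_int (Q : Matrix (Fin d) (Fin d) ℝ) (ξ : Fin d → ℝ) (k : Fin d → ℤ) :
    trigG Q (ξ + (2 * Real.pi) • fun i => (k i : ℝ)) = trigG Q ξ := by
  have h1 : ∀ i, Real.cos (ξ i + 2 * Real.pi * k i) = Real.cos (ξ i) := fun i => by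
    rw [mul_comm]; exact Real.cos_add_int_mul_two_pi _ _
  have h2 : ∀ i, Real.sin (ξ i + 2 * Real.pi * k i) = Real.sin (ξ i) := fun i => by
    rw [mul_comm]; exact Real.sin_add_int_mul_two_pi _ _
  simp [trigG_eq_cos, h1, h2]

lemma trigG_congr (Q : Matrix (Fin d) (Fin d) ℝ) {x y : Fin d → ℝ} (k : Fin d → ℤ)
    (h : ∀ i, x i = y i + k i) (ξ : Fin d → ℝ) :
    trigG Q (ξ + (2 * Real.pi) • x) = trigG Q (ξ + (2 * Real.pi) • y) := by
  have : x = y + fun i => (k i : ℝ) := funext h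
  rw [this, smul_add, ← add_assoc, trigG_add_int]

lemma trigG_mem_trigPoly (Q : Matrix (Fin d) (Fin d) ℝ) (c : Fin d → ℝ) :
    (fun ζ : EuclideanSpace ℝ (Fin d) => (trigG Q ((2 * Real.pi) • ⇑ζ + c) : ℂ)) ∈
      (trigPolyHom d).range := by
  have hs := fun i => sin_mem_trigPoly i (c i)
  have hc : ∀ i, (fun ζ : EuclideanSpace ℝ (Fin d) =>
      (Real.cos (2 * Real.pi * ζ i + c i) : ℂ)) ∈ (trigPolyHom d).range := by
    intro i
    convert sin_mem_trigPoly i (c i + Real.pi / 2) using 3 with ζ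
    rw [← add_assoc, Real.sin_add_pi_div_two]
  have : (fun ζ : EuclideanSpace ℝ (Fin d) => (trigG Q ((2 * Real.pi) • ⇑ζ + c) : ℂ)) =
      (2 : ℂ) • ∑ i, ((Q ^ 2) i i : ℂ) • ((1 : EuclideanSpace ℝ (Fin d) → ℂ) -
        fun ζ : EuclideanSpace ℝ (Fin d) => (Real.cos (2 * Real.pi * ζ i + c i) : ℂ)) +
      (2 : ℂ) • ∑ i, ∑ j ∈ Finset.Ioi i, ((Q ^ 2) i j : ℂ) •
        ((fun ζ : EuclideanSpace ℝ (Fin d) => (Real.sin (2 * Real.pi * ζ i + c i) : ℂ)) *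
        fun ζ : EuclideanSpace ℝ (Fin d) => (Real.sin (2 * Real.pi * ζ j + c j) : ℂ)) := by
    funext ζ
    simp only [trigG_eq_cos, Pi.add_apply, Pi.smul_apply, Finset.sum_apply, Pi.sub_apply,
      Pi.one_apply, Pi.mul_apply, smul_eq_mul]
    push_cast
    simp only [mul_assoc]
  rw [this]
  refine Subalgebra.add_mem _ (Subalgebra.smul_mem _ (Subalgebra.sum_mem _ fun i _ =>
    Subalgebra.smul_mem _ (Subalgebra.sub_mem _ (Subalgebra.one_mem _) (hc i)) _) _)
    (Subalgebra.smul_mem _ (Subalgebra.sum_mem _ fun i _ => Subalgebra.sum_mem _ fun j _ =>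
      Subalgebra.smul_mem _ (Subalgebra.mul_mem _ (hs i) (hs j)) _) _)

lemma mask_mem_trigPoly {A : Matrix (Fin d) (Fin d) ℤ} (hA : A.det ≠ 0)
    (Q : Matrix (Fin d) (Fin d) ℝ) :
    (fun ζ : EuclideanSpace ℝ (Fin d) => (mask A Q ((2 * Real.pi) • ⇑ζ) : ℂ)) ∈
      (trigPolyHom d).range := by
  obtain ⟨S, -, hS⟩ := mask_eq hA Q
  have : (fun ζ : EuclideanSpace ℝ (Fin d) => (mask A Q ((2 * Real.pi) • ⇑ζ) : ℂ)) =
      ((∏ s ∈ S, trigG Q ((2 * Real.pi) • s) : ℝ) : ℂ)⁻¹ • ∏ s ∈ S,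
        fun ζ : EuclideanSpace ℝ (Fin d) =>
          (trigG Q ((2 * Real.pi) • ⇑ζ + (2 * Real.pi) • s) : ℂ) := by
    funext ζ
    rw [hS, Pi.smul_apply, Finset.prod_apply, smul_eq_mul]
    push_cast
    rw [div_eq_inv_mul]
  rw [this]
  exact Subalgebra.smul_mem _ (Subalgebra.prod_mem _ fun s _ => trigG_mem_trigPoly Q _) _

lemma exists_mask_pow_eq {A : Matrix (Fin d) (Fin d) ℤ} (hA : A.det ≠ 0)
    (Q : Matrix (Fin d) (Fin d) ℝ) (m : ℕ) :
    ∃ (S : Finset (Fin d → ℤ)) (a : (Fin d → ℤ) → ℂ), ∀ ζ : EuclideanSpace ℝ (Fin d),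
      ((mask A Q ((2 * Real.pi) • ⇑ζ) ^ m : ℝ) : ℂ) = ∑ l ∈ S, a l * expChar (-intVec l) ζ := by
  obtain ⟨a, ha⟩ := Subalgebra.pow_mem _ (mask_mem_trigPoly hA Q) m
  refine ⟨a.coeff.support, a.coeff, fun ζ => ?_⟩
  rw [← trigPolyHom_apply]
  have := congrFun ha ζ
  simp only [Pi.pow_apply] at this
  rw [Complex.ofReal_pow, ← this]
  rfl

/-- Reduction modulo `ℤ^d` of a point that `M` maps to an integer vector. -/
lemma fract_mem_digitSet {M : Matrix (Fin d) (Fin d) ℤ} {x : Fin d → ℝ} (k : Fin d → ℤ)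
    (hk : (M.map (Int.cast : ℤ → ℝ)) *ᵥ x = fun i => (k i : ℝ)) :
    (fun i => Int.fract (x i)) ∈ digitSet M := by
  refine ⟨fun i => ⟨Int.fract_nonneg _, Int.fract_lt_one _⟩, k - M *ᵥ fun i => ⌊x i⌋, ?_⟩
  funext i
  have h1 := congrFun hk i
  simp only [Matrix.mulVec, dotProduct, Matrix.map_apply, Pi.sub_apply] at h1 ⊢
  push_cast
  rw [← h1, ← Finset.sum_sub_distrib]
  exact Finset.sum_congr rfl fun j _ => by rw [← mul_sub, Int.self_sub_floor]

/-- The map is `s ↦ -s` modulo `ℤ^d`, an involution of the digit set fixing `0`. -/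
lemma neg_fract_bijOn (M : Matrix (Fin d) (Fin d) ℤ) :
    Set.BijOn (fun (s : Fin d → ℝ) i => Int.fract (-s i)) (digitSet M \ {0})
      (digitSet M \ {0}) := by
  have hinv : ∀ s ∈ digitSet M, (fun i => Int.fract (-Int.fract (-s i))) = s := by
    intro s hs
    funext i
    have h1 : -Int.fract (-s i) = s i + ⌊-s i⌋ := by
      have := Int.self_sub_floor (-s i); linarith
    rw [h1, Int.fract_add_intCast, Int.fract_eq_self.2 (hs.1 i)]
  have hmaps : Set.MapsTo (fun (s : Fin d → ℝ) i => Int.fract (-s i)) (digitSet M \ {0})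
      (digitSet M \ {0}) := by
    rintro s ⟨hs, h0⟩
    obtain ⟨k, hk⟩ := hs.2
    refine ⟨fract_mem_digitSet (x := -s) (-k) ?_, fun h => h0 ?_⟩
    · rw [Matrix.mulVec_neg, hk]; funext i; simp
    · rw [Set.mem_singleton_iff, ← hinv s hs]
      funext i
      have h1 : Int.fract (-s i) = 0 := congrFun (Set.mem_singleton_iff.1 h) i
      change Int.fract (-Int.fract (-s i)) = 0
      rw [h1, neg_zero, Int.fract_zero]
  refine ⟨hmaps, fun s hs t ht hst => ?_, fun s hs => ⟨_, hmaps hs, hinv s hs.1⟩⟩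
  rw [← hinv s hs.1, ← hinv t ht.1]
  funext i
  exact congrArg (fun x => Int.fract (-x)) (congrFun hst i)

/-- As `G` is even and periodic, changing the sign of `ξ` only permutes the factors. -/
lemma mask_neg (A : Matrix (Fin d) (Fin d) ℤ) (Q : Matrix (Fin d) (Fin d) ℝ) (ξ : Fin d → ℝ) :
    mask A Q (-ξ) = mask A Q ξ := by
  rw [mask, mask]
  congr 1
  refine finprod_mem_eq_of_bijOn _ (neg_fract_bijOn Aᵀ) fun s _ => ?_
  rw [← trigG_neg, neg_add, neg_neg, ← smul_neg]
  refine trigG_congr Q (fun i => ⌊-s i⌋) (fun i => ?_) ξ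
  have := Int.self_sub_floor (-s i)
  simp only [Pi.neg_apply]
  linarith

lemma phiHat_neg (A : Matrix (Fin d) (Fin d) ℤ) (Q : Matrix (Fin d) (Fin d) ℝ) (ξ : Fin d → ℝ) :
    phiHat A Q (-ξ) = phiHat A Q ξ := by
  simp only [phiHat, Matrix.mulVec_neg, mask_neg]

end TrigonometricPolynomials

/-! ### Linear changes of variables and the Fourier transform. -/

section Dilation

variable {d : ℕ}

/-- A real matrix as an operator on the Euclidean space. -/
noncomputable abbrev matrixCLM (M : Matrix (Fin d) (Fin d) ℝ) :
    EuclideanSpace ℝ (Fin d) →L[ℝ] EuclideanSpace ℝ (Fin d) :=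
  Matrix.toEuclideanCLM (n := Fin d) (𝕜 := ℝ) M

lemma matrixCLM_mul_apply (M N : Matrix (Fin d) (Fin d) ℝ) (x : EuclideanSpace ℝ (Fin d)) :
    matrixCLM M (matrixCLM N x) = matrixCLM (M * N) x := by
  rw [matrixCLM, matrixCLM, matrixCLM, map_mul]; rfl

lemma matrixCLM_one_apply (x : EuclideanSpace ℝ (Fin d)) :
    matrixCLM (1 : Matrix (Fin d) (Fin d) ℝ) x = x := by
  rw [matrixCLM, map_one]; rfl

lemma inner_matrixCLM_left (M : Matrix (Fin d) (Fin d) ℝ) (x y : EuclideanSpace ℝ (Fin d)) :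
    inner ℝ (matrixCLM M x) y = inner ℝ x (matrixCLM Mᵀ y) := by
  simp only [EuclideanSpace.inner_eq_star_dotProduct, Matrix.ofLp_toEuclideanCLM, star_trivial]
  rw [Matrix.dotProduct_mulVec, Matrix.mulVec_transpose]

lemma expChar_matrixCLM (M : Matrix (Fin d) (Fin d) ℝ) (v ζ : EuclideanSpace ℝ (Fin d)) :
    expChar v (matrixCLM M ζ) = expChar (matrixCLM Mᵀ v) ζ := by
  rw [expChar, expChar, inner_matrixCLM_left, Matrix.transpose_transpose]

/-- An invertible real matrix as a linear automorphism of the Euclidean space. -/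
noncomputable def matrixEquiv (M : Matrix (Fin d) (Fin d) ℝ) (hM : IsUnit M.det) :
    EuclideanSpace ℝ (Fin d) ≃L[ℝ] EuclideanSpace ℝ (Fin d) :=
  ContinuousLinearEquiv.equivOfInverse (matrixCLM M) (matrixCLM M⁻¹)
    (fun x => by rw [matrixCLM_mul_apply, Matrix.nonsing_inv_mul _ hM, matrixCLM_one_apply])
    (fun x => by rw [matrixCLM_mul_apply, Matrix.mul_nonsing_inv _ hM, matrixCLM_one_apply])

lemma integral_comp_matrixCLM {M : Matrix (Fin d) (Fin d) ℝ} (hM : M.det ≠ 0)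
    (F : EuclideanSpace ℝ (Fin d) → ℂ) :
    ∫ x, F (matrixCLM M x) = ((|M.det|⁻¹ : ℝ) : ℂ) * ∫ x, F x := by
  have hdet : LinearMap.det (matrixCLM M : EuclideanSpace ℝ (Fin d) →ₗ[ℝ] _) = M.det :=
    LinearMap.det_toLpLin 2 M
  have h1 := MeasureTheory.Measure.map_linearMap_addHaar_eq_smul_addHaar
    (MeasureTheory.volume : MeasureTheory.Measure (EuclideanSpace ℝ (Fin d)))
    (f := (matrixCLM M : EuclideanSpace ℝ (Fin d) →ₗ[ℝ] _)) (by rwa [hdet])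
  have h2 : MeasurableEmbedding (matrixCLM M) :=
    (matrixEquiv M (isUnit_iff_ne_zero.2 hM)).toHomeomorph.measurableEmbedding
  rw [← h2.integral_map]
  change ∫ y, F y ∂(MeasureTheory.Measure.map (matrixCLM M : EuclideanSpace ℝ (Fin d) →ₗ[ℝ] _) _) = _
  rw [h1, MeasureTheory.integral_smul_measure, hdet, abs_inv, ENNReal.toReal_ofReal (by positivity)]
  simp

lemma fourierInv_apply_eq_integral (ψ : 𝓢(EuclideanSpace ℝ (Fin d), ℂ))
    (η : EuclideanSpace ℝ (Fin d)) : (𝓕⁻ ψ) η = ∫ x, expChar x η * ψ x := by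
  rw [SchwartzMap.fourierInv_coe, Real.fourierInv_eq']
  rfl

lemma fourierInv_compSubConst (v : EuclideanSpace ℝ (Fin d)) (ψ : 𝓢(EuclideanSpace ℝ (Fin d), ℂ))
    (η : EuclideanSpace ℝ (Fin d)) :
    (𝓕⁻ (SchwartzMap.compSubConstCLM ℂ (-v) ψ)) η = expChar (-v) η * (𝓕⁻ ψ) η := by
  rw [fourierInv_apply_eq_integral, fourierInv_apply_eq_integral,
    ← MeasureTheory.integral_const_mul,
    ← MeasureTheory.integral_add_right_eq_self (fun x => expChar (-v) η * (expChar x η * ψ x)) v]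
  refine MeasureTheory.integral_congr_ae (Filter.Eventually.of_forall fun x => ?_)
  simp only [SchwartzMap.compSubConstCLM_apply, sub_neg_eq_add]
  rw [← mul_assoc, ← expChar_add_left]
  simp

lemma fourierInv_comp_matrix {M : Matrix (Fin d) (Fin d) ℝ} (hM : IsUnit M.det)
    (ψ : 𝓢(EuclideanSpace ℝ (Fin d), ℂ)) (ζ : EuclideanSpace ℝ (Fin d)) :
    (𝓕⁻ (SchwartzMap.compCLMOfContinuousLinearEquiv ℂ (matrixEquiv M hM) ψ)) (matrixCLM Mᵀ ζ) =
      ((|M.det|⁻¹ : ℝ) : ℂ) * (𝓕⁻ ψ) ζ := by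
  rw [fourierInv_apply_eq_integral, fourierInv_apply_eq_integral,
    ← integral_comp_matrixCLM hM.ne_zero]
  refine MeasureTheory.integral_congr_ae (Filter.Eventually.of_forall fun x => ?_)
  simp only
  rw [expChar_matrixCLM, Matrix.transpose_transpose]
  rfl

end Dilation

/-! ### The refinement equation. -/

section Refinement

variable {d : ℕ} {A : Matrix (Fin d) (Fin d) ℤ} {Q U : Matrix (Fin d) (Fin d) ℝ}

lemma ellipticScalingFunction_apply (hd : 0 < d) (hA : IsDilationMatrix A) (h : IsFactorization A Q U) (m : ℕ) (ψ : 𝓢(EuclideanSpace ℝ (Fin d), ℂ)) :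
    ellipticScalingFunction hd hA h m ψ = ∫ η, fourierSide A Q m η * (𝓕⁻ ψ) η := rfl

lemma integerShift_eq (hd : 0 < d) (hA : IsDilationMatrix A) (h : IsFactorization A Q U) (m : ℕ) (k : Fin d → ℤ) (ψ : 𝓢(EuclideanSpace ℝ (Fin d), ℂ)) :
    integerShift (ellipticScalingFunction hd hA h m) k ψ =
      ∫ η, fourierSide A Q m η * (expChar (-intVec k) η * (𝓕⁻ ψ) η) := by
  rw [integerShift, ellipticScalingFunction_apply]
  simp only [← fourierInv_compSubConst]
  rfl

lemma integrable_integerShift (hd : 0 < d) (hA : IsDilationMatrix A) (h : IsFactorization A Q U) (m : ℕ) (k : Fin d → ℤ) (ψ : 𝓢(EuclideanSpace ℝ (Fin d), ℂ)) :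
    MeasureTheory.Integrable
      fun η => fourierSide A Q m η * (expChar (-intVec k) η * (𝓕⁻ ψ) η) := by
  simp only [← fourierInv_compSubConst]
  exact integrable_mul_schwartz (fourierSide_slowlyIncreasing hd hA h m) _

/-- The matrix `A` with real entries. -/
noncomputable abbrev realMatrix (A : Matrix (Fin d) (Fin d) ℤ) : Matrix (Fin d) (Fin d) ℝ :=
  A.map (Int.cast : ℤ → ℝ)

lemma det_realMatrix (A : Matrix (Fin d) (Fin d) ℤ) : (realMatrix A).det = A.det :=
  (Int.cast_det A).symm

lemma isUnit_det_realMatrix (hd : 0 < d) (hA : IsDilationMatrix A) : IsUnit (realMatrix A).det := by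
  rw [det_realMatrix, isUnit_iff_ne_zero]
  exact_mod_cast det_ne_zero hd hA

lemma invTranspose_mulVec_transpose (hd : 0 < d) (hA : IsDilationMatrix A) (x : Fin d → ℝ) :
    invTranspose A *ᵥ ((realMatrix A)ᵀ *ᵥ x) = x := by
  rw [invTranspose, Matrix.mulVec_mulVec, Matrix.nonsing_inv_mul _ (by
    rw [Matrix.det_transpose]; exact isUnit_det_realMatrix hd hA), Matrix.one_mulVec]

lemma transpose_mulVec_invTranspose (hd : 0 < d) (hA : IsDilationMatrix A) (x : Fin d → ℝ) :
    (realMatrix A)ᵀ *ᵥ (invTranspose A *ᵥ x) = x := by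
  rw [invTranspose, Matrix.mulVec_mulVec, Matrix.mul_nonsing_inv _ (by
    rw [Matrix.det_transpose]; exact isUnit_det_realMatrix hd hA), Matrix.one_mulVec]

lemma fourierSide_refine (hd : 0 < d) (hA : IsDilationMatrix A) (h : IsFactorization A Q U) (m : ℕ)
    (ζ : EuclideanSpace ℝ (Fin d)) :
    fourierSide A Q m (matrixCLM (realMatrix A)ᵀ ζ) =
      ((mask A Q ((2 * Real.pi) • ⇑ζ) ^ m : ℝ) : ℂ) * fourierSide A Q m ζ := by
  have h1 : (fun i => 2 * Real.pi * (matrixCLM (realMatrix A)ᵀ ζ) i) =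
      (realMatrix A)ᵀ *ᵥ ((2 * Real.pi) • ⇑ζ) := by
    rw [Matrix.mulVec_smul, ← Matrix.ofLp_toEuclideanCLM]
    rfl
  rw [fourierSide, h1, phiHat_refine hd hA h, invTranspose_mulVec_transpose hd hA, fourierSide,
    ← Complex.ofReal_mul, mul_pow]
  congr 1
  rw [mul_left_comm]
  rfl

lemma matrixCLM_intVec (A : Matrix (Fin d) (Fin d) ℤ) (k : Fin d → ℤ) :
    matrixCLM (realMatrix A) (intVec k) = intVec (A *ᵥ k) := by
  ext i
  rw [Matrix.ofLp_toEuclideanCLM]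
  simp [Matrix.mulVec, dotProduct]

/-- The refinement equation. -/
lemma integerShift_comp_matrix (hd : 0 < d) (hA : IsDilationMatrix A) (h : IsFactorization A Q U) (m : ℕ) : ∃ (S : Finset (Fin d → ℤ)) (a : (Fin d → ℤ) → ℂ),
    ∀ (k : Fin d → ℤ) (ψ : 𝓢(EuclideanSpace ℝ (Fin d), ℂ)),
      integerShift (ellipticScalingFunction hd hA h m) k
        (SchwartzMap.compCLMOfContinuousLinearEquiv ℂ
          (matrixEquiv (realMatrix A) (isUnit_det_realMatrix hd hA)) ψ) =
      ∑ l ∈ S, a l * integerShift (ellipticScalingFunction hd hA h m) (A *ᵥ k + l) ψ := by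
  obtain ⟨S, a, ha⟩ := exists_mask_pow_eq (det_ne_zero hd hA) Q m
  refine ⟨S, a, fun k ψ => ?_⟩
  have hu := isUnit_det_realMatrix hd hA
  have hdet : ((realMatrix A)ᵀ).det ≠ 0 := by rw [Matrix.det_transpose]; exact hu.ne_zero
  simp only [integerShift_eq]
  -- Substituting `η = Aᵀ ζ` brings out the trigonometric polynomial `m₀^m`, while the character of
  -- frequency `-k` becomes the one of frequency `-A k`. The Jacobian also appears in the transform
  -- of the dilated test function and cancels.
  have h1 := integral_comp_matrixCLM hdet fun η => fourierSide A Q m η *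
    (expChar (-intVec k) η * (𝓕⁻ (SchwartzMap.compCLMOfContinuousLinearEquiv ℂ
      (matrixEquiv (realMatrix A) hu) ψ)) η)
  have h2 : ∀ ζ, fourierSide A Q m (matrixCLM (realMatrix A)ᵀ ζ) *
      (expChar (-intVec k) (matrixCLM (realMatrix A)ᵀ ζ) *
        (𝓕⁻ (SchwartzMap.compCLMOfContinuousLinearEquiv ℂ (matrixEquiv (realMatrix A) hu) ψ))
          (matrixCLM (realMatrix A)ᵀ ζ)) =
      ((|(realMatrix A)ᵀ.det|⁻¹ : ℝ) : ℂ) * ∑ l ∈ S, a l * (fourierSide A Q m ζ *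
        (expChar (-intVec (A *ᵥ k + l)) ζ * (𝓕⁻ ψ) ζ)) := by
    intro ζ
    rw [fourierSide_refine hd hA h, ha, fourierInv_comp_matrix, Matrix.det_transpose,
      expChar_matrixCLM, Matrix.transpose_transpose, map_neg, matrixCLM_intVec]
    simp only [Finset.mul_sum, Finset.sum_mul]
    refine Finset.sum_congr rfl fun l _ => ?_
    rw [intVec_add, neg_add, expChar_add_left]
    ring
  simp only [h2] at h1
  rw [MeasureTheory.integral_const_mul] at h1
  have h3 : ((|(realMatrix A)ᵀ.det|⁻¹ : ℝ) : ℂ) ≠ 0 := by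
    exact_mod_cast inv_ne_zero (abs_ne_zero.2 hdet)
  rw [← mul_left_cancel₀ h3 h1, MeasureTheory.integral_finsetSum _ fun l _ =>
    (integrable_integerShift hd hA h m _ ψ).const_mul _]
  simp only [MeasureTheory.integral_const_mul]

end Refinement

/-! ### Exponential sums with bounded frequencies, and growth of the partial products. -/

section CompactSupport

variable {d : ℕ}

/-- The span of the characters with frequencies in the ball of radius `r`. -/
noncomputable def charSpan (d : ℕ) (r : ℝ) : Submodule ℂ (EuclideanSpace ℝ (Fin d) → ℂ) :=
  Submodule.span ℂ (expChar '' Metric.closedBall 0 r)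

lemma charSpan_mono {r s : ℝ} (hrs : r ≤ s) : charSpan d r ≤ charSpan d s :=
  Submodule.span_mono (Set.image_mono (Metric.closedBall_subset_closedBall hrs))

lemma mul_mem_charSpan {r s : ℝ} {F G : EuclideanSpace ℝ (Fin d) → ℂ} (hF : F ∈ charSpan d r)
    (hG : G ∈ charSpan d s) : F * G ∈ charSpan d (r + s) := by
  have h1 := Submodule.mul_mem_mul hF hG
  rw [charSpan, charSpan, Submodule.span_mul_span] at h1
  refine Submodule.span_mono ?_ h1
  rintro _ ⟨_, ⟨v, hv, rfl⟩, _, ⟨w, hw, rfl⟩, rfl⟩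
  refine ⟨v + w, ?_, funext fun ζ => expChar_add_left v w ζ⟩
  rw [mem_closedBall_zero_iff] at hv hw ⊢
  exact (norm_add_le _ _).trans (add_le_add hv hw)

lemma one_mem_charSpan {r : ℝ} (hr : 0 ≤ r) : (1 : EuclideanSpace ℝ (Fin d) → ℂ) ∈ charSpan d r :=
  Submodule.subset_span ⟨0, by simpa, funext fun ζ => expChar_zero_left ζ⟩

lemma prod_mem_charSpan {F : ℕ → EuclideanSpace ℝ (Fin d) → ℂ} {r : ℕ → ℝ}
    (hF : ∀ j, F j ∈ charSpan d (r j)) (n : ℕ) :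
    ∏ j ∈ Finset.range n, F j ∈ charSpan d (∑ j ∈ Finset.range n, r j) := by
  induction n with
  | zero => simpa using one_mem_charSpan le_rfl
  | succ n ih => rw [Finset.prod_range_succ, Finset.sum_range_succ]; exact mul_mem_charSpan ih (hF n)

lemma comp_matrixCLM_mem_charSpan {M : Matrix (Fin d) (Fin d) ℝ} {c r : ℝ} (hc : 0 ≤ c)
    (hM : ∀ v, ‖matrixCLM Mᵀ v‖ ≤ c * ‖v‖) {F : EuclideanSpace ℝ (Fin d) → ℂ}
    (hF : F ∈ charSpan d r) : (fun ζ => F (matrixCLM M ζ)) ∈ charSpan d (c * r) := by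
  induction hF using Submodule.span_induction with
  | mem F hF =>
    obtain ⟨v, hv, rfl⟩ := hF
    refine Submodule.subset_span ⟨matrixCLM Mᵀ v, ?_, funext fun ζ => (expChar_matrixCLM M v ζ).symm⟩
    rw [mem_closedBall_zero_iff] at hv ⊢
    exact (hM v).trans (mul_le_mul_of_nonneg_left hv hc)
  | zero => exact Submodule.zero_mem _
  | add F G _ _ hF hG => exact Submodule.add_mem _ hF hG
  | smul a F _ hF => exact Submodule.smul_mem _ a hF

/-- By Fourier inversion the pairing with the character of frequency `v` is evaluation of `ψ` at
`-v`, a point of the same ball. -/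
lemma integral_charSpan_mul_fourierInv {r : ℝ} {F : EuclideanSpace ℝ (Fin d) → ℂ}
    (hF : F ∈ charSpan d r) (ψ : 𝓢(EuclideanSpace ℝ (Fin d), ℂ)) (hψ : ∀ x, ‖x‖ ≤ r → ψ x = 0) :
    ∫ ζ, F ζ * (𝓕⁻ ψ) ζ = 0 := by
  -- Integrability is carried through the induction, since additivity of the integral requires it.
  suffices MeasureTheory.Integrable (fun ζ => F ζ * (𝓕⁻ ψ) ζ) ∧ ∫ ζ, F ζ * (𝓕⁻ ψ) ζ = 0 from this.2
  induction hF using Submodule.span_induction with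
  | mem F hF =>
    obtain ⟨v, hv, rfl⟩ := hF
    constructor
    · refine (𝓕⁻ ψ).integrable.bdd_mul (c := 1)
        (continuous_expChar v).aestronglyMeasurable (Filter.Eventually.of_forall fun ζ => ?_)
      rw [norm_expChar]
    · have h1 : (𝓕 (𝓕⁻ ψ)) (-v) = ψ (-v) := by rw [FourierTransform.fourier_fourierInv_eq]
      rw [SchwartzMap.fourier_coe, Real.fourier_eq', hψ (-v) (by
        rwa [norm_neg, ← mem_closedBall_zero_iff])] at h1
      rw [← h1]
      refine MeasureTheory.integral_congr_ae (Filter.Eventually.of_forall fun ζ => ?_)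
      simp only [expChar, smul_eq_mul]
      rw [inner_neg_right, real_inner_comm]
      ring_nf
  | zero => simp
  | add F G _ _ hF hG =>
    simp only [Pi.add_apply, add_mul]
    exact ⟨hF.1.add hG.1, by rw [MeasureTheory.integral_add hF.1 hG.1, hF.2, hG.2, add_zero]⟩
  | smul a F _ hF =>
    simp only [Pi.smul_apply, smul_eq_mul, mul_assoc]
    exact ⟨hF.1.const_mul a, by rw [MeasureTheory.integral_const_mul, hF.2, mul_zero]⟩

variable {A : Matrix (Fin d) (Fin d) ℤ} {Q U : Matrix (Fin d) (Fin d) ℝ}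

/-- The factorization makes `A⁻ᵀ` contract `qNorm` by exactly `ρ`, and `qNorm` is equivalent to the
Euclidean norm. The transpose is needed because composing a character with a matrix applies the
transpose to its frequency. -/
lemma norm_transpose_pow_le (hd : 0 < d) (hA : IsDilationMatrix A) (h : IsFactorization A Q U) :
    ∃ K, 0 ≤ K ∧ ∀ (j : ℕ) (v : EuclideanSpace ℝ (Fin d)),
      ‖matrixCLM (invTranspose A ^ j)ᵀ v‖ ≤
        K * (|(A.det : ℝ)| ^ (-(1 / (d : ℝ)))) ^ j * ‖v‖ := by
  obtain ⟨K, hK, hk⟩ := norm_le_qNorm h.posDef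
  obtain ⟨K', hK', hk'⟩ := qNorm_le Q
  obtain ⟨hρ0, -⟩ := rho_mem hd hA
  set ρ := |(A.det : ℝ)| ^ (-(1 / (d : ℝ)))
  -- `K` bounds the sup norm by `qNorm`, `K'` bounds `qNorm` by the Euclidean norm, and `√d`
  -- compares the sup norm with the Euclidean one.
  refine ⟨√d * K * K', by positivity, fun j v => ?_⟩
  set w := matrixCLM (invTranspose A ^ j)ᵀ v with hw
  have h1 : ‖matrixCLM (invTranspose A ^ j) w‖ ≤ √d * K * K' * ρ ^ j * ‖w‖ := by
    have h2 : ‖matrixCLM (invTranspose A ^ j) w‖ ≤ √d * ‖(invTranspose A ^ j) *ᵥ ⇑w‖ := by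
      have := (PiLp.lipschitzWith_toLp 2 (fun _ : Fin d => ℝ)).dist_le_mul
        ((invTranspose A ^ j) *ᵥ ⇑w) 0
      simp only [dist_zero_right, WithLp.toLp_zero] at this
      refine this.trans_eq ?_
      simp [Real.sqrt_eq_rpow]
    refine h2.trans ?_
    calc √d * ‖(invTranspose A ^ j) *ᵥ ⇑w‖ ≤ √d * (K * (ρ ^ j * (K' * ‖w‖))) := by
          gcongr
          refine (hk _).trans ?_
          rw [qNorm_pow h]
          gcongr
          exact hk' w
      _ = _ := by ring
  -- Duality: with `M` the `j`-th power and `w = Mᵀ v`, one has `⟨w, w⟩ = ⟨v, M w⟩`, so the bound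
  -- for `M` passes to its transpose.
  have h3 : ‖w‖ * ‖w‖ ≤ (√d * K * K' * ρ ^ j * ‖v‖) * ‖w‖ := by
    calc ‖w‖ * ‖w‖ = inner ℝ w w := (real_inner_self_eq_norm_mul_norm w).symm
      _ = inner ℝ v (matrixCLM (invTranspose A ^ j) w) := by
          nth_rw 1 [hw]
          rw [inner_matrixCLM_left, Matrix.transpose_transpose]
      _ ≤ ‖v‖ * ‖matrixCLM (invTranspose A ^ j) w‖ := real_inner_le_norm _ _
      _ ≤ ‖v‖ * (√d * K * K' * ρ ^ j * ‖w‖) := by gcongr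
      _ = _ := by ring
  rcases (norm_nonneg w).eq_or_lt with h0 | h0
  · rw [← h0]; positivity
  · exact le_of_mul_le_mul_right h3 h0

/-- The partial products of `φ̂` grow at most polynomially, uniformly in their length. -/
lemma partialProd_growth (hd : 0 < d) (hA : IsDilationMatrix A) (h : IsFactorization A Q U) :
    ∃ (C : ℝ) (p : ℕ), 0 ≤ C ∧ ∀ (n : ℕ) (ξ : Fin d → ℝ),
      |∏ j ∈ Finset.range n, mask A Q ((invTranspose A ^ (j + 1)) *ᵥ ξ)| ≤
      C * (max 1 (qNorm Q ξ / |(A.det : ℝ)| ^ (-(1 / (d : ℝ))))) ^ p := by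
  obtain ⟨C, hC, hb⟩ := mask_factor_bound hd hA h
  obtain ⟨hρ0, hρ1⟩ := rho_mem hd hA
  obtain ⟨M, hM⟩ := mask_bounded (Q := Q) (det_ne_zero hd hA)
  have hcon := qNorm_contract h
  set ρ := |(A.det : ℝ)| ^ (-(1 / (d : ℝ))) with hρ
  have hM0 : 0 ≤ M := (abs_nonneg _).trans (hM 0)
  -- The exponent is chosen with `M < ρ⁻¹ ^ p`: one more factor of the product costs at most `M`,
  -- which the gain `ρ⁻¹` in `qNorm` compensates.
  obtain ⟨p, hp⟩ := pow_unbounded_of_one_lt M (one_lt_inv_iff₀.2 ⟨hρ0, hρ1⟩)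
  have hinv : 0 ≤ (1 - ρ)⁻¹ := inv_nonneg.2 (by linarith)
  set C0 := Real.exp (C * (1 - ρ)⁻¹) with hC0
  have base : ∀ n ξ, qNorm Q ξ ≤ 1 →
      |∏ j ∈ Finset.range n, mask A Q ((invTranspose A ^ (j + 1)) *ᵥ ξ)| ≤ C0 := by
    intro n ξ hξ
    -- Padded with ones, the partial product is an infinite product with the same bound on its
    -- factors, so the estimate is uniform in `n`.
    have h1 : ∀ j, |(if j < n then mask A Q ((invTranspose A ^ (j + 1)) *ᵥ ξ) else 1) - 1| ≤
        C * qNorm Q ξ * ρ ^ j := by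
      intro j
      split_ifs
      · exact hb ξ j
      · have : 0 ≤ qNorm Q ξ := Real.sqrt_nonneg _
        rw [sub_self, abs_zero]
        positivity
    have h2 := (multipliable_and_bound (mul_nonneg hC (Real.sqrt_nonneg _)) hρ0.le hρ1 h1).2
    rw [tprod_eq_prod (s := Finset.range n) fun j hj => if_neg (by simpa using hj),
      Finset.prod_congr rfl fun j hj => if_pos (Finset.mem_range.1 hj)] at h2
    exact h2.trans (Real.exp_le_exp.2
      (mul_le_mul_of_nonneg_right (mul_le_of_le_one_right hC hξ) hinv))
  refine ⟨C0, p, (Real.exp_pos _).le, fun n => ?_⟩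
  induction n with
  | zero =>
    intro ξ
    simp only [Finset.range_zero, Finset.prod_empty, abs_one]
    exact one_le_mul_of_one_le_of_one_le (Real.one_le_exp (by positivity))
      (one_le_pow₀ (le_max_left _ _))
  | succ n ih =>
    intro ξ
    rcases le_or_gt (qNorm Q ξ) 1 with h1 | h1
    · exact (base _ ξ h1).trans
        (le_mul_of_one_le_right (Real.exp_pos _).le (one_le_pow₀ (le_max_left _ _)))
    -- Without its first factor, the product at `ξ` is the product of length `n` at `A⁻ᵀ ξ`, where
    -- `qNorm` is smaller by the factor `ρ`.
    have h2 := ih (invTranspose A *ᵥ ξ)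
    rw [hcon, mul_div_cancel_left₀ _ hρ0.ne', max_eq_right h1.le] at h2
    simp only [Matrix.mulVec_mulVec, ← pow_succ] at h2
    rw [Finset.prod_range_succ', abs_mul]
    calc _ ≤ (C0 * qNorm Q ξ ^ p) * M := by
          gcongr
          exact hM _
      _ ≤ (C0 * qNorm Q ξ ^ p) * ρ⁻¹ ^ p := by
          have : 0 ≤ qNorm Q ξ := Real.sqrt_nonneg _
          gcongr
      _ = C0 * (qNorm Q ξ / ρ) ^ p := by rw [div_eq_mul_inv, mul_pow]; ring
      _ ≤ _ := by
          have : 0 ≤ qNorm Q ξ / ρ := by positivity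
          gcongr
          exact le_max_right _ _

end CompactSupport

/-! ### Compact support and reality of the scaling function. -/

section SupportAndReality

variable {d : ℕ} {A : Matrix (Fin d) (Fin d) ℤ} {Q U : Matrix (Fin d) (Fin d) ℝ}

lemma mask_pow_mem_charSpan (hA : A.det ≠ 0) (Q : Matrix (Fin d) (Fin d) ℝ) (m : ℕ) :
    ∃ r : ℝ, 0 ≤ r ∧ (fun ζ : EuclideanSpace ℝ (Fin d) =>
      ((mask A Q ((2 * Real.pi) • ⇑ζ) ^ m : ℝ) : ℂ)) ∈ charSpan d r := by
  obtain ⟨S, a, ha⟩ := exists_mask_pow_eq hA Q m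
  refine ⟨∑ l ∈ S, ‖intVec l‖, Finset.sum_nonneg fun _ _ => norm_nonneg _, ?_⟩
  have h1 : (fun ζ : EuclideanSpace ℝ (Fin d) =>
      ((mask A Q ((2 * Real.pi) • ⇑ζ) ^ m : ℝ) : ℂ)) = ∑ l ∈ S, a l • expChar (-intVec l) := by
    funext ζ
    rw [ha, Finset.sum_apply]
    rfl
  rw [h1]
  refine Submodule.sum_mem _ fun l hl => Submodule.smul_mem _ _ (Submodule.subset_span ⟨_, ?_, rfl⟩)
  rw [mem_closedBall_zero_iff, norm_neg]
  exact Finset.single_le_sum (f := fun l => ‖intVec l‖) (fun _ _ => norm_nonneg _) hl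

/-- The bound is independent of `n` and so furnishes the majorant for dominated convergence of the
partial products. -/
lemma partialProd_slowGrowth (hd : 0 < d) (hA : IsDilationMatrix A) (h : IsFactorization A Q U)
    (m : ℕ) : ∃ (C : ℝ) (N : ℕ), ∀ (n : ℕ) (ζ : EuclideanSpace ℝ (Fin d)),
      |(∏ j ∈ Finset.range n, mask A Q ((invTranspose A ^ (j + 1)) *ᵥ ((2 * Real.pi) • ⇑ζ))) ^ m| ≤
        C * (1 + ‖ζ‖) ^ N := by
  obtain ⟨C, p, hC, hb⟩ := partialProd_growth hd hA h
  obtain ⟨K, hK, hk⟩ := qNorm_le Q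
  obtain ⟨hρ0, hρ1⟩ := rho_mem hd hA
  set ρ := |(A.det : ℝ)| ^ (-(1 / (d : ℝ))) with hρ
  set L := max 1 (K * (2 * Real.pi) / ρ) with hL
  have hL0 : 0 ≤ L := zero_le_one.trans (le_max_left _ _)
  refine ⟨(C * L ^ p) ^ m, p * m, fun n ζ => ?_⟩
  have h2 := hk ((2 * Real.pi) • ζ)
  rw [norm_smul, Real.norm_of_nonneg (by positivity)] at h2
  have h3 : qNorm Q ((2 * Real.pi) • ⇑ζ) / ρ ≤ L * ‖ζ‖ := by
    calc _ ≤ K * (2 * Real.pi * ‖ζ‖) / ρ := by gcongr; exact h2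
      _ = K * (2 * Real.pi) / ρ * ‖ζ‖ := by ring
      _ ≤ _ := by gcongr; exact le_max_right _ _
  have h4 : max 1 (qNorm Q ((2 * Real.pi) • ⇑ζ) / ρ) ≤ L * (1 + ‖ζ‖) := by
    have : 1 ≤ L := le_max_left _ _
    apply max_le <;> nlinarith [norm_nonneg ζ]
  rw [abs_pow]
  calc _ ≤ (C * (L * (1 + ‖ζ‖)) ^ p) ^ m := by
        gcongr
        refine (hb n _).trans ?_
        gcongr
    _ = _ := by rw [mul_pow L, pow_mul]; ring

/-- The pairing with the `n`-th partial product of `φ̂^m`. -/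
lemma tendsto_integral_partialProd (hd : 0 < d) (hA : IsDilationMatrix A)
    (h : IsFactorization A Q U) (m : ℕ) (ψ : 𝓢(EuclideanSpace ℝ (Fin d), ℂ)) :
    Filter.Tendsto (fun n => ∫ ζ : EuclideanSpace ℝ (Fin d), (((2 * Real.pi) ^ ((d : ℝ) / 2) *
      (∏ j ∈ Finset.range n, mask A Q ((invTranspose A ^ (j + 1)) *ᵥ
        ((2 * Real.pi) • ⇑ζ))) ^ m : ℝ) : ℂ) * (𝓕⁻ ψ) ζ)
      Filter.atTop (nhds (ellipticScalingFunction hd hA h m ψ)) := by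
  obtain ⟨C, N, hC⟩ := partialProd_slowGrowth hd hA h m
  have hmc := (mask_differentiable (Q := Q) (det_ne_zero hd hA)).continuous
  have hcont : ∀ n, Continuous fun ζ : EuclideanSpace ℝ (Fin d) =>
      ∏ j ∈ Finset.range n, mask A Q ((invTranspose A ^ (j + 1)) *ᵥ ((2 * Real.pi) • ⇑ζ)) := by
    intro n
    refine continuous_finsetProd _ fun j _ => hmc.comp ?_
    exact (Matrix.mulVecLin (invTranspose A ^ (j + 1))).continuous_of_finiteDimensional.comp
      ((PiLp.continuous_ofLp 2 _).const_smul (2 * Real.pi))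
  have hslow : IsSlowlyIncreasing fun ζ : EuclideanSpace ℝ (Fin d) =>
      (((2 * Real.pi) ^ ((d : ℝ) / 2) * (C * (1 + ‖ζ‖) ^ N) : ℝ) : ℂ) := by
    refine ⟨by fun_prop, |(2 * Real.pi) ^ ((d : ℝ) / 2) * C|, N, fun x => ?_⟩
    rw [Complex.norm_real, Real.norm_eq_abs, ← mul_assoc, abs_mul,
      abs_of_nonneg (a := (1 + ‖x‖) ^ N) (by positivity)]
  rw [ellipticScalingFunction_apply]
  refine MeasureTheory.tendsto_integral_of_dominated_convergence _ (fun n => ?_)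
    (integrable_mul_schwartz hslow (𝓕⁻ ψ)).norm (fun n => Filter.Eventually.of_forall fun ζ => ?_)
    (Filter.Eventually.of_forall fun ζ => ?_)
  · exact Continuous.aestronglyMeasurable (Continuous.mul (Complex.continuous_ofReal.comp
      (continuous_const.mul ((hcont n).pow m))) (𝓕⁻ ψ).continuous)
  · rw [norm_mul, norm_mul, Complex.norm_real, Complex.norm_real, norm_mul, norm_mul]
    gcongr
    exact (hC n ζ).trans (le_abs_self _)
  · have := (multipliable_phiHat hd hA h ((2 * Real.pi) • ⇑ζ)).hasProd.tendsto_prod_nat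
    exact ((Complex.continuous_ofReal.tendsto _).comp ((this.pow m).const_mul _)).mul_const _

/-- The elliptic scaling functions have compact support. -/
lemma exists_support_radius (hd : 0 < d) (hA : IsDilationMatrix A) (h : IsFactorization A Q U)
    (m : ℕ) : ∃ R : ℝ, ∀ ψ : 𝓢(EuclideanSpace ℝ (Fin d), ℂ), (∀ x, ‖x‖ ≤ R → ψ x = 0) →
      ellipticScalingFunction hd hA h m ψ = 0 := by
  obtain ⟨r, hr, hF⟩ := mask_pow_mem_charSpan (det_ne_zero hd hA) Q m
  obtain ⟨K, hK, hk⟩ := norm_transpose_pow_le hd hA h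
  obtain ⟨hρ0, hρ1⟩ := rho_mem hd hA
  set ρ := |(A.det : ℝ)| ^ (-(1 / (d : ℝ))) with hρ
  have hinv : 0 ≤ (1 - ρ)⁻¹ := inv_nonneg.2 (by linarith)
  -- If `m₀^m` has frequencies in the ball of radius `r`, its `j`-th dilate has them in the ball of
  -- radius `K ρ^(j+1) r`. Frequencies add under products, and the geometric series bounds all
  -- partial sums at once.
  refine ⟨K * r * (1 - ρ)⁻¹, fun ψ hψ => ?_⟩
  have hj : ∀ j : ℕ, (fun ζ : EuclideanSpace ℝ (Fin d) => ((mask A Q ((2 * Real.pi) •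
      ⇑(matrixCLM (invTranspose A ^ (j + 1)) ζ)) ^ m : ℝ) : ℂ)) ∈
        charSpan d (K * ρ ^ (j + 1) * r) :=
    fun j => comp_matrixCLM_mem_charSpan (by positivity) (hk (j + 1)) hF
  have hzero : ∀ n, ∫ ζ : EuclideanSpace ℝ (Fin d), (((2 * Real.pi) ^ ((d : ℝ) / 2) *
      (∏ j ∈ Finset.range n, mask A Q ((invTranspose A ^ (j + 1)) *ᵥ
        ((2 * Real.pi) • ⇑ζ))) ^ m : ℝ) : ℂ) * (𝓕⁻ ψ) ζ = 0 := by
    intro n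
    have hn := charSpan_mono (s := K * r * (1 - ρ)⁻¹) (by
      calc ∑ j ∈ Finset.range n, K * ρ ^ (j + 1) * r ≤ ∑ j ∈ Finset.range n, K * r * ρ ^ j := by
            refine Finset.sum_le_sum fun j _ => ?_
            rw [mul_right_comm]
            exact mul_le_mul_of_nonneg_left (pow_le_pow_of_le_one hρ0.le hρ1.le (Nat.le_succ j))
              (by positivity)
        _ = K * r * ∑ j ∈ Finset.range n, ρ ^ j := by rw [Finset.mul_sum]
        _ ≤ K * r * (1 - ρ)⁻¹ := by
            rw [← tsum_geometric_of_lt_one hρ0.le hρ1]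
            exact mul_le_mul_of_nonneg_left ((summable_geometric_of_lt_one hρ0.le hρ1).sum_le_tsum _
              fun j _ => by positivity) (by positivity)) (prod_mem_charSpan hj n)
    have h1 := integral_charSpan_mul_fourierInv hn ψ hψ
    have h2 : ∀ ζ : EuclideanSpace ℝ (Fin d), (∏ j ∈ Finset.range n,
        (fun ζ : EuclideanSpace ℝ (Fin d) => ((mask A Q ((2 * Real.pi) •
          ⇑(matrixCLM (invTranspose A ^ (j + 1)) ζ)) ^ m : ℝ) : ℂ))) ζ =
        (((∏ j ∈ Finset.range n, mask A Q ((invTranspose A ^ (j + 1)) *ᵥ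
          ((2 * Real.pi) • ⇑ζ))) ^ m : ℝ) : ℂ) := by
      intro ζ
      rw [Finset.prod_apply, ← Finset.prod_pow, Complex.ofReal_prod]
      refine Finset.prod_congr rfl fun j _ => ?_
      rw [Matrix.mulVec_smul, ← Matrix.ofLp_toEuclideanCLM]
    simp only [h2] at h1
    simp only [Complex.ofReal_mul, mul_assoc]
    rw [MeasureTheory.integral_const_mul, h1, mul_zero]
  have hlim := tendsto_integral_partialProd hd hA h m ψ
  simp only [hzero] at hlim
  exact tendsto_nhds_unique hlim tendsto_const_nhds

lemma finite_norm_intVec_le (r : ℝ) : {k : Fin d → ℤ | ‖intVec k‖ ≤ r}.Finite := by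
  refine (Set.finite_Icc (fun _ => -⌈r⌉) (fun _ => ⌈r⌉)).subset fun k hk => ?_
  have h1 : ∀ i, |k i| ≤ ⌈r⌉ := fun i => by
    have h2 : |(k i : ℝ)| ≤ r := (PiLp.norm_apply_le (intVec k) i).trans hk
    exact_mod_cast h2.trans (Int.le_ceil r)
  exact ⟨fun i => (abs_le.1 (h1 i)).1, fun i => (abs_le.1 (h1 i)).2⟩

lemma finite_support_integerShift (hd : 0 < d) (hA : IsDilationMatrix A)
    (h : IsFactorization A Q U) (m : ℕ) (ψ : 𝓢(EuclideanSpace ℝ (Fin d), ℂ))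
    (hψ : HasCompactSupport ψ) :
    (Function.support fun k => integerShift (ellipticScalingFunction hd hA h m) k ψ).Finite := by
  obtain ⟨R, hR⟩ := exists_support_radius hd hA h m
  obtain ⟨r, hr⟩ := hψ.isCompact.isBounded.subset_closedBall 0
  refine (finite_norm_intVec_le (R + r)).subset fun k hk => ?_
  by_contra hcon
  simp only [Set.mem_ofPred_eq, not_le] at hcon
  refine hk (hR _ fun x hx => ?_)
  rw [SchwartzMap.compSubConstCLM_apply, sub_neg_eq_add]
  by_contra hne
  have h1 := hr (subset_tsupport _ hne)
  rw [mem_closedBall_zero_iff] at h1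
  have h2 : ‖intVec k‖ ≤ ‖x + intVec k‖ + ‖x‖ := by
    simpa using norm_sub_le (x + intVec k) x
  exact absurd (h2.trans (add_le_add h1 hx)) (by rw [add_comm r]; exact not_le.2 hcon)

/-- The complex conjugate of a Schwartz function. -/
noncomputable def conjSchwartz (ψ : 𝓢(EuclideanSpace ℝ (Fin d), ℂ)) :
    𝓢(EuclideanSpace ℝ (Fin d), ℂ) :=
  SchwartzMap.postcompCLM (𝕜 := ℝ) (Complex.conjCLE : ℂ →L[ℝ] ℂ) ψ

lemma conjSchwartz_apply (ψ : 𝓢(EuclideanSpace ℝ (Fin d), ℂ)) (x : EuclideanSpace ℝ (Fin d)) :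
    conjSchwartz ψ x = (starRingEnd ℂ) (ψ x) := rfl

lemma fourierInv_conjSchwartz (ψ : 𝓢(EuclideanSpace ℝ (Fin d), ℂ))
    (η : EuclideanSpace ℝ (Fin d)) :
    (𝓕⁻ (conjSchwartz ψ)) η = (starRingEnd ℂ) ((𝓕⁻ ψ) (-η)) := by
  rw [fourierInv_apply_eq_integral, fourierInv_apply_eq_integral, ← integral_conj]
  refine MeasureTheory.integral_congr_ae (Filter.Eventually.of_forall fun x => ?_)
  simp only [map_mul, conj_expChar, conjSchwartz_apply]
  rw [expChar_comm (-x), expChar_comm x, expChar, expChar]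
  simp

lemma conj_fourierSide_neg (A : Matrix (Fin d) (Fin d) ℤ) (Q : Matrix (Fin d) (Fin d) ℝ) (m : ℕ)
    (η : EuclideanSpace ℝ (Fin d)) :
    (starRingEnd ℂ) (fourierSide A Q m (-η)) = fourierSide A Q m η := by
  rw [fourierSide, fourierSide, Complex.conj_ofReal]
  congr 3
  rw [← phiHat_neg]
  congr 2
  funext i
  simp

/-- The distribution is real because its Fourier transform is real and even. -/
lemma integerShift_conj (hd : 0 < d) (hA : IsDilationMatrix A) (h : IsFactorization A Q U)
    (m : ℕ) (k : Fin d → ℤ) (ψ : 𝓢(EuclideanSpace ℝ (Fin d), ℂ)) :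
    integerShift (ellipticScalingFunction hd hA h m) k (conjSchwartz ψ) =
      (starRingEnd ℂ) (integerShift (ellipticScalingFunction hd hA h m) k ψ) := by
  rw [integerShift_eq, integerShift_eq, ← integral_conj, ← MeasureTheory.integral_neg_eq_self]
  refine MeasureTheory.integral_congr_ae (Filter.Eventually.of_forall fun η => ?_)
  simp only [map_mul, fourierInv_conjSchwartz, neg_neg]
  rw [← conj_fourierSide_neg, neg_neg, conj_expChar, expChar, expChar, inner_neg_left,
    inner_neg_left, inner_neg_right, inner_neg_left]

/-- Complex coefficients may be used to test membership in the span of the shifts. -/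
lemma mem_polynomialsInSpan_of_complex (hd : 0 < d) (hA : IsDilationMatrix A)
    (h : IsFactorization A Q U) (m : ℕ) {P : MvPolynomial (Fin d) ℝ} (c : (Fin d → ℤ) → ℂ)
    (hc : ∀ ψ : 𝓢(EuclideanSpace ℝ (Fin d), ℂ), HasCompactSupport ψ →
      HasSum (fun k => c k * integerShift (ellipticScalingFunction hd hA h m) k ψ)
        (∫ x : EuclideanSpace ℝ (Fin d), ((MvPolynomial.eval x P : ℝ) : ℂ) * ψ x)) :
    P ∈ polynomialsInSpan (ellipticScalingFunction hd hA h m) := by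
  refine ⟨fun k => (c k).re, fun ψ hψ => ?_⟩
  have hψ' : HasCompactSupport (conjSchwartz ψ) := by
    refine hψ.comp_left (g := starRingEnd ℂ) (map_zero _)
  -- Averaging the expansion with its conjugate replaces each coefficient by its real part and
  -- leaves the real polynomial unchanged.
  have h1 := (hc _ hψ').map (starRingEnd ℂ) Complex.continuous_conj
  have h2 := ((hc ψ hψ).add h1).mul_left (1 / 2 : ℂ)
  have e1 : (fun k => (((c k).re : ℝ) : ℂ) *
      integerShift (ellipticScalingFunction hd hA h m) k ψ) = fun k => (1 / 2 : ℂ) *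
        (c k * integerShift (ellipticScalingFunction hd hA h m) k ψ +
          ((starRingEnd ℂ) ∘ fun k => c k *
            integerShift (ellipticScalingFunction hd hA h m) k (conjSchwartz ψ)) k) := by
    funext k
    simp only [Function.comp_apply, map_mul, integerShift_conj, Complex.conj_conj]
    rw [← add_mul, Complex.add_conj]
    push_cast
    ring
  have e2 : (starRingEnd ℂ) (∫ x : EuclideanSpace ℝ (Fin d),
      ((MvPolynomial.eval x P : ℝ) : ℂ) * conjSchwartz ψ x) =
      ∫ x : EuclideanSpace ℝ (Fin d), ((MvPolynomial.eval x P : ℝ) : ℂ) * ψ x := by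
    rw [← integral_conj]
    simp only [map_mul, Complex.conj_ofReal, conjSchwartz_apply, Complex.conj_conj]
  rw [e2, ← two_mul, ← mul_assoc, one_div, inv_mul_cancel₀ two_ne_zero, one_mul] at h2
  rw [e1, one_div]
  exact h2

end SupportAndReality

/-! ### Affine invariance of the space of polynomials. -/

section AffineInvariance

variable {d : ℕ} {A : Matrix (Fin d) (Fin d) ℤ} {Q U : Matrix (Fin d) (Fin d) ℝ}

lemma polyShift_int_mem (hd : 0 < d) (hA : IsDilationMatrix A) (h : IsFactorization A Q U)
    (m : ℕ) {P : MvPolynomial (Fin d) ℝ}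
    (hP : P ∈ polynomialsInSpan (ellipticScalingFunction hd hA h m)) (k : Fin d → ℤ) :
    polyShift (fun i => (k i : ℝ)) P ∈ polynomialsInSpan (ellipticScalingFunction hd hA h m) := by
  obtain ⟨c, hc⟩ := hP
  refine ⟨fun n => c (n + k), fun ψ hψ => ?_⟩
  have h1 := hc (SchwartzMap.compSubConstCLM ℂ (intVec k) ψ)
    (hψ.comp_homeomorph (Homeomorph.subRight (intVec k)))
  rw [← (Equiv.addRight k).hasSum_iff] at h1
  have e1 : ∫ x : EuclideanSpace ℝ (Fin d),
      ((MvPolynomial.eval x (polyShift (fun i => (k i : ℝ)) P) : ℝ) : ℂ) * ψ x =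
      ∫ x : EuclideanSpace ℝ (Fin d), ((MvPolynomial.eval x P : ℝ) : ℂ) *
        (SchwartzMap.compSubConstCLM ℂ (intVec k) ψ) x := by
    rw [← MeasureTheory.integral_add_right_eq_self (fun x : EuclideanSpace ℝ (Fin d) =>
      ((MvPolynomial.eval x P : ℝ) : ℂ) * (SchwartzMap.compSubConstCLM ℂ (intVec k) ψ) x)
      (intVec k)]
    refine MeasureTheory.integral_congr_ae (Filter.Eventually.of_forall fun x => ?_)
    simp only [SchwartzMap.compSubConstCLM_apply, add_sub_cancel_right, eval_polyShift]
    rfl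
  rw [e1]
  refine h1.congr_fun fun n => ?_
  simp only [Function.comp_apply, Equiv.coe_addRight]
  congr 1
  rw [integerShift, integerShift, SchwartzMap.compSubConstCLM_comp]
  change _ = ellipticScalingFunction hd hA h m (SchwartzMap.compSubConstCLM ℂ
    (intVec k + -intVec (n + k)) ψ)
  rw [intVec_add]
  congr 2
  simp [intVec]

/-- Rearrangement of a double sum over shifts of the form `f k + l`. -/
lemma hasSum_extend {ι : Type*} [AddCommGroup ι] {f : ι → ι} (hf : Function.Injective f)
    (S : Finset ι) (a c : ι → ℂ) {s : ι → ℂ} (hs : (Function.support s).Finite) {I : ℂ}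
    (hI : HasSum (fun k => c k * ∑ l ∈ S, a l * s (f k + l)) I) :
    HasSum (fun n => (∑ l ∈ S, a l * Function.extend (fun k => f k + l) c 0 n) * s n) I := by
  have hinj : ∀ l : ι, Function.Injective fun k => f k + l := fun l k k' hk =>
    hf (add_right_cancel hk)
  -- The finite support of `s` lets the series be split into one convergent series for each `l`;
  -- each is then re-indexed by `n = f k + l`, with coefficient zero off the range.
  have h2 : ∀ l, ∃ T, HasSum (fun k => c k * s (f k + l)) T := fun l =>
    summable_of_hasFiniteSupport ((hs.preimage (hinj l).injOn).subset fun k hk =>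
      right_ne_zero_of_mul hk)
  choose T hT using h2
  have h3 : HasSum (fun k => c k * ∑ l ∈ S, a l * s (f k + l)) (∑ l ∈ S, a l * T l) := by
    refine (hasSum_sum (s := S) fun l _ => (hT l).mul_left (a l)).congr_fun fun k => ?_
    rw [Finset.mul_sum]
    exact Finset.sum_congr rfl fun l _ => by ring
  have h7 : HasSum (fun n => ∑ l ∈ S, a l * (Function.extend (fun k => f k + l) c 0 n * s n))
      (∑ l ∈ S, a l * T l) := by
    refine hasSum_sum fun l _ => HasSum.mul_left (a l) ?_
    rw [← (hinj l).hasSum_iff]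
    · refine (hT l).congr_fun fun k => ?_
      rw [Function.comp_apply, (hinj l).extend_apply]
    · intro n hn
      rw [Function.extend_apply' _ _ _ hn, Pi.zero_apply, zero_mul]
  rw [hI.unique h3]
  refine h7.congr_fun fun n => ?_
  rw [Finset.sum_mul]
  exact Finset.sum_congr rfl fun l _ => mul_assoc _ _ _

lemma integral_polySubst_inv (hu : IsUnit (realMatrix A).det) (P : MvPolynomial (Fin d) ℝ)
    (ψ : 𝓢(EuclideanSpace ℝ (Fin d), ℂ)) :
    ∫ x : EuclideanSpace ℝ (Fin d),
      ((MvPolynomial.eval x (polySubst (realMatrix A)⁻¹ P) : ℝ) : ℂ) * ψ x =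
    ((|(realMatrix A).det| : ℝ) : ℂ) * ∫ x : EuclideanSpace ℝ (Fin d),
      ((MvPolynomial.eval x P : ℝ) : ℂ) * (SchwartzMap.compCLMOfContinuousLinearEquiv ℂ
        (matrixEquiv (realMatrix A) hu) ψ) x := by
  have hdet : (((|(realMatrix A).det| : ℝ)) : ℂ) ≠ 0 := by
    exact_mod_cast abs_ne_zero.2 hu.ne_zero
  have h5 := integral_comp_matrixCLM hu.ne_zero fun x : EuclideanSpace ℝ (Fin d) =>
    ((MvPolynomial.eval x (polySubst (realMatrix A)⁻¹ P) : ℝ) : ℂ) * ψ x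
  have h6 : ∀ x : EuclideanSpace ℝ (Fin d), ((MvPolynomial.eval (matrixCLM (realMatrix A) x)
      (polySubst (realMatrix A)⁻¹ P) : ℝ) : ℂ) * ψ (matrixCLM (realMatrix A) x) =
      ((MvPolynomial.eval x P : ℝ) : ℂ) * (SchwartzMap.compCLMOfContinuousLinearEquiv ℂ
        (matrixEquiv (realMatrix A) hu) ψ) x := by
    intro x
    rw [eval_polySubst, Matrix.ofLp_toEuclideanCLM, Matrix.mulVec_mulVec,
      Matrix.nonsing_inv_mul _ hu, Matrix.one_mulVec]
    rfl
  simp only [h6] at h5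
  rw [h5, Complex.ofReal_inv, mul_inv_cancel_left₀ hdet]

lemma hasCompactSupport_comp_equiv {ψ : 𝓢(EuclideanSpace ℝ (Fin d), ℂ)}
    (hψ : HasCompactSupport ψ) (e : EuclideanSpace ℝ (Fin d) ≃L[ℝ] EuclideanSpace ℝ (Fin d)) :
    HasCompactSupport (SchwartzMap.compCLMOfContinuousLinearEquiv ℂ e ψ) := by
  rw [SchwartzMap.compCLMOfContinuousLinearEquiv_apply]
  exact hψ.comp_homeomorph e.toHomeomorph

/-- By the refinement equation `φ^m(A⁻¹x - k)` is `|det A|` times a finite combination of the `φ^m(x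
- A k - l)`. Its coefficients come from complex exponentials, hence the detour through complex
coefficients. -/
lemma polySubst_inv_mem (hd : 0 < d) (hA : IsDilationMatrix A) (h : IsFactorization A Q U)
    (m : ℕ) {P : MvPolynomial (Fin d) ℝ}
    (hP : P ∈ polynomialsInSpan (ellipticScalingFunction hd hA h m)) :
    polySubst (realMatrix A)⁻¹ P ∈ polynomialsInSpan (ellipticScalingFunction hd hA h m) := by
  obtain ⟨c, hc⟩ := hP
  obtain ⟨S, a, hS⟩ := integerShift_comp_matrix hd hA h m
  have hu := isUnit_det_realMatrix hd hA
  refine mem_polynomialsInSpan_of_complex hd hA h m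
    (fun n => ((|(realMatrix A).det| : ℝ) : ℂ) * ∑ l ∈ S, a l *
      Function.extend (fun k => A *ᵥ k + l) (fun k => (c k : ℂ)) 0 n) fun ψ hψ => ?_
  have h1 := hc _ (hasCompactSupport_comp_equiv hψ (matrixEquiv (realMatrix A) hu))
  simp only [hS] at h1
  have h2 := hasSum_extend (f := fun k => A *ᵥ k)
    (Matrix.mulVec_injective_of_det_ne_zero (det_ne_zero hd hA)) S a (fun k => (c k : ℂ))
    (finite_support_integerShift hd hA h m ψ hψ) h1
  rw [integral_polySubst_inv hu]
  simp only [mul_assoc]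
  exact h2.mul_left _

lemma compactSpace_orthogonalGroup : CompactSpace (Matrix.orthogonalGroup (Fin d) ℝ) := by
  have h1 : IsCompact (Set.pi Set.univ fun _ : Fin d => Set.pi Set.univ fun _ : Fin d =>
      Set.Icc (-1 : ℝ) 1) := isCompact_univ_pi fun _ => isCompact_univ_pi fun _ => isCompact_Icc
  refine (isCompact_iff_compactSpace (s := (Matrix.orthogonalGroup (Fin d) ℝ :
    Set (Matrix (Fin d) (Fin d) ℝ)))).1 (IsCompact.of_isClosed_subset
      (X := Matrix (Fin d) (Fin d) ℝ) h1 ?_ fun M hM i _ j _ => ?_)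
  · have : (Matrix.orthogonalGroup (Fin d) ℝ : Set (Matrix (Fin d) (Fin d) ℝ)) =
        {M | M * star M = 1} := by
      ext M
      exact Matrix.mem_orthogonalGroup_iff (Fin d) ℝ
    rw [this]
    exact isClosed_eq (continuous_id.mul continuous_star) continuous_const
  · exact abs_le.1 (entry_norm_bound_of_unitary hM i j)

/-- Recurrence in a compact group: the powers of any element accumulate at the identity. -/
lemma mapClusterPt_one_pow_orthogonal {V : Matrix (Fin d) (Fin d) ℝ}
    (hV : V ∈ Matrix.orthogonalGroup (Fin d) ℝ) :
    MapClusterPt (1 : Matrix (Fin d) (Fin d) ℝ) Filter.atTop (fun j : ℕ => V ^ j) := by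
  have := compactSpace_orthogonalGroup (d := d)
  have h1 := mapClusterPt_one_atTop_pow (⟨V, hV⟩ : Matrix.orthogonalGroup (Fin d) ℝ)
  exact h1.continuousAt_comp continuous_subtype_val.continuousAt

/-- Transposing the factorization puts `A⁻¹` into the form required by `homogeneousComponent_mem`.
-/
lemma inv_realMatrix_eq (h : IsFactorization A Q U) :
    (realMatrix A)⁻¹ = (|(A.det : ℝ)| ^ (-(1 / (d : ℝ)))) • (Q * Uᵀ * Q⁻¹) := by
  have hs : Qᵀ = Q := by simpa using h.posDef.1.eq
  have h1 : (invTranspose A)ᵀ = (realMatrix A)⁻¹ := by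
    rw [invTranspose, Matrix.transpose_nonsing_inv, Matrix.transpose_transpose]
  rw [← h1, h.factor, Matrix.transpose_smul, Matrix.transpose_mul, Matrix.transpose_mul,
    Matrix.transpose_nonsing_inv, hs, Matrix.mul_assoc]

lemma mapClusterPt_one_pow_conj (h : IsFactorization A Q U) :
    MapClusterPt (1 : Matrix (Fin d) (Fin d) ℝ) Filter.atTop
      (fun j : ℕ => (Q * Uᵀ * Q⁻¹) ^ j) := by
  have hQ : IsUnit Q.det := (Matrix.isUnit_iff_isUnit_det Q).1 h.posDef.isUnit
  have hU : Uᵀ ∈ Matrix.orthogonalGroup (Fin d) ℝ := by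
    simpa [Matrix.star_eq_conjTranspose] using Unitary.star_mem h.orthogonal
  have h1 := (mapClusterPt_one_pow_orthogonal hU).continuousAt_comp
    (f := fun M => Q * M * Q⁻¹) (by fun_prop)
  have h2 : ∀ j : ℕ, (Q * Uᵀ * Q⁻¹) ^ j = Q * Uᵀ ^ j * Q⁻¹ := by
    intro j
    induction j with
    | zero => simp [Matrix.mul_nonsing_inv _ hQ]
    | succ j ih =>
      rw [pow_succ, ih, pow_succ]
      simp only [Matrix.mul_assoc, Matrix.nonsing_inv_mul_cancel_left _ _ hQ]
  simp only [h2]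
  rwa [Matrix.mul_one, Matrix.mul_nonsing_inv _ hQ] at h1

lemma homogeneousComponent_mem_polynomialsInSpan (hd : 0 < d) (hA : IsDilationMatrix A)
    (h : IsFactorization A Q U) (m : ℕ) {P : MvPolynomial (Fin d) ℝ}
    (hP : P ∈ polynomialsInSpan (ellipticScalingFunction hd hA h m)) (n : ℕ) :
    MvPolynomial.homogeneousComponent n P ∈
      polynomialsInSpan (ellipticScalingFunction hd hA h m) := by
  obtain ⟨hρ0, hρ1⟩ := rho_mem hd hA
  refine homogeneousComponent_mem hρ0 hρ1 (mapClusterPt_one_pow_conj h) (fun P hP => ?_) hP n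
  rw [← inv_realMatrix_eq h]
  exact polySubst_inv_mem hd hA h m hP

lemma isAffinelyInvariant_polynomialsInSpan (hd : 0 < d) (hA : IsDilationMatrix A)
    (h : IsFactorization A Q U) (m : ℕ) :
    IsAffinelyInvariant (polynomialsInSpan (ellipticScalingFunction hd hA h m)) :=
  ⟨fun _ hP u => polyShift_mem (fun _ hP k => polyShift_int_mem hd hA h m hP k) hP u,
    fun _ hP t =>
      polyScale_mem (fun n => homogeneousComponent_mem_polynomialsInSpan hd hA h m hP n) t⟩

end AffineInvariance

/-! ### The Fourier transform near lattice points outside `Aᵀ ℤ^d`. -/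

section LocalBehaviour

variable {d : ℕ} {A : Matrix (Fin d) (Fin d) ℤ} {Q U : Matrix (Fin d) (Fin d) ℝ}

lemma continuous_phiHat (hd : 0 < d) (hA : IsDilationMatrix A) (h : IsFactorization A Q U) :
    Continuous (phiHat A Q) := by
  obtain ⟨C, hC, hb⟩ := mask_factor_bound hd hA h
  obtain ⟨hρ0, hρ1⟩ := rho_mem hd hA
  have hmc := (mask_differentiable (Q := Q) (det_ne_zero hd hA)).continuous
  have hq : Continuous (qNorm Q) := by
    have : Continuous fun ξ => Q *ᵥ ξ := (Matrix.mulVecLin Q).continuous_of_finiteDimensional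
    exact Real.continuous_sqrt.comp (this.dotProduct this)
  rw [continuous_iff_continuousAt]
  intro ξ
  -- On a set where `qNorm` is bounded the factors differ from `1` by a fixed geometric sequence, so
  -- the product converges locally uniformly.
  have hopen : IsOpen {ζ | qNorm Q ζ < qNorm Q ξ + 1} := isOpen_lt hq continuous_const
  have h1 := (((summable_geometric_of_lt_one hρ0.le hρ1).mul_left
    (C * (qNorm Q ξ + 1))).hasProdLocallyUniformlyOn_nat_one_add hopen
    (f := fun j ζ => mask A Q ((invTranspose A ^ (j + 1)) *ᵥ ζ) - 1)
    (Filter.Eventually.of_forall fun j ζ hζ => ?_) fun j => ?_)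
  · have h2 := h1.tendstoLocallyUniformlyOn_finsetRange.continuousOn (Filter.Frequently.of_forall
      fun n => ?_)
    · simp only [add_sub_cancel] at h2
      exact h2.continuousAt (hopen.mem_nhds (by simp))
    · refine (continuous_finsetProd _ fun j _ => ?_).continuousOn
      simp only [add_sub_cancel]
      exact hmc.comp (Matrix.mulVecLin (invTranspose A ^ (j + 1))).continuous_of_finiteDimensional
  · refine (hb ζ j).trans ?_
    have : qNorm Q ζ ≤ qNorm Q ξ + 1 := le_of_lt hζ
    gcongr
  · exact ((hmc.comp (Matrix.mulVecLin
      (invTranspose A ^ (j + 1))).continuous_of_finiteDimensional).sub continuous_const).continuousOn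

lemma continuous_fourierSide (hd : 0 < d) (hA : IsDilationMatrix A) (h : IsFactorization A Q U)
    (m : ℕ) : Continuous (fourierSide A Q m) := by
  refine Complex.continuous_ofReal.comp (continuous_const.mul
    (((continuous_phiHat hd hA h).comp ?_).pow m))
  fun_prop

/-- Some integer vector is not in the lattice `Aᵀ ℤ^d`. -/
lemma exists_notMem_range_transpose (hd : 0 < d) (hA : IsDilationMatrix A) :
    ∃ k : Fin d → ℤ, ∀ n : Fin d → ℤ, Aᵀ *ᵥ n ≠ k := by
  by_contra! hcon
  -- Surjectivity over `ℤ` would force `det A = ±1`.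
  have h1 : IsUnit Aᵀ := Matrix.mulVec_surjective_iff_isUnit.1 hcon
  rw [Matrix.isUnit_iff_isUnit_det, Matrix.det_transpose, Int.isUnit_iff] at h1
  have h2 := one_lt_abs_det hd hA
  rcases h1 with h1 | h1 <;> simp [h1] at h2

/-- By periodicity `y` may be reduced to the unit cube, where `trigG_ne_zero` leaves only the
origin. -/
lemma exists_int_of_trigG_eq_zero (hQ : Q.PosDef) {y : Fin d → ℝ}
    (hy : trigG Q ((2 * Real.pi) • y) = 0) : ∃ n : Fin d → ℤ, y = fun i => (n i : ℝ) := by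
  have h1 := trigG_congr Q (x := y) (y := fun i => Int.fract (y i)) (fun i => ⌊y i⌋)
    (fun i => (Int.fract_add_floor _).symm) 0
  rw [zero_add, zero_add, hy] at h1
  by_contra hcon
  refine trigG_ne_zero hQ (s := fun i => Int.fract (y i))
    (fun i => ⟨Int.fract_nonneg _, Int.fract_lt_one _⟩) (fun h0 => hcon ?_) h1.symm
  refine ⟨fun i => ⌊y i⌋, funext fun i => ?_⟩
  have h2 : Int.fract (y i) = 0 := congrFun h0 i
  have h3 := Int.fract_add_floor (y i)
  rw [h2, zero_add] at h3
  exact h3.symm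

/-- Compared with `mask_eq`, membership is characterized exactly; locating the vanishing factor
needs every nonzero digit to be present. -/
lemma mask_eq_prod (hA : A.det ≠ 0) (Q : Matrix (Fin d) (Fin d) ℝ) :
    ∃ S : Finset (Fin d → ℝ), (∀ s, s ∈ S ↔ s ∈ digitSet Aᵀ \ {0}) ∧
      ∀ ξ, mask A Q ξ = (∏ s ∈ S, trigG Q (ξ + (2 * Real.pi) • s)) /
        ∏ s ∈ S, trigG Q ((2 * Real.pi) • s) := by
  have hf : (digitSet Aᵀ \ {0}).Finite :=
    (digitSet_finite (by rwa [Matrix.det_transpose])).subset Set.sdiff_subset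
  refine ⟨hf.toFinset, fun s => hf.mem_toFinset, fun ξ => ?_⟩
  rw [mask, finprod_mem_eq_finite_toFinset_prod _ hf, finprod_mem_eq_finite_toFinset_prod _ hf]

/-- A vanishing factor means `x ∈ -s + ℤ^d` for some digit `s`, and `Aᵀ s` is integral. -/
lemma exists_int_of_mask_eq_zero (hA : A.det ≠ 0) (hQ : Q.PosDef) {x : Fin d → ℝ}
    (hx : mask A Q ((2 * Real.pi) • x) = 0) :
    ∃ n : Fin d → ℤ, (realMatrix A)ᵀ *ᵥ x = fun i => (n i : ℝ) := by
  obtain ⟨S, hS, hm⟩ := mask_eq_prod hA Q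
  rw [hm, div_eq_zero_iff] at hx
  rcases hx with hx | hx
  · obtain ⟨s, hs, h0⟩ := Finset.prod_eq_zero_iff.1 hx
    rw [← smul_add] at h0
    obtain ⟨n, hn⟩ := exists_int_of_trigG_eq_zero hQ h0
    obtain ⟨k, hk⟩ := ((hS s).1 hs).1.2
    refine ⟨Aᵀ *ᵥ n - k, ?_⟩
    have h1 : x = (x + s) - s := (add_sub_cancel_right x s).symm
    rw [h1, hn, Matrix.mulVec_sub]
    change _ - (Aᵀ.map Int.cast) *ᵥ s = _
    rw [hk]
    funext i
    simp [Matrix.mulVec, dotProduct]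
  · obtain ⟨s, hs, h0⟩ := Finset.prod_eq_zero_iff.1 hx
    exact absurd h0 (trigG_ne_zero hQ ((hS s).1 hs).1.1 ((hS s).1 hs).2)

lemma mem_range_of_pow_invTranspose (hd : 0 < d) (hA : IsDilationMatrix A) {k n : Fin d → ℤ}
    (j : ℕ) (hn : (invTranspose A ^ (j + 1)) *ᵥ (fun i => (k i : ℝ)) = fun i => (n i : ℝ)) :
    ∃ n' : Fin d → ℤ, Aᵀ *ᵥ n' = k := by
  have hT : ∀ n : Fin d → ℤ, (realMatrix A)ᵀ *ᵥ (fun i => (n i : ℝ)) =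
      fun i => ((Aᵀ *ᵥ n) i : ℝ) := fun n => by
    funext i
    simp [Matrix.mulVec, dotProduct]
  induction j generalizing n with
  | zero =>
    refine ⟨n, ?_⟩
    have h1 := congrArg (fun v => (realMatrix A)ᵀ *ᵥ v) hn
    simp only [zero_add, pow_one] at h1
    rw [transpose_mulVec_invTranspose hd hA, hT] at h1
    funext i
    exact_mod_cast (congrFun h1 i).symm
  | succ j ih =>
    have h1 := congrArg (fun v => (realMatrix A)ᵀ *ᵥ v) hn
    rw [pow_succ', ← Matrix.mulVec_mulVec, transpose_mulVec_invTranspose hd hA, hT] at h1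
    exact ih h1

/-- A zero of the `j`-th factor would make `(A⁻ᵀ)^(j+1) k` integral and put `k` into `Aᵀ ℤ^d`. An
absolutely convergent product without zero factors is nonzero. -/
lemma phiHat_ne_zero (hd : 0 < d) (hA : IsDilationMatrix A) (h : IsFactorization A Q U)
    {k : Fin d → ℤ} (hk : ∀ n : Fin d → ℤ, Aᵀ *ᵥ n ≠ k) :
    phiHat A Q ((2 * Real.pi) • (invTranspose A *ᵥ fun i => (k i : ℝ))) ≠ 0 := by
  obtain ⟨C, hC, hb⟩ := mask_factor_bound hd hA h
  obtain ⟨hρ0, hρ1⟩ := rho_mem hd hA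
  set ξ := (2 * Real.pi) • (invTranspose A *ᵥ fun i => (k i : ℝ)) with hξ
  have h1 := tprod_one_add_ne_zero_of_summable
    (f := fun j => mask A Q ((invTranspose A ^ (j + 1)) *ᵥ ξ) - 1) (fun j => ?_)
    (Summable.of_nonneg_of_le (fun _ => norm_nonneg _) (hb ξ)
      ((summable_geometric_of_lt_one hρ0.le hρ1).mul_left _))
  · simp only [add_sub_cancel] at h1
    exact h1
  · rw [add_sub_cancel, hξ, Matrix.mulVec_smul]
    intro h0
    obtain ⟨n, hn⟩ := exists_int_of_mask_eq_zero (det_ne_zero hd hA) h.posDef h0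
    rw [pow_succ', ← Matrix.mulVec_mulVec, transpose_mulVec_invTranspose hd hA,
      Matrix.mulVec_mulVec, ← pow_succ] at hn
    obtain ⟨n', hn'⟩ := mem_range_of_pow_invTranspose hd hA j hn
    exact hk n' hn'

lemma quadForm_eq_qNorm_sq (hQ : Q.PosDef) (η : Fin d → ℝ) : quadForm Q η = qNorm Q η ^ 2 := by
  have hs : Qᵀ = Q := by simpa using hQ.1.eq
  have h0 : 0 ≤ (Q *ᵥ η) ⬝ᵥ (Q *ᵥ η) := Finset.sum_nonneg fun i _ => mul_self_nonneg _
  rw [qNorm, Real.sq_sqrt h0, Matrix.dotProduct_mulVec, ← Matrix.mulVec_transpose, hs, Matrix.mulVec_mulVec, ← sq,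
    dotProduct_comm]
  simp only [quadForm, dotProduct, Matrix.mulVec, Finset.mul_sum]
  exact Finset.sum_congr rfl fun i _ => Finset.sum_congr rfl fun j _ => by ring

lemma quadForm_smul (c : ℝ) (η : Fin d → ℝ) : quadForm Q (c • η) = c ^ 2 * quadForm Q η := by
  simp only [quadForm, Finset.mul_sum, Pi.smul_apply, smul_eq_mul]
  exact Finset.sum_congr rfl fun i _ => Finset.sum_congr rfl fun j _ => by ring

lemma tendsto_inv_mul_sin (a : ℝ) :
    Filter.Tendsto (fun t : ℝ => t⁻¹ * Real.sin (t * a)) (nhdsWithin 0 {0}ᶜ) (nhds a) := by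
  have h1 : HasDerivAt (fun t : ℝ => Real.sin (t * a)) a 0 := by
    simpa using ((hasDerivAt_id (0 : ℝ)).mul_const a).sin
  simpa using h1.tendsto_slope_zero

/-- The Taylor series of `G` begins with `W`. -/
lemma tendsto_trigG (hQ : Q.PosDef) (ζ : Fin d → ℝ) :
    Filter.Tendsto (fun t : ℝ => (t⁻¹) ^ 2 * trigG Q (t • ζ)) (nhdsWithin 0 {0}ᶜ)
      (nhds (quadForm Q ζ)) := by
  have hs : Qᵀ = Q := by simpa using hQ.1.eq
  have hs2 : (Q ^ 2).IsSymm := by rw [Matrix.IsSymm, Matrix.transpose_pow, hs]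
  have e1 : quadForm Q ζ = 4 * ∑ i, (Q ^ 2) i i * (ζ i / 2) ^ 2 +
      2 * ∑ i, ∑ j ∈ Finset.Ioi i, (Q ^ 2) i j * ζ i * ζ j := by
    have h1 := sum_symm_eq _ hs2 ζ
    simp only [quadForm, ← mul_assoc]
    rw [h1]
    congr 1
    rw [Finset.mul_sum]
    exact Finset.sum_congr rfl fun i _ => by ring
  have e2 : ∀ t : ℝ, (t⁻¹) ^ 2 * trigG Q (t • ζ) =
      4 * ∑ i, (Q ^ 2) i i * (t⁻¹ * Real.sin (t * (ζ i / 2))) ^ 2 +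
      2 * ∑ i, ∑ j ∈ Finset.Ioi i, (Q ^ 2) i j * (t⁻¹ * Real.sin (t * ζ i)) *
        (t⁻¹ * Real.sin (t * ζ j)) := by
    intro t
    rw [trigG, mul_add, mul_left_comm, mul_left_comm _ (2 : ℝ)]
    simp only [Finset.mul_sum, Pi.smul_apply, smul_eq_mul, mul_div_assoc]
    congr 1
    · exact Finset.sum_congr rfl fun i _ => by ring
    · exact Finset.sum_congr rfl fun i _ => Finset.sum_congr rfl fun j _ => by ring
  simp only [e2, e1]
  refine ((tendsto_finsetSum _ fun i _ => ((tendsto_inv_mul_sin _).pow 2).const_mul _).const_mul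
    _).add ((tendsto_finsetSum _ fun i _ => tendsto_finsetSum _ fun j _ =>
      ((tendsto_inv_mul_sin _).const_mul _).mul (tendsto_inv_mul_sin _)).const_mul _)

/-- Exactly one factor `G(· + 2πs)` vanishes at `2πA⁻ᵀk`, and it contributes `W`; the others and the
normalization make up the nonzero constant `E`. -/
lemma tendsto_mask (hd : 0 < d) (hA : IsDilationMatrix A) (hQ : Q.PosDef)
    {k : Fin d → ℤ} (hk : ∀ n : Fin d → ℤ, Aᵀ *ᵥ n ≠ k) : ∃ E : ℝ, E ≠ 0 ∧ ∀ ζ : Fin d → ℝ,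
      Filter.Tendsto (fun t : ℝ => (t⁻¹) ^ 2 *
        mask A Q ((2 * Real.pi) • (invTranspose A *ᵥ fun i => (k i : ℝ)) + t • ζ))
        (nhdsWithin 0 {0}ᶜ) (nhds (E * quadForm Q ζ)) := by
  classical
  obtain ⟨S, hS, hm⟩ := mask_eq_prod (det_ne_zero hd hA) Q
  set x := invTranspose A *ᵥ fun i => (k i : ℝ) with hx
  have hAx : (realMatrix A)ᵀ *ᵥ x = fun i => (k i : ℝ) := transpose_mulVec_invTranspose hd hA _
  have hxint : ∀ n : Fin d → ℤ, x ≠ fun i => (n i : ℝ) := fun n hn => by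
    obtain ⟨n', hn'⟩ := mem_range_of_pow_invTranspose hd hA (k := k) 0 (n := n) (by
      rw [zero_add, pow_one, ← hn])
    exact hk n' hn'
  -- The digit of the vanishing factor is `-A⁻ᵀk` modulo `ℤ^d`. It is nonzero, so it does occur in
  -- the product, because `A⁻ᵀk` is not integral.
  set s1 : Fin d → ℝ := fun i => Int.fract (-x i) with hs1
  have hs1x : ∀ i, x i + s1 i = ((-⌊-x i⌋ : ℤ) : ℝ) := fun i => by
    have := Int.self_sub_floor (-x i)
    simp only [hs1]
    push_cast
    linarith
  have hs1S : s1 ∈ S := by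
    refine (hS _).2 ⟨fract_mem_digitSet (x := -x) (-k) ?_, fun h0 => ?_⟩
    · change (realMatrix A)ᵀ *ᵥ (-x) = _
      rw [Matrix.mulVec_neg, hAx]
      funext i
      simp
    · refine hxint (fun i => -⌊-x i⌋) (funext fun i => ?_)
      have := hs1x i
      rw [Set.mem_singleton_iff.1 h0, Pi.zero_apply, add_zero] at this
      exact this
  have hother : ∀ s ∈ S.erase s1, trigG Q ((2 * Real.pi) • x + (2 * Real.pi) • s) ≠ 0 := by
    intro s hs h0
    rw [← smul_add] at h0
    obtain ⟨n, hn⟩ := exists_int_of_trigG_eq_zero hQ h0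
    refine (Finset.mem_erase.1 hs).1 (funext fun i => ?_)
    have h1 : -x i = s i - n i := by
      have := congrFun hn i
      simp only [Pi.add_apply] at this
      linarith
    simp only [hs1]
    rw [h1, Int.fract_sub_intCast,
      Int.fract_eq_self.2 (((hS s).1 (Finset.mem_erase.1 hs).2).1.1 i)]
  have hD : ∏ s ∈ S, trigG Q ((2 * Real.pi) • s) ≠ 0 := Finset.prod_ne_zero_iff.2 fun s hs =>
    trigG_ne_zero hQ ((hS s).1 hs).1.1 ((hS s).1 hs).2
  refine ⟨(∏ s ∈ S.erase s1, trigG Q ((2 * Real.pi) • x + (2 * Real.pi) • s)) /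
    ∏ s ∈ S, trigG Q ((2 * Real.pi) • s), div_ne_zero (Finset.prod_ne_zero_iff.2 hother) hD,
    fun ζ => ?_⟩
  have e1 : ∀ t : ℝ, (t⁻¹) ^ 2 * mask A Q ((2 * Real.pi) • x + t • ζ) =
      (∏ s ∈ S.erase s1, trigG Q ((2 * Real.pi) • x + t • ζ + (2 * Real.pi) • s)) /
        (∏ s ∈ S, trigG Q ((2 * Real.pi) • s)) * ((t⁻¹) ^ 2 * trigG Q (t • ζ)) := by
    intro t
    have h1 : trigG Q ((2 * Real.pi) • x + t • ζ + (2 * Real.pi) • s1) = trigG Q (t • ζ) := by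
      rw [add_right_comm, ← smul_add, add_comm]
      rw [show x + s1 = fun i => ((-⌊-x i⌋ : ℤ) : ℝ) from funext hs1x]
      exact trigG_add_int Q _ fun i => -⌊-x i⌋
    rw [hm, ← Finset.mul_prod_erase S _ hs1S, h1]
    ring
  simp only [e1]
  refine Filter.Tendsto.mul (Filter.Tendsto.div_const ?_ _) (tendsto_trigG hQ ζ)
  refine tendsto_finsetProd _ fun s _ => ?_
  have h2 : Continuous fun t : ℝ => trigG Q ((2 * Real.pi) • x + t • ζ + (2 * Real.pi) • s) :=
    (trigG_differentiable Q).continuous.comp (by fun_prop)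
  have h3 := h2.tendsto 0
  rw [zero_smul, add_zero] at h3
  exact h3.mono_left nhdsWithin_le_nhds

/-- Near `k ∉ Aᵀ ℤ^d` the Fourier transform of `φ^m` behaves like a nonzero multiple of `W^m`. -/
lemma tendsto_fourierSide (hd : 0 < d) (hA : IsDilationMatrix A) (h : IsFactorization A Q U)
    (m : ℕ) {k : Fin d → ℤ} (hk : ∀ n : Fin d → ℤ, Aᵀ *ᵥ n ≠ k) : ∃ E : ℝ, E ≠ 0 ∧
      ∀ η : EuclideanSpace ℝ (Fin d), Filter.Tendsto (fun t : ℝ => ((t⁻¹ ^ (2 * m) : ℝ) : ℂ) *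
        fourierSide A Q m (intVec k + t • η)) (nhdsWithin 0 {0}ᶜ)
        (nhds ((E * quadForm Q η ^ m : ℝ) : ℂ)) := by
  obtain ⟨E, hE, hlim⟩ := tendsto_mask hd hA h.posDef hk
  obtain ⟨hρ0, -⟩ := rho_mem hd hA
  have hne := phiHat_ne_zero hd hA h hk
  set x := invTranspose A *ᵥ fun i => (k i : ℝ) with hx
  set ρ := |(A.det : ℝ)| ^ (-(1 / (d : ℝ))) with hρ
  have hπ := Real.pi_pos
  refine ⟨(2 * Real.pi) ^ ((d : ℝ) / 2) *
    (E * ((2 * Real.pi) ^ 2 * ρ ^ 2) * phiHat A Q ((2 * Real.pi) • x)) ^ m, by positivity,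
    fun η => ?_⟩
  set ζ := (2 * Real.pi) • (invTranspose A *ᵥ ⇑η) with hζ
  -- Here isotropy enters through the factorization: `A⁻ᵀ` is a similarity for `W`, so the leading
  -- form at `k` is again a multiple of `W^m`.
  have hW : quadForm Q ζ = ((2 * Real.pi) ^ 2 * ρ ^ 2) * quadForm Q η := by
    rw [hζ, quadForm_smul, quadForm_eq_qNorm_sq h.posDef, quadForm_eq_qNorm_sq h.posDef,
      qNorm_contract h, ← hρ]
    ring
  have e1 : ∀ t : ℝ, ((t⁻¹ ^ (2 * m) : ℝ) : ℂ) * fourierSide A Q m (intVec k + t • η) =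
      (((2 * Real.pi) ^ ((d : ℝ) / 2) * ((t⁻¹) ^ 2 * mask A Q ((2 * Real.pi) • x + t • ζ) *
        phiHat A Q ((2 * Real.pi) • x + t • ζ)) ^ m : ℝ) : ℂ) := by
    intro t
    rw [fourierSide, ← Complex.ofReal_mul, phiHat_refine hd hA h]
    have h1 : invTranspose A *ᵥ (fun i => 2 * Real.pi * (intVec k + t • η) i) =
        (2 * Real.pi) • x + t • ζ := by
      have : (fun i => 2 * Real.pi * (intVec k + t • η) i) =
          (2 * Real.pi) • (fun i => (k i : ℝ)) + t • (2 * Real.pi) • ⇑η := by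
        funext i
        simp
        ring
      rw [this, Matrix.mulVec_add, Matrix.mulVec_smul, Matrix.mulVec_smul, Matrix.mulVec_smul]
    rw [h1, pow_mul]
    congr 1
    ring
  simp only [e1]
  have h2 : Filter.Tendsto (fun t : ℝ => phiHat A Q ((2 * Real.pi) • x + t • ζ))
      (nhdsWithin 0 {0}ᶜ) (nhds (phiHat A Q ((2 * Real.pi) • x))) := by
    have h3 : Continuous fun t : ℝ => phiHat A Q ((2 * Real.pi) • x + t • ζ) :=
      (continuous_phiHat hd hA h).comp (by fun_prop)
    have h4 := h3.tendsto 0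
    rw [zero_smul, add_zero] at h4
    exact h4.mono_left nhdsWithin_le_nhds
  have h5 := (Complex.continuous_ofReal.tendsto _).comp
    ((((hlim ζ).mul h2).pow m).const_mul ((2 * Real.pi) ^ ((d : ℝ) / 2)))
  rw [show (2 * Real.pi) ^ ((d : ℝ) / 2) *
    (E * ((2 * Real.pi) ^ 2 * ρ ^ 2) * phiHat A Q ((2 * Real.pi) • x)) ^ m * quadForm Q η ^ m =
    (2 * Real.pi) ^ ((d : ℝ) / 2) * (E * quadForm Q ζ * phiHat A Q ((2 * Real.pi) • x)) ^ m by
      rw [hW]; ring]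
  exact h5

end LocalBehaviour

/-! ### Periodizations and their Fourier coefficients. -/

section Periodization

variable {d : ℕ}

/-- If `p = ∑ c l φ(· - l)` on a lattice and `p' = ∑ c l g(· + l)`, then `∑ p g = ∑ p' φ`. -/
lemma exists_hasSum_commute {ι : Type*} [AddCommGroup ι] {φ g c p p' : ι → ℂ}
    (hφ : (Function.support φ).Finite) (hg : (Function.support g).Finite)
    (hp : ∀ k, HasSum (fun l => c l * φ (k - l)) (p k))
    (hp' : ∀ k, HasSum (fun l => c l * g (k + l)) (p' k)) :
    ∃ S, HasSum (fun k => p k * g k) S ∧ HasSum (fun k => p' k * φ k) S := by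
  -- Both sums are iterated sums of this finitely supported function, once directly and once after
  -- the shear `(k, l) ↦ (k - l, l)`.
  set F : ι × ι → ℂ := fun q => c q.2 * g (q.1 + q.2) * φ q.1 with hF
  have hfin : (Function.support F).Finite := by
    refine ((hφ.prod hg).preimage (f := fun q : ι × ι => (q.1, q.1 + q.2)) ?_).subset ?_
    · rintro ⟨a, b⟩ - ⟨a', b'⟩ - hab
      simp only [Prod.mk.injEq] at hab
      obtain ⟨rfl, h2⟩ := hab
      rw [add_left_cancel h2]
    · rintro ⟨a, b⟩ hab
      exact ⟨right_ne_zero_of_mul hab, right_ne_zero_of_mul (left_ne_zero_of_mul hab)⟩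
  have hS : HasSum F (∑' q, F q) := (summable_of_hasFiniteSupport hfin).hasSum
  refine ⟨∑' q, F q, ?_, hS.prod_fiberwise fun k => (hp' k).mul_right (φ k)⟩
  let e : ι × ι ≃ ι × ι :=
    { toFun := fun q => (q.1 - q.2, q.2)
      invFun := fun q => (q.1 + q.2, q.2)
      left_inv := fun q => by simp
      right_inv := fun q => by simp }
  have hS' := (e.hasSum_iff (f := F)).2 hS
  refine hS'.prod_fiberwise fun k => ((hp k).mul_right (g k)).congr_fun fun l => ?_
  simp only [Function.comp_apply, hF, e, Equiv.coe_fn_mk, sub_add_cancel]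
  ring

lemma sum_eval_eq_zero_of_int {ι : Type*} (s : Finset ι) (a : ι → ℂ)
    (q : ι → MvPolynomial (Fin d) ℝ)
    (h : ∀ n : Fin d → ℤ,
      ∑ i ∈ s, a i * ((MvPolynomial.eval (fun j => (n j : ℝ)) (q i) : ℝ) : ℂ) = 0)
    (w : Fin d → ℝ) : ∑ i ∈ s, a i * ((MvPolynomial.eval w (q i) : ℝ) : ℂ) = 0 := by
  set R : MvPolynomial (Fin d) ℂ :=
    ∑ i ∈ s, MvPolynomial.C (a i) * MvPolynomial.map Complex.ofRealHom (q i) with hR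
  have hev : ∀ w : Fin d → ℝ, MvPolynomial.eval (fun j => (w j : ℂ)) R =
      ∑ i ∈ s, a i * ((MvPolynomial.eval w (q i) : ℝ) : ℂ) := by
    intro w
    rw [hR, map_sum]
    refine Finset.sum_congr rfl fun i _ => ?_
    rw [map_mul, MvPolynomial.eval_C, MvPolynomial.eval_map]
    congr 1
    exact (MvPolynomial.eval₂_comp_left Complex.ofRealHom (RingHom.id ℝ) w (q i)).symm
  have h0 : R = 0 := by
    refine MvPolynomial.funext_set (fun _ => Set.range (Int.cast : ℤ → ℂ))
      (fun _ => Set.infinite_range_of_injective Int.cast_injective) fun x hx => ?_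
    choose k hk using fun i => hx i (Set.mem_univ i)
    have : x = fun i => (((k i : ℝ)) : ℂ) := funext fun i => by rw [← hk i]; simp
    rw [this, hev, h, map_zero]
  rw [← hev, h0, map_zero]

lemma intVec_neg_sub (k : Fin d → ℤ) (y : EuclideanSpace ℝ (Fin d)) :
    y + intVec (-k) = y - intVec k := by
  rw [intVec_neg, sub_eq_add_neg]

lemma finite_support_comp_intVec {f : EuclideanSpace ℝ (Fin d) → ℂ} (hf : HasCompactSupport f)
    (y : EuclideanSpace ℝ (Fin d)) : (Function.support fun k => f (y + intVec k)).Finite := by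
  obtain ⟨r, hr⟩ := hf.isCompact.isBounded.subset_closedBall 0
  refine (finite_norm_intVec_le (r + ‖y‖)).subset fun k hk => ?_
  have h1 := hr (subset_tsupport _ hk)
  rw [mem_closedBall_zero_iff] at h1
  have h2 : ‖intVec k‖ ≤ ‖y + intVec k‖ + ‖y‖ := by simpa using norm_sub_le (y + intVec k) y
  exact h2.trans (by gcongr)

lemma finite_support_comp_sub_intVec {f : EuclideanSpace ℝ (Fin d) → ℂ}
    (hf : HasCompactSupport f) (y : EuclideanSpace ℝ (Fin d)) :
    (Function.support fun k => f (y - intVec k)).Finite := by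
  have h1 := (finite_support_comp_intVec hf y).preimage (f := fun k => -k) neg_injective.injOn
  refine h1.subset fun k hk => ?_
  simpa only [Set.mem_preimage, Function.mem_support, intVec_neg_sub] using hk

/-- A real polynomial as a complex function on the Euclidean space. -/
noncomputable def polyFun (p : MvPolynomial (Fin d) ℝ) (x : EuclideanSpace ℝ (Fin d)) : ℂ :=
  ((MvPolynomial.eval x p : ℝ) : ℂ)

/-- If a polynomial `p` is in the span of the shifts of `f`, then the periodization of
`p(-·) f` is constant. -/
lemma exists_hasSum_periodization {f : EuclideanSpace ℝ (Fin d) → ℂ} (hf : HasCompactSupport f)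
    (p : MvPolynomial (Fin d) ℝ) (c : (Fin d → ℤ) → ℂ)
    (hc : ∀ x : EuclideanSpace ℝ (Fin d), HasSum (fun l => c l * f (x - intVec l))
      (polyFun p x)) :
    ∃ C, ∀ y : EuclideanSpace ℝ (Fin d), HasSum (fun k =>
      polyFun p (-(y + intVec k)) * f (y + intVec k)) C := by
  classical
  -- Lattice convolution with `f` commutes: the values of `p` on `ℤ^d`, and on `x + ℤ^d`, are
  -- convolutions of the same `c` with the values of `f`.
  have key : ∀ x : EuclideanSpace ℝ (Fin d),
      ∑' k, polyFun p (intVec k) * f (x - intVec k) =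
      ∑' k, polyFun p (x - intVec k) * f (intVec k) := by
    intro x
    obtain ⟨S, h1, h2⟩ := exists_hasSum_commute (φ := fun k => f (intVec k))
      (g := fun k => f (x - intVec k)) (c := c)
      (p := fun k => polyFun p (intVec k))
      (p' := fun k => polyFun p (x - intVec k))
      (by simpa using finite_support_comp_intVec hf 0) (finite_support_comp_sub_intVec hf x)
      (fun k => (hc (intVec k)).congr_fun fun l => by
        rw [sub_eq_add_neg k, intVec_add, intVec_neg, sub_eq_add_neg])
      (fun k => (hc (x - intVec k)).congr_fun fun l => by rw [intVec_add, sub_sub])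
    rw [h1.tsum_eq, h2.tsum_eq]
  refine ⟨∑' k, polyFun p (-(intVec k)) * f (intVec k), fun y => ?_⟩
  have hfy := finite_support_comp_intVec hf y
  have hf0 : (Function.support fun k => f (intVec k)).Finite := by
    simpa using finite_support_comp_intVec hf 0
  have hsum : ∀ (g : (Fin d → ℤ) → ℂ) (u : EuclideanSpace ℝ (Fin d)),
      Summable fun k => g k * f (u + intVec k) := fun g u =>
    summable_of_hasFiniteSupport ((finite_support_comp_intVec hf u).subset
      fun k hk => right_ne_zero_of_mul hk)
  suffices h : ∑' k, polyFun p (-(y + intVec k)) * f (y + intVec k) =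
      ∑' k, polyFun p (-(intVec k)) * f (intVec k) by
    rw [← h]
    exact (hsum _ y).hasSum
  -- A single finite index set serves all `n` below; otherwise the sums would not be polynomial in
  -- `n`.
  set T := hfy.toFinset ∪ hf0.toFinset with hT
  have hT1 : ∀ g : (Fin d → ℤ) → ℂ,
      ∑' k, g k * f (y + intVec k) = ∑ k ∈ T, g k * f (y + intVec k) := fun g =>
    tsum_eq_sum fun k hk => by
      have : f (y + intVec k) = 0 := by
        by_contra h0
        exact hk (Finset.mem_union_left _ (hfy.mem_toFinset.2 h0))
      rw [this, mul_zero]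
  have hT2 : ∀ g : (Fin d → ℤ) → ℂ,
      ∑' k, g k * f (intVec k) = ∑ k ∈ T, g k * f (intVec k) := fun g =>
    tsum_eq_sum fun k hk => by
      have : f (intVec k) = 0 := by
        by_contra h0
        exact hk (Finset.mem_union_right _ (hf0.mem_toFinset.2 h0))
      rw [this, mul_zero]
  rw [hT1, hT2]
  -- The identity `key` at `y + n` reads `∑ f(y+k) p(n-k) = ∑ f(k) p(y+n-k)`. Both sides are
  -- polynomial in `n`, so `n` may be replaced by the real point `-y`, which makes the right side
  -- independent of `y`.
  have hz := sum_eval_eq_zero_of_int (T.disjSum T)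
    (Sum.elim (fun k => f (y + intVec k)) fun k => -f (intVec k))
    (Sum.elim (fun k => polyShift (-(intVec k)).ofLp p) fun k => polyShift (y - intVec k).ofLp p)
    (fun n => ?_) (-y).ofLp
  · rw [Finset.sum_disjSum] at hz
    simp only [Sum.elim_inl, Sum.elim_inr, eval_polyShift, neg_mul, Finset.sum_neg_distrib] at hz
    rw [← sub_eq_add_neg, sub_eq_zero] at hz
    convert hz using 1
    · refine Finset.sum_congr rfl fun k _ => ?_
      rw [mul_comm, neg_add]
      rfl
    · refine Finset.sum_congr rfl fun k _ => ?_
      rw [mul_comm]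
      congr 4
      ext i
      simp
      ring
  · rw [Finset.sum_disjSum]
    simp only [Sum.elim_inl, Sum.elim_inr, eval_polyShift, neg_mul, Finset.sum_neg_distrib]
    rw [← sub_eq_add_neg, sub_eq_zero]
    have hk := key (y + intVec n)
    -- The substitution `k ↦ n - k` moves `n` out of the argument of `f`.
    have e1 : ∑' k, polyFun p (intVec k) * f (y + intVec n - intVec k) =
        ∑' k, polyFun p (intVec n - intVec k) * f (y + intVec k) := by
      rw [← (Equiv.subLeft n).tsum_eq]
      refine tsum_congr fun k => ?_
      rw [Equiv.subLeft_apply, sub_eq_add_neg n, intVec_add, intVec_neg]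
      congr 2
      abel
    rw [e1] at hk
    rw [hT1 fun k => polyFun p (intVec n - intVec k),
      hT2 fun k => polyFun p (y + intVec n - intVec k)] at hk
    convert hk using 1
    · refine Finset.sum_congr rfl fun k _ => ?_
      rw [mul_comm, sub_eq_add_neg]
      rfl
    · refine Finset.sum_congr rfl fun k _ => ?_
      rw [mul_comm]
      congr 4
      ext i
      simp
      ring

/-- The half-open unit cube. -/
def unitCube (d : ℕ) : Set (EuclideanSpace ℝ (Fin d)) := {y | ∀ i, y i ∈ Set.Ico (0 : ℝ) 1}

lemma measurableSet_unitCube : MeasurableSet (unitCube d) := by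
  have : unitCube d = ⋂ i, (fun y : EuclideanSpace ℝ (Fin d) => y i) ⁻¹' Set.Ico (0 : ℝ) 1 := by
    ext y; simp [unitCube]
  rw [this]
  exact MeasurableSet.iInter fun i => (by fun_prop : Measurable fun y : EuclideanSpace ℝ (Fin d) =>
    y i) measurableSet_Ico

lemma sub_intVec_mem_unitCube (y : EuclideanSpace ℝ (Fin d)) (k : Fin d → ℤ) :
    y - intVec k ∈ unitCube d ↔ k = fun i => ⌊y i⌋ := by
  simp only [unitCube, Set.mem_ofPred_eq, PiLp.sub_apply, intVec_apply, Set.mem_Ico, sub_nonneg,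
    sub_lt_iff_lt_add, funext_iff]
  refine forall_congr' fun i => ?_
  rw [eq_comm, Int.floor_eq_iff, add_comm]

/-- Unfolding of an integral over the whole space to the unit cube. -/
lemma integral_eq_of_periodization {F : EuclideanSpace ℝ (Fin d) → ℂ} (hF : Continuous F)
    (hFc : HasCompactSupport F) {C : ℂ} (hC : ∀ y, HasSum (fun k => F (y + intVec k)) C)
    (k₀ : Fin d → ℤ) : ∫ y, expChar (-intVec k₀) y * F y =
      ∫ y, (unitCube d).indicator (fun y => expChar (-intVec k₀) y * C) y := by
  classical
  obtain ⟨r, hr⟩ := hFc.isCompact.isBounded.subset_closedBall 0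
  have hcube : ∀ y ∈ unitCube d, ‖y‖ ≤ √d := by
    intro y hy
    rw [EuclideanSpace.norm_eq]
    apply Real.sqrt_le_sqrt
    calc ∑ i, ‖y i‖ ^ 2 ≤ ∑ _i : Fin d, (1 : ℝ) := Finset.sum_le_sum fun i _ => by
          rw [Real.norm_of_nonneg (hy i).1]
          nlinarith [(hy i).1, (hy i).2]
      _ = d := by simp
  set T := (finite_norm_intVec_le (d := d) (r + √d)).toFinset with hT
  have hTz : ∀ k ∉ T, ∀ y ∈ unitCube d, F (y + intVec k) = 0 := by
    intro k hk y hy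
    by_contra h0
    have h1 := hr (subset_tsupport _ h0)
    rw [mem_closedBall_zero_iff] at h1
    refine hk ((Set.Finite.mem_toFinset _).2 ?_)
    have h2 : ‖intVec k‖ ≤ ‖y + intVec k‖ + ‖y‖ := by simpa using norm_sub_le (y + intVec k) y
    exact h2.trans (add_le_add h1 (hcube y hy))
  set g : EuclideanSpace ℝ (Fin d) → ℂ := fun y => expChar (-intVec k₀) y * F y with hg
  have hgi : MeasureTheory.Integrable g :=
    ((continuous_expChar _).mul hF).integrable_of_hasCompactSupport hFc.mul_left
  -- Each `y` lies in exactly one integer translate of the cube, and the translates outside `T` miss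
  -- the support of `F`.
  have hsplit : ∀ y, g y = ∑ k ∈ T, (unitCube d).indicator (fun z => g (z + intVec k))
      (y - intVec k) := by
    intro y
    have h1 : ∀ k, (unitCube d).indicator (fun z => g (z + intVec k)) (y - intVec k) =
        if k = (fun i => ⌊y i⌋) then g y else 0 := by
      intro k
      rw [Set.indicator_apply]
      simp only [sub_intVec_mem_unitCube, sub_add_cancel]
    simp only [h1, Finset.sum_ite_eq']
    split_ifs with h2
    · rfl
    · have h3 := hTz _ h2 (y - intVec fun i => ⌊y i⌋) ((sub_intVec_mem_unitCube _ _).2 rfl)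
      rw [sub_add_cancel] at h3
      simp only [hg, h3, mul_zero]
  have hper : ∀ (k : Fin d → ℤ) (y : EuclideanSpace ℝ (Fin d)), g (y + intVec k) =
      expChar (-intVec k₀) y * F (y + intVec k) := by
    intro k y
    simp only [hg]
    rw [expChar_add_right, ← intVec_neg k₀, expChar_intVec, mul_one]
  have hi : ∀ k, MeasureTheory.Integrable
      ((unitCube d).indicator fun z => g (z + intVec k)) := fun k =>
    (hgi.comp_add_right (intVec k)).indicator measurableSet_unitCube
  change ∫ y, g y = _
  calc ∫ y, g y = ∫ y, ∑ k ∈ T, (unitCube d).indicator (fun z => g (z + intVec k))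
        (y - intVec k) := by simp only [← hsplit]
    _ = ∑ k ∈ T, ∫ y, (unitCube d).indicator (fun z => g (z + intVec k)) (y - intVec k) :=
        MeasureTheory.integral_finsetSum _ fun k _ => (hi k).comp_sub_right (intVec k)
    _ = ∑ k ∈ T, ∫ y, (unitCube d).indicator (fun z => g (z + intVec k)) y :=
        Finset.sum_congr rfl fun k _ => MeasureTheory.integral_sub_right_eq_self _ _
    _ = ∫ y, ∑ k ∈ T, (unitCube d).indicator (fun z => g (z + intVec k)) y :=
        (MeasureTheory.integral_finsetSum _ fun k _ => hi k).symm
    _ = _ := by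
        refine MeasureTheory.integral_congr_ae (Filter.Eventually.of_forall fun y => ?_)
        simp only
        by_cases hy : y ∈ unitCube d
        · simp only [Set.indicator_of_mem hy, hper, ← Finset.mul_sum]
          congr 1
          exact (hasSum_sum_of_ne_finset_zero fun k hk => hTz k hk y hy).unique (hC y)
        · simp only [Set.indicator_of_notMem hy, Finset.sum_const_zero]

/-- The Fourier transform at a nonzero integer of a function with constant periodization is
zero. -/
lemma integral_eq_zero_of_periodization {F : EuclideanSpace ℝ (Fin d) → ℂ} (hF : Continuous F)
    (hFc : HasCompactSupport F) {C : ℂ} (hC : ∀ y, HasSum (fun k => F (y + intVec k)) C)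
    {k₀ : Fin d → ℤ} (hk : k₀ ≠ 0) : ∫ y, expChar (-intVec k₀) y * F y = 0 := by
  have hn : intVec k₀ ≠ 0 := fun h => hk (funext fun i => by
    have := congrFun (congrArg WithLp.ofLp h) i
    simpa using this)
  -- A half period of the character, which takes the value `-1` at `v`.
  set v : EuclideanSpace ℝ (Fin d) := (2 * ‖intVec k₀‖ ^ 2)⁻¹ • intVec k₀ with hv
  have hev : expChar (-intVec k₀) v = -1 := by
    have h0 : ‖intVec k₀‖ ^ 2 ≠ 0 := pow_ne_zero 2 (norm_ne_zero_iff.2 hn)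
    have h1 : 2 * Real.pi * inner ℝ (-intVec k₀) v = -Real.pi := by
      rw [hv, inner_neg_left, inner_smul_right, real_inner_self_eq_norm_sq]
      field_simp
    rw [expChar, h1, Complex.ofReal_neg, neg_mul, Complex.exp_neg, Complex.exp_pi_mul_I]
    norm_num
  have h1 := integral_eq_of_periodization hF hFc hC k₀
  -- The translate by `v` has the same constant periodization, hence the same integral; translating
  -- back changes the sign of the character. So the integral equals its own negative.
  have h2 := integral_eq_of_periodization (F := fun y => F (y + v))
    (hF.comp (continuous_id.add continuous_const))
    (hFc.comp_homeomorph (Homeomorph.addRight v))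
    (fun y => (hC (y + v)).congr_fun fun k => by rw [add_right_comm]) k₀
  rw [← h1, ← MeasureTheory.integral_sub_right_eq_self _ v] at h2
  have h3 : ∀ y, expChar (-intVec k₀) (y - v) * F (y - v + v) =
      -(expChar (-intVec k₀) y * F y) := by
    intro y
    have h4 : expChar (-intVec k₀) (y - v) * expChar (-intVec k₀) v = expChar (-intVec k₀) y := by
      rw [← expChar_add_right, sub_add_cancel]
    rw [hev, mul_neg, mul_one] at h4
    rw [sub_add_cancel, ← h4]
    ring
  simp only [h3] at h2
  rw [MeasureTheory.integral_neg] at h2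
  have h5 : (2 : ℂ) * ∫ y, expChar (-intVec k₀) y * F y = 0 := by
    rw [two_mul]
    nth_rewrite 1 [← h2]
    exact neg_add_cancel _
  exact (mul_eq_zero.1 h5).resolve_left two_ne_zero

end Periodization

/-! ### Moments from the order of vanishing at the origin. -/

section Moments

variable {d : ℕ}

/-- Multiplying the convergent quantity by a positive power of `t` shows that the constant
coefficient vanishes; cancelling one `t` lowers `N`. -/
lemma coeff_eq_of_tendsto (N : ℕ) (b : ℕ → ℂ) (ℓ : ℂ)
    (h : Filter.Tendsto (fun t : ℝ => ((t⁻¹ ^ N : ℝ) : ℂ) *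
      ∑ n ∈ Finset.range (N + 1), b n * (t : ℂ) ^ n) (nhdsWithin 0 {0}ᶜ) (nhds ℓ)) :
    (∀ n < N, b n = 0) ∧ b N = ℓ := by
  induction N generalizing b with
  | zero =>
    simp only [pow_zero, Complex.ofReal_one, one_mul, zero_add, Finset.sum_range_one, mul_one] at h
    exact ⟨fun n hn => absurd hn (Nat.not_lt_zero n), tendsto_nhds_unique tendsto_const_nhds h⟩
  | succ N ih =>
    have hcont : ∀ g : ℝ → ℂ, Continuous g → Filter.Tendsto g (nhdsWithin 0 {0}ᶜ) (nhds (g 0)) :=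
      fun g hg => hg.continuousAt.tendsto.mono_left nhdsWithin_le_nhds
    have h1 := hcont (fun t => ∑ n ∈ Finset.range (N + 1 + 1), b n * (t : ℂ) ^ n) (by fun_prop)
    have h2 := (hcont (fun t => (t : ℂ) ^ (N + 1)) (by fun_prop)).mul h
    have h3 : b 0 = 0 := by
      have h4 := tendsto_nhds_unique (h1.congr' ?_) h2
      · simpa [Finset.sum_range_succ'] using h4
      · filter_upwards [self_mem_nhdsWithin] with t ht
        have ht' : (t : ℂ) ≠ 0 := by exact_mod_cast ht
        rw [← mul_assoc, Complex.ofReal_pow, Complex.ofReal_inv, ← mul_pow, mul_inv_cancel₀ ht',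
          one_pow, one_mul]
    obtain ⟨h5, h6⟩ := ih (fun n => b (n + 1)) (h.congr' (by
      filter_upwards [self_mem_nhdsWithin] with t ht
      have ht' : (t : ℂ) ≠ 0 := by exact_mod_cast ht
      rw [Finset.sum_range_succ', h3, zero_mul, add_zero]
      simp only [pow_succ _ _, ← mul_assoc, ← Finset.sum_mul]
      push_cast
      field_simp))
    refine ⟨fun n hn => ?_, h6⟩
    rcases n with _ | n
    · exact h3
    · exact h5 n (by omega)

/-- The moments of a compactly supported function from the behaviour of its Laplace transform. -/
lemma moments_of_tendsto {w z : EuclideanSpace ℝ (Fin d) → ℂ} (hw : Continuous w)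
    (hwc : HasCompactSupport w) (hz : Continuous z) (N : ℕ) (ℓ : ℂ)
    (h : Filter.Tendsto (fun t : ℝ => ((t⁻¹ ^ N : ℝ) : ℂ) *
      ∫ y, Complex.exp (t * z y) * w y) (nhdsWithin 0 {0}ᶜ) (nhds ℓ)) :
    (∀ n < N, ∫ y, z y ^ n * w y = 0) ∧ ∫ y, z y ^ N * w y = N.factorial * ℓ := by
  have hint : ∀ g : EuclideanSpace ℝ (Fin d) → ℂ, Continuous g →
      MeasureTheory.Integrable fun y => g y * w y := fun g hg =>
    (hg.mul hw).integrable_of_hasCompactSupport hwc.mul_left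
  set b : ℕ → ℂ := fun n => (n.factorial : ℂ)⁻¹ * ∫ y, z y ^ n * w y with hb
  -- Constant in the Taylor remainder of the exponential, uniform for `|t| ≤ 1` and finite because
  -- `w` has compact support.
  set B : ℝ := ∫ y, ‖z y‖ ^ (N + 1) * Real.exp ‖z y‖ * ‖w y‖ with hB
  have hrem : ∀ t : ℝ, |t| ≤ 1 → ‖(∫ y, Complex.exp (t * z y) * w y) -
      ∑ n ∈ Finset.range (N + 1), b n * (t : ℂ) ^ n‖ ≤ |t| ^ (N + 1) * B := by
    intro t ht
    have h1 : ∑ n ∈ Finset.range (N + 1), b n * (t : ℂ) ^ n =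
        ∫ y, (∑ n ∈ Finset.range (N + 1), (t * z y) ^ n / n.factorial) * w y := by
      simp only [Finset.sum_mul]
      rw [MeasureTheory.integral_finsetSum _ fun n _ => hint _ (by fun_prop)]
      refine Finset.sum_congr rfl fun n _ => ?_
      rw [hb, mul_comm, ← mul_assoc, ← MeasureTheory.integral_const_mul]
      refine MeasureTheory.integral_congr_ae (Filter.Eventually.of_forall fun y => ?_)
      simp only
      rw [mul_pow]
      ring
    rw [h1, ← MeasureTheory.integral_sub (hint _ (by fun_prop)) (hint _ (by fun_prop)), hB,
      ← MeasureTheory.integral_const_mul]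
    refine MeasureTheory.norm_integral_le_of_norm_le ?_ (Filter.Eventually.of_forall fun y => ?_)
    · refine Continuous.integrable_of_hasCompactSupport (by fun_prop) ?_
      exact (hwc.norm.mul_left).mul_left
    · rw [← sub_mul, norm_mul]
      have h2 := Complex.norm_exp_sub_sum_le_norm_mul_exp (t * z y) (N + 1)
      have h3 : ‖(t : ℂ) * z y‖ = |t| * ‖z y‖ := by
        rw [norm_mul, Complex.norm_real, Real.norm_eq_abs]
      rw [h3, mul_pow] at h2
      have h4 : Real.exp (|t| * ‖z y‖) ≤ Real.exp ‖z y‖ :=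
        Real.exp_le_exp.2 (mul_le_of_le_one_left (norm_nonneg _) ht)
      calc _ ≤ |t| ^ (N + 1) * ‖z y‖ ^ (N + 1) * Real.exp (|t| * ‖z y‖) * ‖w y‖ := by gcongr
        _ ≤ |t| ^ (N + 1) * ‖z y‖ ^ (N + 1) * Real.exp ‖z y‖ * ‖w y‖ := by gcongr
        _ = _ := by ring
  have hz0 : Filter.Tendsto (fun t : ℝ => ((t⁻¹ ^ N : ℝ) : ℂ) *
      ((∫ y, Complex.exp (t * z y) * w y) - ∑ n ∈ Finset.range (N + 1), b n * (t : ℂ) ^ n))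
      (nhdsWithin 0 {0}ᶜ) (nhds 0) := by
    have h1 : Filter.Tendsto (fun t : ℝ => |t| * B) (nhdsWithin 0 {0}ᶜ) (nhds 0) := by
      have : Continuous fun t : ℝ => |t| * B := by fun_prop
      simpa using this.continuousAt.tendsto.mono_left (nhdsWithin_le_nhds (a := (0 : ℝ)))
    refine squeeze_zero_norm' ?_ h1
    have h2 : ∀ᶠ t : ℝ in nhdsWithin 0 {0}ᶜ, |t| ≤ 1 := by
      filter_upwards [nhdsWithin_le_nhds (Metric.closedBall_mem_nhds (0 : ℝ) one_pos)] with t ht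
      simpa using ht
    filter_upwards [h2, self_mem_nhdsWithin] with t ht ht0
    have ht' : |t| ≠ 0 := abs_ne_zero.2 ht0
    rw [norm_mul, Complex.norm_real, Real.norm_eq_abs, abs_pow, abs_inv]
    calc _ ≤ |t|⁻¹ ^ N * (|t| ^ (N + 1) * B) := by
          gcongr
          exact hrem t ht
      _ = _ := by
          rw [pow_succ, inv_pow]
          field_simp
  have h1 := h.sub hz0
  simp only [mul_sub, sub_sub_cancel, sub_zero] at h1
  obtain ⟨h2, h3⟩ := coeff_eq_of_tendsto N b ℓ h1
  have hf : ∀ n : ℕ, (n.factorial : ℂ) ≠ 0 := fun n => by exact_mod_cast n.factorial_ne_zero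
  refine ⟨fun n hn => (mul_eq_zero.1 (h2 n hn)).resolve_left (inv_ne_zero (hf n)), ?_⟩
  rw [← h3, hb]
  simp only
  rw [mul_inv_cancel_left₀ (hf N)]

end Moments

/-! ### Smoothing the scaling function. -/

section Smoothing

variable {d : ℕ} {A : Matrix (Fin d) (Fin d) ℤ} {Q U : Matrix (Fin d) (Fin d) ℝ}

/-- Smoothing the scaling function by a test function gives a continuous compactly supported
function. -/
lemma exists_smoothing (hd : 0 < d) (hA : IsDilationMatrix A) (h : IsFactorization A Q U) (m : ℕ)
    {χ : 𝓢(EuclideanSpace ℝ (Fin d), ℂ)} (hχ : HasCompactSupport χ) :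
    ∃ f : EuclideanSpace ℝ (Fin d) → ℂ, Continuous f ∧ HasCompactSupport f ∧
      (∀ x, f x = ellipticScalingFunction hd hA h m (SchwartzMap.compSubConstCLM ℂ x χ)) ∧
      ∀ ζ, ∫ y, expChar (-ζ) y * f y = fourierSide A Q m ζ * (𝓕⁻ χ) ζ := by
  set H : EuclideanSpace ℝ (Fin d) → ℂ := fun η => fourierSide A Q m η * (𝓕⁻ χ) η with hH
  have hHc : Continuous H := (continuous_fourierSide hd hA h m).mul (𝓕⁻ χ).continuous
  have hHi : MeasureTheory.Integrable H :=
    integrable_mul_schwartz (fourierSide_slowlyIncreasing hd hA h m) _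
  set f : EuclideanSpace ℝ (Fin d) → ℂ := fun x => ∫ η, expChar x η * H η with hf
  have hfx : ∀ x, f x = ellipticScalingFunction hd hA h m (SchwartzMap.compSubConstCLM ℂ x χ) := by
    intro x
    rw [ellipticScalingFunction_apply, hf]
    refine MeasureTheory.integral_congr_ae (Filter.Eventually.of_forall fun η => ?_)
    have := fourierInv_compSubConst (-x) χ η
    rw [neg_neg] at this
    simp only [hH, this]
    ring
  have hfc : Continuous f := by
    refine MeasureTheory.continuous_of_dominated (bound := fun η => ‖H η‖) (fun x => ?_)
      (fun x => Filter.Eventually.of_forall fun η => ?_) hHi.norm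
      (Filter.Eventually.of_forall fun η => ?_)
    · exact ((continuous_expChar x).mul hHc).aestronglyMeasurable
    · rw [norm_mul, norm_expChar, one_mul]
    · simp only [expChar_comm _ η]
      exact (continuous_expChar η).mul continuous_const
  have hfs : HasCompactSupport f := by
    obtain ⟨R, hR⟩ := exists_support_radius hd hA h m
    obtain ⟨r, hr⟩ := hχ.isCompact.isBounded.subset_closedBall 0
    refine HasCompactSupport.intro (isCompact_closedBall 0 (R + r)) fun x hx => ?_
    rw [hfx]
    refine hR _ fun y hy => ?_
    rw [SchwartzMap.compSubConstCLM_apply]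
    by_contra h0
    have h1 := hr (subset_tsupport _ h0)
    rw [mem_closedBall_zero_iff] at h1 hx
    have h2 : ‖x‖ ≤ ‖y‖ + ‖y - x‖ := by simpa using norm_sub_le y (y - x)
    exact hx (by linarith)
  refine ⟨f, hfc, hfs, hfx, fun ζ => ?_⟩
  have e1 : 𝓕⁻ H = f := by
    funext x
    rw [Real.fourierInv_eq', hf]
    refine MeasureTheory.integral_congr_ae (Filter.Eventually.of_forall fun η => ?_)
    simp only [expChar, smul_eq_mul, real_inner_comm]
  have e2 : 𝓕 H = fun x => f (-x) := by
    funext x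
    rw [Real.fourier_eq', hf]
    refine MeasureTheory.integral_congr_ae (Filter.Eventually.of_forall fun η => ?_)
    simp only [expChar, smul_eq_mul, inner_neg_left, real_inner_comm, neg_mul, mul_neg]
  have hfi : MeasureTheory.Integrable f := hfc.integrable_of_hasCompactSupport hfs
  -- Inversion applies because `H` is continuous and integrable and its transform, a reflection of
  -- `f`, is continuous with compact support.
  have e3 := hHc.fourier_fourierInv_eq hHi (by rw [e2]; exact hfi.comp_neg)
  rw [e1] at e3
  change _ = H ζ
  rw [← congrFun e3 ζ, Real.fourier_eq']
  refine MeasureTheory.integral_congr_ae (Filter.Eventually.of_forall fun y => ?_)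
  simp only [expChar, smul_eq_mul, inner_neg_left, real_inner_comm, neg_mul, mul_neg]

end Smoothing

/-! ### The moment functional at a lattice point is a multiple of `ellipticFunctional`. -/

section Annihilation

variable {d : ℕ} {A : Matrix (Fin d) (Fin d) ℤ} {Q U : Matrix (Fin d) (Fin d) ℝ}

lemma totalDegree_bind₁_affine_le (s : ℝ) (u : Fin d → ℝ) (P : MvPolynomial (Fin d) ℝ) :
    (MvPolynomial.bind₁ (fun i => MvPolynomial.C s * MvPolynomial.X i + MvPolynomial.C (u i))
      P).totalDegree ≤ P.totalDegree := by
  have h1 : ∀ i : Fin d, (MvPolynomial.C s * MvPolynomial.X i +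
      MvPolynomial.C (u i) : MvPolynomial (Fin d) ℝ).totalDegree ≤ 1 := by
    intro i
    refine (MvPolynomial.totalDegree_add _ _).trans (max_le ?_ (by simp))
    refine (MvPolynomial.totalDegree_mul _ _).trans ?_
    simp
  conv_lhs => rw [P.as_sum, map_sum]
  refine MvPolynomial.totalDegree_finsetSum_le fun v hv => ?_
  rw [MvPolynomial.bind₁_monomial]
  refine (MvPolynomial.totalDegree_mul _ _).trans ?_
  rw [MvPolynomial.totalDegree_C, zero_add]
  refine (MvPolynomial.totalDegree_finsetProd _ _).trans ?_
  refine le_trans ?_ (MvPolynomial.le_totalDegree hv)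
  refine Finset.sum_le_sum fun i _ => (MvPolynomial.totalDegree_pow _ _).trans ?_
  exact mul_le_of_le_one_right (Nat.zero_le _) (h1 i)

lemma continuous_polyFun (P : MvPolynomial (Fin d) ℝ) : Continuous (polyFun P) :=
  Complex.continuous_ofReal.comp ((MvPolynomial.continuous_eval P).comp (by fun_prop))

lemma integrable_polyFun_mul (P : MvPolynomial (Fin d) ℝ) {w : EuclideanSpace ℝ (Fin d) → ℂ}
    (hw : Continuous w) (hwc : HasCompactSupport w) :
    MeasureTheory.Integrable fun y => polyFun P y * w y :=
  ((continuous_polyFun P).mul hw).integrable_of_hasCompactSupport hwc.mul_left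

/-- The functional `P ↦ ∫ P w`. -/
noncomputable def momentFunctional {w : EuclideanSpace ℝ (Fin d) → ℂ} (hw : Continuous w)
    (hwc : HasCompactSupport w) : MvPolynomial (Fin d) ℝ →ₗ[ℝ] ℂ where
  toFun P := ∫ y, polyFun P y * w y
  map_add' P P' := by
    rw [← MeasureTheory.integral_add (integrable_polyFun_mul P hw hwc)
      (integrable_polyFun_mul P' hw hwc)]
    simp only [polyFun, map_add, Complex.ofReal_add, add_mul]
  map_smul' a P := by
    rw [RingHom.id_apply, Complex.real_smul, ← MeasureTheory.integral_const_mul]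
    simp only [polyFun, MvPolynomial.smul_eval, Complex.ofReal_mul, mul_assoc]

/-- A functional on polynomials of bounded degree is determined by powers of linear forms. -/
lemma momentFunctional_eq {w : EuclideanSpace ℝ (Fin d) → ℂ} (hw : Continuous w)
    (hwc : HasCompactSupport w) {N : ℕ} {c : ℂ} (l : MvPolynomial (Fin d) ℝ →ₗ[ℝ] ℝ)
    (h : ∀ n ≤ N, ∀ η, momentFunctional hw hwc (linearForm η ^ n) = c * l (linearForm η ^ n))
    {P : MvPolynomial (Fin d) ℝ} (hP : P.totalDegree ≤ N) :
    momentFunctional hw hwc P = c * l P := by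
  set L : MvPolynomial (Fin d) ℝ →ₗ[ℝ] ℂ :=
    momentFunctional hw hwc - (LinearMap.toSpanSingleton ℝ ℂ c) ∘ₗ l with hL
  have hLa : ∀ P, L P = momentFunctional hw hwc P - c * l P := fun P => by
    simp [hL, mul_comm]
  have h0 : ∀ n ≤ N, ∀ η, L (linearForm η ^ n) = 0 := fun n hn η => by
    rw [hLa, h n hn, sub_self]
  have h1 := functional_eq_zero_of_linearForm_pow (l := Complex.reLm ∘ₗ L) (N := N)
    (fun n hn η => by rw [LinearMap.comp_apply, h0 n hn, map_zero]) hP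
  have h2 := functional_eq_zero_of_linearForm_pow (l := Complex.imLm ∘ₗ L) (N := N)
    (fun n hn η => by rw [LinearMap.comp_apply, h0 n hn, map_zero]) hP
  rw [← sub_eq_zero, ← hLa]
  exact Complex.ext h1 h2

/-- Both nonvanishing conditions matter: the one at `v` preserves the leading form of the Fourier
transform there, and the total mass is the factor cancelled at the end. -/
lemma exists_bump (v : EuclideanSpace ℝ (Fin d)) :
    ∃ (χ : 𝓢(EuclideanSpace ℝ (Fin d), ℂ)) (r : EuclideanSpace ℝ (Fin d) → ℝ),
      HasCompactSupport χ ∧ (∀ x, χ x = r x) ∧ ∫ x, χ x ≠ 0 ∧ (𝓕⁻ χ) v ≠ 0 := by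
  -- This radius ensures `|x · v| ≤ 1/4` on the support, so that `cos(2π x · v)` is nonnegative
  -- there.
  set ε : ℝ := (4 * (‖v‖ + 1))⁻¹ with hε
  have hε0 : 0 < ε := by positivity
  let r : ContDiffBump (0 : EuclideanSpace ℝ (Fin d)) := ⟨ε / 2, ε, by positivity, by linarith⟩
  have hrc : HasCompactSupport fun x => ((r x : ℝ) : ℂ) :=
    r.hasCompactSupport.comp_left (g := fun a : ℝ => (a : ℂ)) Complex.ofReal_zero
  have hrs : ContDiff ℝ (⊤ : ℕ∞) fun x => ((r x : ℝ) : ℂ) :=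
    Complex.ofRealCLM.contDiff.comp r.contDiff
  have hr1 : r 0 = 1 := r.one_of_mem_closedBall (by simp [r.rIn_pos.le])
  refine ⟨hrc.toSchwartzMap hrs, r, hrc, fun x => rfl, ?_, ?_⟩
  · change ∫ x, ((r x : ℝ) : ℂ) ≠ 0
    rw [integral_complex_ofReal]
    have := r.continuous.integral_pos_of_hasCompactSupport_nonneg_nonzero (x := 0)
      (μ := MeasureTheory.volume) r.hasCompactSupport (fun x => r.nonneg) (by simp [hr1])
    exact_mod_cast this.ne'
  · have hcos : ∀ x, 0 ≤ Real.cos (2 * Real.pi * inner ℝ x v) * r x := by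
      intro x
      by_cases hx : r x = 0
      · simp [hx]
      have hx' : x ∈ Metric.ball (0 : EuclideanSpace ℝ (Fin d)) ε := by
        rw [← r.support_eq]; exact hx
      rw [mem_ball_zero_iff] at hx'
      refine mul_nonneg (Real.cos_nonneg_of_mem_Icc (abs_le.1 ?_)) r.nonneg
      have h1 : |inner ℝ x v| ≤ 1 / 4 := by
        calc |inner ℝ x v| ≤ ‖x‖ * ‖v‖ := abs_real_inner_le_norm x v
          _ ≤ ε * (‖v‖ + 1) := by gcongr; linarith
          _ = 1 / 4 := by rw [hε]; field_simp
      rw [abs_mul, abs_of_pos Real.two_pi_pos]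
      nlinarith [Real.pi_pos]
    have hc : Continuous fun x => Real.cos (2 * Real.pi * inner ℝ x v) * r x :=
      (by fun_prop : Continuous fun x : EuclideanSpace ℝ (Fin d) =>
        Real.cos (2 * Real.pi * inner ℝ x v)).mul r.continuous
    have hpos := hc.integral_pos_of_hasCompactSupport_nonneg_nonzero (x := 0)
      (μ := MeasureTheory.volume) r.hasCompactSupport.mul_left hcos (by simp [hr1])
    intro h0
    rw [fourierInv_apply_eq_integral] at h0
    have hi : MeasureTheory.Integrable fun x => expChar x v * ((r x : ℝ) : ℂ) := by
      refine Continuous.integrable_of_hasCompactSupport ?_ hrc.mul_left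
      simp only [expChar_comm _ v]
      exact (continuous_expChar v).mul hrs.continuous
    have h1 := congrArg Complex.re h0
    change (∫ x, expChar x v * ((r x : ℝ) : ℂ)).re = 0 at h1
    have h2 : (∫ x, expChar x v * ((r x : ℝ) : ℂ)).re =
        ∫ x, (expChar x v * ((r x : ℝ) : ℂ)).re := (integral_re hi).symm
    rw [h2] at h1
    refine hpos.ne' (h1 ▸ ?_)
    refine MeasureTheory.integral_congr_ae (Filter.Eventually.of_forall fun x => ?_)
    simp only
    rw [Complex.re_mul_ofReal, expChar, Complex.exp_ofReal_mul_I_re]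

/-- The moments of the modulated smoothed scaling function. -/
lemma exists_momentFunctional_eq (hd : 0 < d) (hA : IsDilationMatrix A)
    (h : IsFactorization A Q U) (m : ℕ) {k : Fin d → ℤ} (hk : ∀ n : Fin d → ℤ, Aᵀ *ᵥ n ≠ k)
    {χ : 𝓢(EuclideanSpace ℝ (Fin d), ℂ)} (hχ : (𝓕⁻ χ) (intVec k) ≠ 0)
    {f : EuclideanSpace ℝ (Fin d) → ℂ} (hf : Continuous f) (hfc : HasCompactSupport f)
    (hfF : ∀ ζ, ∫ y, expChar (-ζ) y * f y = fourierSide A Q m ζ * (𝓕⁻ χ) ζ) :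
    ∃ c : ℂ, c ≠ 0 ∧ ∀ P : MvPolynomial (Fin d) ℝ, P.totalDegree ≤ 2 * m →
      ∫ y, polyFun P y * (expChar (-intVec k) y * f y) = c * ellipticFunctional Q m P := by
  obtain ⟨E, hE, hlim⟩ := tendsto_fourierSide hd hA h m hk
  set w : EuclideanSpace ℝ (Fin d) → ℂ := fun y => expChar (-intVec k) y * f y with hw
  have hwc : Continuous w := (continuous_expChar _).mul hf
  have hws : HasCompactSupport w := hfc.mul_left
  have hπ : ((2 * Real.pi : ℝ) : ℂ) ≠ 0 := by exact_mod_cast Real.two_pi_pos.ne'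
  -- With this `a`, the integral of `exp(t a η·y) w(y)` is the Fourier transform of `f` at `k + t
  -- η`.
  set a : ℂ := -((2 * Real.pi : ℝ) * Complex.I) with ha
  have ha0 : a ≠ 0 := neg_ne_zero.2 (mul_ne_zero hπ Complex.I_ne_zero)
  have hmom : ∀ η : EuclideanSpace ℝ (Fin d),
      (∀ n < 2 * m, ∫ y, (a * (inner ℝ η y : ℝ)) ^ n * w y = 0) ∧
      ∫ y, (a * (inner ℝ η y : ℝ)) ^ (2 * m) * w y =
        (2 * m).factorial * ((E * quadForm Q η ^ m : ℝ) * (𝓕⁻ χ) (intVec k)) := by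
    intro η
    refine moments_of_tendsto hwc hws (by fun_prop) (2 * m) _ ?_
    have h1 : ∀ t : ℝ, ∫ y, Complex.exp (t * (a * (inner ℝ η y : ℝ))) * w y =
        fourierSide A Q m (intVec k + t • η) * (𝓕⁻ χ) (intVec k + t • η) := by
      intro t
      rw [← hfF]
      refine MeasureTheory.integral_congr_ae (Filter.Eventually.of_forall fun y => ?_)
      simp only [hw]
      rw [← mul_assoc, neg_add, expChar_add_left, mul_comm (expChar (-intVec k) y)]
      congr 2
      rw [expChar, inner_neg_left, inner_smul_left, ha]
      congr 1
      push_cast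
      simp
      ring
    simp only [h1]
    simp only [← mul_assoc]
    refine (hlim η).mul ?_
    have h2 : Continuous fun t : ℝ => (𝓕⁻ χ) (intVec k + t • η) :=
      (𝓕⁻ χ).continuous.comp (by fun_prop)
    simpa using h2.continuousAt.tendsto.mono_left (nhdsWithin_le_nhds (a := (0 : ℝ)))
  have hlin : ∀ (η : Fin d → ℝ) (n : ℕ), a ^ n * momentFunctional hwc hws (linearForm η ^ n) =
      ∫ y, (a * (inner ℝ (WithLp.toLp 2 η) y : ℝ)) ^ n * w y := by
    intro η n
    change a ^ n * ∫ y, _ = _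
    rw [← MeasureTheory.integral_const_mul]
    refine MeasureTheory.integral_congr_ae (Filter.Eventually.of_forall fun y => ?_)
    simp only [polyFun]
    rw [map_pow, eval_linearForm, mul_pow, Complex.ofReal_pow, mul_assoc]
    congr 4
    simp [PiLp.inner_apply, dotProduct, mul_comm]
  refine ⟨(((2 * Real.pi) ^ (2 * m) : ℝ) : ℂ)⁻¹ * (E * (𝓕⁻ χ) (intVec k)), ?_, fun P hP => ?_⟩
  · refine mul_ne_zero (inv_ne_zero ?_) (mul_ne_zero (by exact_mod_cast hE) hχ)
    rw [Complex.ofReal_pow]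
    exact pow_ne_zero _ hπ
  refine momentFunctional_eq hwc hws (ellipticFunctional Q m) (fun n hn η => ?_) hP
  have h1 := hlin η n
  refine mul_left_cancel₀ (pow_ne_zero n ha0) ?_
  rcases hn.lt_or_eq with hn | rfl
  · rw [h1, (hmom _).1 n hn, ellipticFunctional_linearForm_pow_of_lt Q hn]
    simp
  · rw [h1, (hmom _).2, ellipticFunctional_linearForm_pow, ha, neg_pow, mul_pow]
    rw [pow_mul Complex.I, Complex.I_sq, pow_mul (-1 : ℂ), neg_one_sq, one_pow, one_mul,
      neg_pow (quadForm Q η)]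
    -- The sign of `a^(2m) = (-1)^m (2π)^(2m)` cancels that of `(-W(η))^m`.
    have h3 : (-1 : ℂ) ^ m * (-1) ^ m = 1 := by rw [← mul_pow]; simp
    push_cast at hπ ⊢
    field_simp
    linear_combination (-((2 * m).factorial * E * (quadForm Q η : ℂ) ^ m)) * h3

end Annihilation

/-! ### Polynomials in the span satisfy the differential equation. -/

section Kernel

variable {d : ℕ} {A : Matrix (Fin d) (Fin d) ℤ} {Q U : Matrix (Fin d) (Fin d) ℝ}

/-- Smoothing a polynomial by a real test function gives a polynomial. -/
lemma exists_polyFun_eq_integral {r : EuclideanSpace ℝ (Fin d) → ℝ} (hr : Continuous r)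
    (hrc : HasCompactSupport r) (P : MvPolynomial (Fin d) ℝ) :
    ∃ q : MvPolynomial (Fin d) ℝ, ∀ x : EuclideanSpace ℝ (Fin d),
      polyFun q x = ∫ u, polyFun P (u + x) * r u := by
  have hc : Continuous fun x => ((r x : ℝ) : ℂ) := Complex.continuous_ofReal.comp hr
  have hcs : HasCompactSupport fun x => ((r x : ℝ) : ℂ) :=
    hrc.comp_left (g := fun a : ℝ => (a : ℂ)) Complex.ofReal_zero
  obtain ⟨q, hq⟩ := exists_eval_eq_functional_bind (σ := Fin d)
    (Complex.reLm ∘ₗ momentFunctional hc hcs)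
    (fun i => MvPolynomial.X i + MvPolynomial.C (MvPolynomial.X i)) P
  simp only [map_add, MvPolynomial.map_X, MvPolynomial.map_C, MvPolynomial.eval_X] at hq
  refine ⟨q, fun x => ?_⟩
  have h1 : momentFunctional hc hcs (polyShift x.ofLp P) = ∫ u, polyFun P (u + x) * r u := by
    refine MeasureTheory.integral_congr_ae (Filter.Eventually.of_forall fun u => ?_)
    simp only [polyFun]
    rw [eval_polyShift]
    rfl
  have h2 : ∫ u, polyFun P (u + x) * r u =
      ((∫ u : EuclideanSpace ℝ (Fin d), MvPolynomial.eval (u + x).ofLp P * r u : ℝ) : ℂ) := by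
    rw [← integral_complex_ofReal]
    simp only [polyFun, Complex.ofReal_mul]
  change ((MvPolynomial.eval x.ofLp q : ℝ) : ℂ) = _
  rw [hq x.ofLp, LinearMap.comp_apply]
  change (((momentFunctional hc hcs (polyShift x.ofLp P)).re : ℝ) : ℂ) = _
  rw [h1, h2, Complex.ofReal_re]

/-- The polynomial `y ↦ P (u - y)`. -/
noncomputable def polyReflect (u : Fin d → ℝ) (P : MvPolynomial (Fin d) ℝ) :
    MvPolynomial (Fin d) ℝ :=
  MvPolynomial.bind₁ (fun i => MvPolynomial.C (-1) * MvPolynomial.X i + MvPolynomial.C (u i)) P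

lemma polyFun_polyReflect (u y : EuclideanSpace ℝ (Fin d)) (P : MvPolynomial (Fin d) ℝ) :
    polyFun (polyReflect u.ofLp P) y = polyFun P (u - y) := by
  rw [polyFun, polyFun, polyReflect, eval_bind₁]
  congr 3
  funext i
  simp
  ring

/-- The operator has even order, so it does not see the reflection; it sends `P` to a constant, so
it does not see the translation either. -/
lemma ellipticFunctional_polyReflect (Q : Matrix (Fin d) (Fin d) ℝ) {m : ℕ}
    {P : MvPolynomial (Fin d) ℝ} (hP : P.IsHomogeneous (2 * m)) (u : Fin d → ℝ) :
    ellipticFunctional Q m (polyReflect u P) = ellipticFunctional Q m P := by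
  have h0 := isHomogeneous_ellipticOperator_pow Q hP m
  rw [Nat.sub_self] at h0
  rw [ellipticFunctional_apply, polyReflect, ellipticOperator_pow_bind₁_affine, neg_one_sq,
    one_pow, one_smul, eval_bind₁, eval_eq_of_isHomogeneous_zero h0, ellipticFunctional_apply]

/-- The Fourier coefficient at `k` of the periodization of `q(-·) f`, where `q` and `f` are the
smoothings of `P` and `φ^m`, is computed twice: it vanishes since that periodization is constant,
and it is a nonzero multiple of `ellipticFunctional Q m P` by the local behaviour at `k`. -/
lemma ellipticFunctional_eq_zero_of_isHomogeneous (hd : 0 < d) (hA : IsDilationMatrix A)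
    (h : IsFactorization A Q U) (m : ℕ) {P : MvPolynomial (Fin d) ℝ}
    (hP : P ∈ polynomialsInSpan (ellipticScalingFunction hd hA h m))
    (hPh : P.IsHomogeneous (2 * m)) : ellipticFunctional Q m P = 0 := by
  obtain ⟨k, hk⟩ := exists_notMem_range_transpose hd hA
  have hk0 : k ≠ 0 := fun h0 => hk 0 (by rw [h0, Matrix.mulVec_zero])
  obtain ⟨χ, r, hχ, hχr, hχi, hχk⟩ := exists_bump (intVec k)
  obtain ⟨f, hf, hfc, hfx, hfF⟩ := exists_smoothing hd hA h m hχ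
  obtain ⟨a, ha, hmom⟩ := exists_momentFunctional_eq hd hA h m hk hχk hf hfc hfF
  have hr : r = fun x => (χ x).re := funext fun x => by rw [hχr, Complex.ofReal_re]
  obtain ⟨q, hq⟩ := exists_polyFun_eq_integral (r := r)
    (by rw [hr]; exact Complex.continuous_re.comp χ.continuous)
    (by rw [hr]; exact hχ.comp_left (g := Complex.re) Complex.zero_re) P
  simp only [← hχr] at hq
  obtain ⟨c, hc⟩ := hP
  have hsum : ∀ x : EuclideanSpace ℝ (Fin d),
      HasSum (fun l => (c l : ℂ) * f (x - intVec l)) (polyFun q x) := by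
    intro x
    have h1 := hc (SchwartzMap.compSubConstCLM ℂ x χ)
      (hχ.comp_homeomorph (Homeomorph.subRight x))
    have h2 : ∫ y : EuclideanSpace ℝ (Fin d), ((MvPolynomial.eval y P : ℝ) : ℂ) *
        (SchwartzMap.compSubConstCLM ℂ x χ) y = polyFun q x := by
      rw [hq, ← MeasureTheory.integral_add_right_eq_self _ x]
      refine MeasureTheory.integral_congr_ae (Filter.Eventually.of_forall fun u => ?_)
      simp only [SchwartzMap.compSubConstCLM_apply, add_sub_cancel_right]
      rfl
    rw [h2] at h1
    refine h1.congr_fun fun l => ?_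
    rw [hfx, integerShift]
    congr 2
    ext y
    simp only [SchwartzMap.compSubConstCLM_apply]
    congr 1
    change _ = y - -(intVec l) - x
    abel
  obtain ⟨C, hC⟩ := exists_hasSum_periodization hfc q (fun l => (c l : ℂ)) hsum
  have hz := integral_eq_zero_of_periodization (F := fun y => polyFun q (-y) * f y)
    (((continuous_polyFun q).comp continuous_neg).mul hf) hfc.mul_left hC hk0
  set w : EuclideanSpace ℝ (Fin d) → ℂ := fun y => expChar (-intVec k) y * f y with hw
  have hwc : Continuous w := (continuous_expChar _).mul hf
  have hws : HasCompactSupport w := hfc.mul_left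
  -- With `q(-y)` written as an average of `P(u - y)`, the integral over `y` becomes the moment
  -- functional at a reflected translate of `P`, whose value does not depend on `u`.
  have hswap : ∫ y, ∫ u, polyFun P (u - y) * χ u * w y =
      ∫ u, ∫ y, polyFun P (u - y) * χ u * w y := by
    refine MeasureTheory.integral_integral_swap_of_hasCompactSupport ?_ ?_
    · have h1 : Continuous fun z : EuclideanSpace ℝ (Fin d) × EuclideanSpace ℝ (Fin d) =>
          polyFun P (z.2 - z.1) := (continuous_polyFun P).comp (by fun_prop)
      exact (h1.mul (χ.continuous.comp continuous_snd)).mul (hwc.comp continuous_fst)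
    · refine HasCompactSupport.intro (hws.isCompact.prod hχ.isCompact) fun z hz => ?_
      rw [Set.mem_prod, not_and_or] at hz
      rcases hz with hz | hz
      · simp only [Function.uncurry, image_eq_zero_of_notMem_tsupport hz, mul_zero]
      · simp only [Function.uncurry, image_eq_zero_of_notMem_tsupport hz, mul_zero, zero_mul]
  have h1 : ∀ y, ∫ u, polyFun P (u - y) * χ u * w y =
      expChar (-intVec k) y * (polyFun q (-y) * f y) := by
    intro y
    rw [MeasureTheory.integral_mul_const, hq]
    simp only [hw, sub_eq_add_neg]
    ring
  have h2 : ∀ u, ∫ y, polyFun P (u - y) * χ u * w y =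
      (a * ellipticFunctional Q m P) * χ u := by
    intro u
    rw [← ellipticFunctional_polyReflect Q hPh u.ofLp, ← hmom (polyReflect u.ofLp P)
      ((totalDegree_bind₁_affine_le _ _ _).trans hPh.totalDegree_le),
      ← MeasureTheory.integral_mul_const]
    refine MeasureTheory.integral_congr_ae (Filter.Eventually.of_forall fun y => ?_)
    simp only [polyFun_polyReflect, hw]
    ring
  simp only [h1, h2] at hswap
  rw [hz, MeasureTheory.integral_const_mul, eq_comm] at hswap
  have h3 := (mul_eq_zero.1 ((mul_eq_zero.1 hswap).resolve_right hχi)).resolve_left ha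
  exact_mod_cast h3

/-- Components of degree below `2m` are annihilated by the operator; those above are sent to forms
of positive degree, which vanish at the origin. -/
lemma ellipticFunctional_homogeneousComponent (Q : Matrix (Fin d) (Fin d) ℝ) (m : ℕ)
    (P : MvPolynomial (Fin d) ℝ) :
    ellipticFunctional Q m P =
      ellipticFunctional Q m (MvPolynomial.homogeneousComponent (2 * m) P) := by
  have h0 : ∀ n, n ≠ 2 * m →
      ellipticFunctional Q m (MvPolynomial.homogeneousComponent n P) = 0 := by
    intro n hn
    have hh := MvPolynomial.homogeneousComponent_isHomogeneous n P
    rcases hn.lt_or_gt with hn | hn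
    · exact functional_eq_zero_of_linearForm_pow (N := n)
        (fun j hj η => ellipticFunctional_linearForm_pow_of_lt Q (hj.trans_lt hn) η)
        hh.totalDegree_le
    · rw [ellipticFunctional_apply]
      exact eval_zero_of_isHomogeneous_pos (isHomogeneous_ellipticOperator_pow Q hh m) (by omega)
  conv_lhs => rw [← MvPolynomial.sum_homogeneousComponent P, map_sum]
  rw [Finset.sum_eq_single (2 * m) (fun n _ hn => h0 n hn) fun hn => ?_]
  rw [MvPolynomial.homogeneousComponent_eq_zero _ _ (by simpa using hn), map_zero]

/-- The polynomials in the span of the shifts are in the kernel of the elliptic operator. -/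
lemma ellipticOperator_pow_eq_zero (hd : 0 < d) (hA : IsDilationMatrix A)
    (h : IsFactorization A Q U) (m : ℕ) {P : MvPolynomial (Fin d) ℝ}
    (hP : P ∈ polynomialsInSpan (ellipticScalingFunction hd hA h m)) :
    (ellipticOperator Q ^ m) P = 0 := by
  refine MvPolynomial.funext fun x => ?_
  -- Translating by `x` reduces the value at `x` to a value at the origin, which only the component
  -- of degree `2m` determines.
  have h1 := (isAffinelyInvariant_polynomialsInSpan hd hA h m).1 P hP x
  have h2 := ellipticFunctional_eq_zero_of_isHomogeneous hd hA h m
    (homogeneousComponent_mem_polynomialsInSpan hd hA h m h1 (2 * m))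
    (MvPolynomial.homogeneousComponent_isHomogeneous _ _)
  rw [← ellipticFunctional_homogeneousComponent, ellipticFunctional_apply] at h2
  have h3 : polyShift x P = MvPolynomial.bind₁
      (fun i => MvPolynomial.C 1 * MvPolynomial.X i + MvPolynomial.C (x i)) P := by
    simp only [map_one, one_mul]
    rfl
  rw [h3, ellipticOperator_pow_bind₁_affine, one_pow, one_pow, one_smul, eval_bind₁] at h2
  rw [map_zero, ← h2]
  congr 2
  funext i
  simp

end Kernel

end EllipticScaling

theorem mainTheorem1 {d : ℕ} (hd : 0 < d) (A : Matrix (Fin d) (Fin d) ℤ)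
    (hA : EllipticScaling.IsDilationMatrix A) (hiso : EllipticScaling.IsIsotropic A)
    (Q U : Matrix (Fin d) (Fin d) ℝ) (hQU : EllipticScaling.IsFactorization A Q U)
    (m : ℕ) (hm : 1 ≤ m) :
    (∀ P ∈ EllipticScaling.polynomialsInSpan
        (EllipticScaling.ellipticScalingFunction hd hA hQU m),
      (EllipticScaling.ellipticOperator Q ^ m) P = 0) ∧
    EllipticScaling.IsAffinelyInvariant
      (EllipticScaling.polynomialsInSpan
        (EllipticScaling.ellipticScalingFunction hd hA hQU m)) :=
  ⟨fun _ hP => EllipticScaling.ellipticOperator_pow_eq_zero hd hA hQU m hP,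
    EllipticScaling.isAffinelyInvariant_polynomialsInSpan hd hA hQU m⟩
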